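/- All logarithms, roots and powers are principal, with $\arg\in(-\pi,\pi]$. For $m\in\mathbb C$ put $$I_m(z)=\sum_{n\ge0}\frac{\sqrt\pi\,(z/2)^{2n+m+1/2}}{n!\,\Gamma(m+n+1)},\quad J_m(z)=\sum_{n\ge0}\frac{(-1)^n\sqrt\pi\,(z/2)^{2n+m+1/2}}{n!\,\Gamma(m+n+1)},$$ $$K_m(z)=\frac{I_{-m}(z)-I_m(z)}{\sin(\pi m)},\qquad H_m^\pm(z)=\pm i\,\frac{e^{\mp i\pi m}J_m(z)-J_{-m}(z)}{\sin(\pi m)},$$ where $K_m$ and $H_m^\pm$ are extended to $m\in\mathbb Z$ by continuity in $m$ (Bessel-type functions for dimension one). (1) Let $\beta\in\mathbb C$ with $\pm\operatorname{Im}\sqrt\beta>0$ and let $|\operatorname{Re}m|<1$. Then $x\mapsto\big((\beta x)^{1/4}H^\pm_{2m}(2\sqrt{\beta x})\big)^2$ is integrable on $(0,\infty)$ and $$\int_0^\infty\Big((\beta x)^{1/4}H^\pm_{2m}(2\sqrt{\beta x})\Big)^2dx=\frac{m(4m^2-1)\,e^{\mp 2i\pi m}}{3\beta\sin(2\pi m)},$$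 where for $m\in\{0,\pm\frac12\}$ the right-hand side is extended by continuity: it equals $-\frac1{6\pi\beta}$ for $m=0$ and $\frac1{3\pi\beta}$ for $m=\pm\frac12$. (2) Let $a,b\in\mathbb C\setminus(-\infty,0]$ with $\operatorname{Re}(a+b)>0$ and let $|\operatorname{Re}m|<1$. Then $x\mapsto x^2K_m(ax)K_m(bx)$ is integrable on $(0,\infty)$. If $a\ne b$ and $m\neq0$, then $$\int_0^\infty x^2K_m(ax)K_m(bx)\,dx=\frac{4a^{\frac12-m}b^{\frac12-m}\big\{(m-1)(a^{2m+2}-b^{2m+2})+(m+1)a^2b^2(b^{2m-2}-a^{2m-2})\big\}}{\sin(\pi m)\,(b^2-a^2)^3}.$$ In the limiting cases, for $a\neq b$, $$\int_0^\infty x^2K_0(ax)K_0(bx)\,dx=-\frac{8a^{\frac12}b^{\frac12}}{\pi(b^2-a^2)^2}+\frac{8a^{\frac12}b^{\frac12}(a^2+b^2)}{\pi(b^2-a^2)^3}\big(\ln b-\ln a\big),$$ and for $a=b$, $$\int_0^\infty x^2K_m(ax)^2\,dx=\frac{2m(1-m^2)}{3a^3\sin(\pi m)}\quad(m\ne0),\qquad\int_0^\infty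 x^2K_0(ax)^2\,dx=\frac{2}{3\pi a^3}.$$ -/

import Mathlib

open Complex Set Filter Topology MeasureTheory

noncomputable section

/-- The modified Bessel function for dimension one,
`I_m(z) = ∑ₙ √π (z/2)^(2n+m+1/2) / (n! Γ(m+n+1))`, with principal powers
(and `1 / Γ = 0` at the poles of `Γ`). -/
def besselI1 (m z : ℂ) : ℂ :=
  ∑' n : ℕ, ((Real.sqrt Real.pi : ℝ) : ℂ) * (z / 2) ^ (2 * (n : ℂ) + m + 1 / 2) /
    ((n.factorial : ℂ) * Complex.Gamma (m + (n : ℂ) + 1))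

/-- The standard Bessel function for dimension one,
`J_m(z) = ∑ₙ (-1)ⁿ √π (z/2)^(2n+m+1/2) / (n! Γ(m+n+1))`, with principal powers. -/
def besselJ1 (m z : ℂ) : ℂ :=
  ∑' n : ℕ, (-1 : ℂ) ^ n * ((Real.sqrt Real.pi : ℝ) : ℂ) *
    (z / 2) ^ (2 * (n : ℂ) + m + 1 / 2) /
      ((n.factorial : ℂ) * Complex.Gamma (m + (n : ℂ) + 1))

/-- Given an expression `f μ` in a complex parameter that is meaningful for `μ ∉ ℤ`,
extend it to integer parameters by continuity. -/
def extendToIntegers (f : ℂ → ℂ) (m : ℂ) : ℂ :=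
  open Classical in
  if ∃ n : ℤ, m = (n : ℂ) then limUnder (𝓝[≠] m) f else f m

/-- The MacDonald function for dimension one,
`K_m(z) = (I_{-m}(z) - I_m(z)) / sin(π m)`, extended by continuity to `m ∈ ℤ`. -/
def macdonaldK1 (m z : ℂ) : ℂ :=
  extendToIntegers
    (fun μ => (-besselI1 μ z + besselI1 (-μ) z) / Complex.sin ((Real.pi : ℂ) * μ)) m

/-- The Hankel functions for dimension one. For a sign `ε = ±1`,
`H^ε_m(z) = ε i (e^{-ε i π m} J_m(z) - J_{-m}(z)) / sin(π m)`, extended by continuity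
to `m ∈ ℤ`. -/
def hankelH1 (ε : ℤˣ) (m z : ℂ) : ℂ :=
  extendToIntegers
    (fun μ => ((ε : ℤ) : ℂ) * I *
      (Complex.exp (-(((ε : ℤ) : ℂ) * I * (Real.pi : ℂ) * μ)) * besselJ1 μ z - besselJ1 (-μ) z) /
        Complex.sin ((Real.pi : ℂ) * μ)) m

/-- The function `x ↦ (β x)^{1/4} H^ε_{2m}(2 √(β x))`, with principal root and power. -/
def zeroEnergySolution (ε : ℤˣ) (β m : ℂ) (x : ℝ) : ℂ :=
  (β * (x : ℂ)) ^ (1 / 4 : ℂ) * hankelH1 ε (2 * m) (2 * (β * (x : ℂ)) ^ (1 / 2 : ℂ))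

end

/-! Both integrals come down to one rational integral. Put `G_m(r) = ∫₀^∞ exp(-t - r²/t) t^(-m-1)
dt` (`besselG`). Then `K_m(2r) = π^(-1/2) r^(m+1/2) G_m(r)` for `r > 0` and `Re m > -1/2`, and `r^m
G_m(r)` is even in `m`. Use index `m` for the factor with `a` and `-m` for the factor with `b`: for
`a, b > 0` the integral becomes a multiple of `∫ x³ G_m(ax/2) G_{-m}(bx/2) dx`, a triple integral
over `s`, `sw` and `x`. The integral in `x` is Gaussian and the one in `s` is exponential, so only
`8/a⁴ · V(b²/a², m)` is left, where `V(c, m) = ∫₀^∞ w^(m+1) / ((1+w)² (w+c)²) dw` converges for `|Re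
m| < 2` (`integral_pow_three_mul_besselG_mul_besselG`).

For `-1 < Re m < 0`, partial fractions split `V` into Beta integrals, and the resulting identity
continues analytically to the whole strip (`rationalIntegral_eq`). The logarithm at `m = 0` appears
on differentiating that identity, and `c = 1`, the case `a = b`, is a Beta integral by itself.
Complex `a, b` are reached by the identity theorem in one variable at a time
(`integral_besselProd_eq_of_eq_ofReal`).

Continuation needs a form of `K_m` that is holomorphic in `z` and in `m` and has explicit decay.
This is `besselF`: `F_m(z) = e^(-z) / Γ(m+1/2) · ∫ e^(-t) (t(1 + t/(2z)))^(m-1/2) dt` for `Re m >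
-1/2`. On the positive axis a Fubini argument gives `F` in terms of `G`. The tie between `G` and the
power series comes from splitting the integral at `t = r` and expanding each half through incomplete
Gamma functions: the unwanted double series is odd in `m` and cancels in the sum
(`cpow_mul_besselG_eq_besselSeries`). Continuity of `F` in `m` then identifies the values of `K` at
integers. As `K` is even in its index, one may always take an index `μ = ±m` with `Re μ ≥ 0`.

Part (1) is the diagonal case at index `2m`: a Hankel function at `εi w` with `Re w > 0` is an
explicit multiple of `K(w)`, and `x = t²` produces `∫ t² K_{2m}(at)² dt` with `a = -2εi√β`. The
range `|Re m| < 1` there is exactly `|Re 2m| < 2`. -/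

/-! ### Holomorphy of parameter integrals -/

/-- For holomorphic integrands a local bound on the function suffices: the Cauchy estimate on
circles of radius `r` turns a bound `g` into the bound `g / r` for the derivative. -/
theorem differentiableOn_integral_of_locally_dominated {α : Type*} [MeasurableSpace α]
    {μ : Measure α} {U : Set ℂ} (hU : IsOpen U) {f : ℂ → α → ℂ}
    (hmeas : ∀ ζ ∈ U, AEStronglyMeasurable (f ζ) μ)
    (hdiff : ∀ᵐ x ∂μ, DifferentiableOn ℂ (fun ζ => f ζ x) U)
    (hbound : ∀ ζ₀ ∈ U, ∃ V ∈ 𝓝 ζ₀, ∃ g : α → ℝ, Integrable g μ ∧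
      ∀ᵐ x ∂μ, ∀ ζ ∈ V, ‖f ζ x‖ ≤ g x) :
    DifferentiableOn ℂ (fun ζ => ∫ x, f ζ x ∂μ) U := by
  intro ζ₀ hζ₀
  obtain ⟨V, hV, g, hg, hfg⟩ := hbound ζ₀ hζ₀
  obtain ⟨R, hR, hRsub⟩ := Metric.mem_nhds_iff.1 (inter_mem hV (hU.mem_nhds hζ₀))
  -- A third, so that closed discs of radius `r` centred within `r` of `ζ₀` stay inside the disc of
  -- radius `R`.
  set r : ℝ := R / 3 with hr
  have hr0 : 0 < r := by positivity
  have hsub : ∀ ζ ∈ Metric.ball ζ₀ r, Metric.closedBall ζ r ⊆ V ∩ U := by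
    intro ζ hζ w hw
    apply hRsub
    rw [Metric.mem_ball] at hζ ⊢
    rw [Metric.mem_closedBall] at hw
    have := dist_triangle w ζ ζ₀
    linarith
  have hself : ∀ ζ ∈ Metric.ball ζ₀ r, ζ ∈ V ∩ U := fun ζ hζ =>
    hsub ζ hζ (Metric.mem_closedBall_self hr0.le)
  have h0 : ζ₀ ∈ Metric.ball ζ₀ r := Metric.mem_ball_self hr0
  have hderiv : ∀ᵐ x ∂μ, ∀ ζ ∈ Metric.ball ζ₀ r,
      HasDerivAt (fun ζ => f ζ x) (deriv (fun ζ => f ζ x) ζ) ζ := by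
    filter_upwards [hdiff] with x hx ζ hζ
    exact (hx.differentiableAt (hU.mem_nhds (hself ζ hζ).2)).hasDerivAt
  have hmeas' : AEStronglyMeasurable (fun x => deriv (fun ζ => f ζ x) ζ₀) μ := by
    -- The derivative is measurable as a limit of difference quotients. The shift by 2 keeps every
    -- increment strictly shorter than `r`.
    let u : ℕ → ℂ := fun n => ((r / (n + 2) : ℝ) : ℂ)
    have hu0 : ∀ n, u n ≠ 0 := fun n => by
      have : r / ((n : ℝ) + 2) ≠ 0 := by positivity
      exact ofReal_ne_zero.2 this
    have hu : Tendsto u atTop (𝓝 0) := by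
      have : Tendsto (fun n : ℕ => r / ((n : ℝ) + 2)) atTop (𝓝 0) :=
        Tendsto.div_atTop tendsto_const_nhds
          (tendsto_atTop_add_const_right _ _ tendsto_natCast_atTop_atTop)
      exact (continuous_ofReal.tendsto' 0 0 ofReal_zero).comp this
    have hmem : ∀ n, ζ₀ + u n ∈ U := fun n => by
      refine (hself _ ?_).2
      rw [Metric.mem_ball, dist_eq_norm, add_sub_cancel_left, norm_real, Real.norm_eq_abs,
        abs_of_pos (by positivity)]
      rw [div_lt_iff₀ (by positivity)]
      have : (0 : ℝ) ≤ n := by positivity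
      nlinarith
    refine aestronglyMeasurable_of_tendsto_ae atTop
      (f := fun n x => (u n)⁻¹ • (f (ζ₀ + u n) x - f ζ₀ x)) (fun n => ?_) ?_
    · exact ((hmeas _ (hmem n)).sub (hmeas _ hζ₀)).const_smul ((u n)⁻¹)
    · filter_upwards [hderiv] with x hx
      have h1 := (hx ζ₀ h0).tendsto_slope_zero
      exact h1.comp (tendsto_nhdsWithin_iff.2 ⟨hu, Eventually.of_forall fun n => hu0 n⟩)
  refine (hasDerivAt_integral_of_dominated_loc_of_deriv_le (F := f)
    (F' := fun ζ x => deriv (fun ζ => f ζ x) ζ) (bound := fun x => g x / r)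
    (Metric.ball_mem_nhds ζ₀ hr0) ?_ ?_ hmeas' ?_ (hg.div_const r) ?_
    ).2.differentiableAt.differentiableWithinAt
  · filter_upwards [Metric.ball_mem_nhds ζ₀ hr0] with ζ hζ
    exact hmeas ζ (hself ζ hζ).2
  · refine hg.mono' (hmeas _ hζ₀) ?_
    filter_upwards [hfg] with x hx
    exact hx _ (hself _ h0).1
  · filter_upwards [hdiff, hfg] with x hx hx' ζ hζ
    refine Complex.norm_deriv_le_of_forall_mem_sphere_norm_le hr0 ?_ ?_
    · refine DifferentiableOn.diffContOnCl_ball (U := U) hx ?_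
      exact fun w hw => (hsub ζ hζ hw).2
    · exact fun w hw => hx' w (hsub ζ hζ (Metric.sphere_subset_closedBall hw)).1
  · filter_upwards [hderiv] with x hx ζ hζ
    exact hx ζ hζ

/-! ### The entire series behind the functions I and J -/

/-- The entire function `w ↦ ∑ wⁿ / (n! Γ(m+n+1))`. -/
noncomputable def besselSeries (m w : ℂ) : ℂ :=
  ∑' n : ℕ, w ^ n / ((n.factorial : ℂ) * Complex.Gamma (m + (n : ℂ) + 1))

/-- Once `|m + n + 1| ≥ 1`, the functional equation makes `1/|Γ(m+n+1)|` non-increasing in `n`, so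
finitely many terms control all of them. -/
theorem exists_norm_inv_Gamma_add_natCast_le (m : ℂ) :
    ∃ C : ℝ, ∀ n : ℕ, ‖(Complex.Gamma (m + (n : ℂ) + 1))⁻¹‖ ≤ C := by
  obtain ⟨N, hN⟩ := exists_nat_ge (‖m‖ + 1)
  have hstep : ∀ n : ℕ, N ≤ n → ‖(Complex.Gamma (m + ((n + 1 : ℕ) : ℂ) + 1))⁻¹‖ ≤
      ‖(Complex.Gamma (m + (n : ℂ) + 1))⁻¹‖ := by
    intro n hn
    have hn' : (N : ℝ) ≤ n := by exact_mod_cast hn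
    have h1 : 1 ≤ ‖m + (n : ℂ) + 1‖ := by
      have h2 := norm_sub_le (m + (n : ℂ) + 1) m
      have h3 : m + (n : ℂ) + 1 - m = ((n + 1 : ℕ) : ℂ) := by push_cast; ring
      rw [h3, Complex.norm_natCast] at h2
      push_cast at h2
      linarith
    have h0 : m + (n : ℂ) + 1 ≠ 0 := by
      intro h; rw [h, norm_zero] at h1; linarith
    have h4 : m + ((n + 1 : ℕ) : ℂ) + 1 = (m + (n : ℂ) + 1) + 1 := by push_cast; ring
    rw [h4, Complex.Gamma_add_one _ h0, mul_inv, norm_mul, norm_inv (m + (n : ℂ) + 1)]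
    exact mul_le_of_le_one_left (norm_nonneg _) (inv_le_one_of_one_le₀ h1)
  refine ⟨∑ k ∈ Finset.range (N + 1), ‖(Complex.Gamma (m + (k : ℂ) + 1))⁻¹‖, fun n => ?_⟩
  have hle : ∀ k ≤ N, ‖(Complex.Gamma (m + (k : ℂ) + 1))⁻¹‖ ≤
      ∑ k ∈ Finset.range (N + 1), ‖(Complex.Gamma (m + (k : ℂ) + 1))⁻¹‖ := fun k hk =>
    Finset.single_le_sum (f := fun k : ℕ => ‖(Complex.Gamma (m + (k : ℂ) + 1))⁻¹‖)
      (fun _ _ => norm_nonneg _) (Finset.mem_range.2 (by lia))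
  rcases le_total n N with h | h
  · exact hle n h
  · induction n, h using Nat.le_induction with
    | base => exact hle N le_rfl
    | succ n hn ih => exact (hstep n hn).trans ih

theorem exists_bound_besselSeries_term (m : ℂ) (R : ℝ) : ∃ u : ℕ → ℝ, Summable u ∧
    ∀ n : ℕ, ∀ w : ℂ, ‖w‖ ≤ R →
      ‖w ^ n / ((n.factorial : ℂ) * Complex.Gamma (m + (n : ℂ) + 1))‖ ≤ u n := by
  obtain ⟨C, hC⟩ := exists_norm_inv_Gamma_add_natCast_le m
  refine ⟨fun n => C * (R ^ n / n.factorial), (Real.summable_pow_div_factorial R).mul_left C,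
    fun n w hw => ?_⟩
  have hR : 0 ≤ R := (norm_nonneg _).trans hw
  rw [div_eq_mul_inv, mul_inv, norm_mul, norm_mul, norm_inv, norm_pow, Complex.norm_natCast]
  calc ‖w‖ ^ n * ((n.factorial : ℝ)⁻¹ * ‖(Complex.Gamma (m + (n : ℂ) + 1))⁻¹‖)
      ≤ R ^ n * ((n.factorial : ℝ)⁻¹ * C) := by gcongr; exact hC n
    _ = _ := by ring

theorem differentiable_besselSeries (m : ℂ) : Differentiable ℂ (besselSeries m) := by
  intro w₀
  obtain ⟨u, hu, hb⟩ := exists_bound_besselSeries_term m (‖w₀‖ + 1)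
  have h := differentiableOn_tsum_of_summable_norm
    (F := fun (n : ℕ) (w : ℂ) => w ^ n / ((n.factorial : ℂ) * Complex.Gamma (m + (n : ℂ) + 1)))
    hu (U := Metric.ball w₀ 1) (fun n => by fun_prop) Metric.isOpen_ball (fun n w hw => by
      refine hb n w ?_
      rw [Metric.mem_ball, dist_eq_norm] at hw
      have := norm_le_norm_add_norm_sub' w w₀
      linarith)
  exact h.differentiableAt (Metric.ball_mem_nhds _ one_pos)

theorem half_cpow_two_mul_nat_add {z : ℂ} (hz : z ≠ 0) (m : ℂ) (n : ℕ) :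
    (z / 2) ^ (2 * (n : ℂ) + m + 1 / 2) = (z / 2) ^ (m + 1 / 2) * (z ^ 2 / 4) ^ n := by
  have h2 : z / 2 ≠ 0 := div_ne_zero hz two_ne_zero
  rw [show 2 * (n : ℂ) + m + 1 / 2 = (m + 1 / 2) + ((2 * n : ℕ) : ℂ) by push_cast; ring,
    cpow_add _ _ h2, cpow_natCast, pow_mul]
  congr 2
  ring

theorem besselI1_eq {z : ℂ} (hz : z ≠ 0) (m : ℂ) :
    besselI1 m z = ((Real.sqrt Real.pi : ℝ) : ℂ) * (z / 2) ^ (m + 1 / 2) *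
      besselSeries m (z ^ 2 / 4) := by
  rw [besselI1, besselSeries, ← tsum_mul_left]
  refine tsum_congr fun n => ?_
  rw [half_cpow_two_mul_nat_add hz]
  ring

theorem besselJ1_eq {z : ℂ} (hz : z ≠ 0) (m : ℂ) :
    besselJ1 m z = ((Real.sqrt Real.pi : ℝ) : ℂ) * (z / 2) ^ (m + 1 / 2) *
      besselSeries m (-(z ^ 2 / 4)) := by
  rw [besselJ1, besselSeries, ← tsum_mul_left]
  refine tsum_congr fun n => ?_
  rw [half_cpow_two_mul_nat_add hz, neg_pow (z ^ 2 / 4)]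
  ring

theorem differentiableOn_besselI1 (m : ℂ) : DifferentiableOn ℂ (besselI1 m) slitPlane := by
  have h : DifferentiableOn ℂ (fun z => ((Real.sqrt Real.pi : ℝ) : ℂ) * (z / 2) ^ (m + 1 / 2) *
      besselSeries m (z ^ 2 / 4)) slitPlane := by
    intro z hz
    have h2 : z / 2 ∈ slitPlane := by
      rw [mem_slitPlane_iff] at hz ⊢
      simpa using hz
    have h3 : DifferentiableAt ℂ (fun z : ℂ => (z / 2) ^ (m + 1 / 2)) z :=
      DifferentiableAt.cpow (by fun_prop) (by fun_prop) h2
    have h4 : DifferentiableAt ℂ (fun z : ℂ => besselSeries m (z ^ 2 / 4)) z :=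
      (differentiable_besselSeries m _).comp z (by fun_prop)
    exact ((h3.const_mul _).mul h4).differentiableWithinAt
  exact h.congr fun z hz => besselI1_eq (slitPlane_ne_zero hz) m

/-! ### Upper incomplete Gamma functions at non-integer parameters -/

theorem continuousOn_ofReal_cpow_const (s : ℂ) :
    ContinuousOn (fun t : ℝ => (t : ℂ) ^ s) (Ioi 0) := fun t ht =>
  (continuousAt_ofReal_cpow_const t s (Or.inr (ne_of_gt ht))).continuousWithinAt

/-- Away from `0` a negative power is harmless: `t^(p-|p|) ≤ x^(p-|p|)` leaves a convergent Gamma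
integrand with exponent `|p|`. -/
theorem integrableOn_exp_neg_mul_rpow_Ioi {x : ℝ} (hx : 0 < x) (p : ℝ) :
    IntegrableOn (fun t => Real.exp (-t) * t ^ p) (Ioi x) := by
  have h := ((Real.GammaIntegral_convergent (s := |p| + 1) (by positivity)).mono_set
    (Ioi_subset_Ioi hx.le)).const_mul (x ^ (p - |p|))
  refine h.mono' ?_ ?_
  · refine ContinuousOn.aestronglyMeasurable (fun t ht => ?_) measurableSet_Ioi
    have : 0 < t := hx.trans ht
    exact (ContinuousAt.mul (by fun_prop)
      (Real.continuousAt_rpow_const _ _ (Or.inl this.ne'))).continuousWithinAt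
  · filter_upwards [ae_restrict_mem measurableSet_Ioi] with t ht
    have ht0 : 0 < t := hx.trans ht
    rw [Real.norm_of_nonneg (by positivity), add_sub_cancel_right]
    have h1 : t ^ p = t ^ (p - |p|) * t ^ |p| := by rw [← Real.rpow_add ht0]; ring_nf
    have h2 : t ^ (p - |p|) ≤ x ^ (p - |p|) :=
      Real.rpow_le_rpow_of_nonpos hx (le_of_lt ht) (by linarith [le_abs_self p])
    rw [h1]
    calc Real.exp (-t) * (t ^ (p - |p|) * t ^ |p|)
        ≤ Real.exp (-t) * (x ^ (p - |p|) * t ^ |p|) := by gcongr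
      _ = _ := by ring

theorem integrableOn_exp_neg_mul_cpow_Ioi {x : ℝ} (hx : 0 < x) (s : ℂ) :
    IntegrableOn (fun t : ℝ => ((Real.exp (-t) : ℝ) : ℂ) * (t : ℂ) ^ s) (Ioi x) := by
  refine (integrableOn_exp_neg_mul_rpow_Ioi hx s.re).mono' ?_ ?_
  · refine ContinuousOn.aestronglyMeasurable ?_ measurableSet_Ioi
    exact (by fun_prop : Continuous fun t : ℝ => ((Real.exp (-t) : ℝ) : ℂ)).continuousOn.mul
      ((continuousOn_ofReal_cpow_const s).mono (Ioi_subset_Ioi hx.le))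
  · filter_upwards [ae_restrict_mem measurableSet_Ioi] with t ht
    rw [norm_mul, norm_real, Real.norm_of_nonneg (Real.exp_pos _).le,
      norm_cpow_eq_rpow_re_of_pos (hx.trans ht)]

/-- The integers are closed in `ℂ`. The resulting gap bounds the denominators of the incomplete
Gamma series and of the double series uniformly. -/
theorem exists_pos_le_norm_add_intCast {s : ℂ} (hs : ∀ n : ℤ, s ≠ n) :
    ∃ δ : ℝ, 0 < δ ∧ ∀ n : ℤ, δ ≤ ‖s + n‖ := by
  have hmem : s ∈ (range ((↑) : ℤ → ℂ))ᶜ := by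
    rintro ⟨n, hn⟩
    exact hs n hn.symm
  obtain ⟨δ, hδ, hb⟩ := Metric.isOpen_iff.1
    (Complex.isClosedEmbedding_intCast.isClosed_range.isOpen_compl) s hmem
  refine ⟨δ, hδ, fun n => ?_⟩
  by_contra! h
  refine hb (a := ((-n : ℤ) : ℂ)) ?_ ⟨-n, rfl⟩
  rw [Metric.mem_ball, dist_comm, dist_eq_norm]
  simpa using h

theorem summable_incompleteGamma_series {x : ℝ} (hx : 0 < x) {s : ℂ} (hs : ∀ n : ℤ, s ≠ n) :
    Summable fun j : ℕ => (-1 : ℂ) ^ j * (x : ℂ) ^ (s + j) / ((j.factorial : ℂ) * (s + j)) := by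
  obtain ⟨δ, hδ, hb⟩ := exists_pos_le_norm_add_intCast hs
  refine Summable.of_norm_bounded
    (g := fun j : ℕ => x ^ s.re / δ * (x ^ j / j.factorial))
    ((Real.summable_pow_div_factorial x).mul_left _) fun j => ?_
  have h1 : δ ≤ ‖s + j‖ := by exact_mod_cast hb j
  rw [norm_div, norm_mul, norm_mul, norm_pow, norm_neg, norm_one, one_pow, one_mul,
    norm_cpow_eq_rpow_re_of_pos hx, add_re, natCast_re, Real.rpow_add hx, Real.rpow_natCast,
    Complex.norm_natCast, div_mul_div_comm, mul_comm (j.factorial : ℝ)]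
  gcongr

/-- Subtract the part over `(0, x]` from Euler's integral for `Γ(s)`; on that part the exponential
series may be integrated term by term. -/
theorem integral_exp_neg_mul_cpow_Ioi_of_re_pos {x : ℝ} (hx : 0 < x) {s : ℂ} (hs : 0 < s.re) :
    ∫ t : ℝ in Ioi x, ((Real.exp (-t) : ℝ) : ℂ) * (t : ℂ) ^ (s - 1) =
      Complex.Gamma s -
        ∑' j : ℕ, (-1 : ℂ) ^ j * (x : ℂ) ^ (s + j) / ((j.factorial : ℂ) * (s + j)) := by
  have hint := Complex.GammaIntegral_convergent hs
  have hsplit := setIntegral_union (μ := volume) (Ioc_disjoint_Ioi le_rfl) measurableSet_Ioi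
    (hint.mono_set (Ioc_subset_Ioi_self : Ioc 0 x ⊆ Ioi 0)) (hint.mono_set (Ioi_subset_Ioi hx.le))
  rw [Ioc_union_Ioi_eq_Ioi hx.le] at hsplit
  rw [Complex.Gamma_eq_integral hs, Complex.GammaIntegral, hsplit]
  suffices h : ∫ t in Ioc 0 x, ((Real.exp (-t) : ℝ) : ℂ) * (t : ℂ) ^ (s - 1) =
      ∑' j : ℕ, (-1 : ℂ) ^ j * (x : ℂ) ^ (s + j) / ((j.factorial : ℂ) * (s + j)) by
    rw [h]; ring
  have hre : ∀ j : ℕ, -1 < (s + j - 1).re := fun j => by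
    have : (0 : ℝ) ≤ j := by positivity
    simp only [sub_re, add_re, natCast_re, one_re]; linarith
  have hI : ∀ j : ℕ, IntegrableOn (fun t : ℝ => (t : ℂ) ^ (s + j - 1)) (Ioc 0 x) := fun j => by
    have := intervalIntegral.intervalIntegrable_cpow' (a := 0) (b := x) (hre j)
    rwa [intervalIntegrable_iff_integrableOn_Ioc_of_le hx.le] at this
  have hF : ∀ j : ℕ, IntegrableOn
      (fun t : ℝ => (-1 : ℂ) ^ j / (j.factorial : ℂ) * (t : ℂ) ^ (s + j - 1)) (Ioc 0 x) :=
    fun j => (hI j).const_mul _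
  have hsum := integral_tsum_of_summable_integral_norm hF ?_
  · rw [← integral_congr_ae, ← hsum]
    · refine tsum_congr fun j => ?_
      rw [integral_const_mul, ← intervalIntegral.integral_of_le hx.le,
        integral_cpow (Or.inl (hre j)), ofReal_zero, sub_add_cancel, zero_cpow, sub_zero]
      · field_simp
      · intro h
        have := congrArg re h
        simp only [add_re, natCast_re, zero_re] at this
        have : (0 : ℝ) ≤ j := by positivity
        linarith
    · filter_upwards [ae_restrict_mem measurableSet_Ioc] with t ht
      have ht0 : (t : ℂ) ≠ 0 := ofReal_ne_zero.2 ht.1.ne'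
      have : ∀ j : ℕ, (-1 : ℂ) ^ j / (j.factorial : ℂ) * (t : ℂ) ^ (s + j - 1) =
          (-(t : ℂ)) ^ j / (j.factorial : ℂ) * (t : ℂ) ^ (s - 1) := fun j => by
        rw [show s + (j : ℂ) - 1 = (s - 1) + j by ring, cpow_add _ _ ht0, cpow_natCast,
          neg_pow (t : ℂ)]
        ring
      simp_rw [this]
      rw [tsum_mul_right, ofReal_exp, Complex.exp_eq_exp_ℂ, NormedSpace.exp_eq_tsum_div]
      simp
  · refine Summable.of_nonneg_of_le (fun j => by positivity) (fun j => ?_)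
      ((Real.summable_pow_div_factorial x).mul_left (x ^ s.re / s.re))
    have : ∀ t ∈ Ioc 0 x, ‖(-1 : ℂ) ^ j / (j.factorial : ℂ) * (t : ℂ) ^ (s + j - 1)‖ =
        (j.factorial : ℝ)⁻¹ * t ^ (s.re + j - 1) := fun t ht => by
      rw [norm_mul, norm_div, norm_pow, norm_neg, norm_one, one_pow, Complex.norm_natCast,
        norm_cpow_eq_rpow_re_of_pos ht.1]
      simp
    rw [setIntegral_congr_fun measurableSet_Ioc this, integral_const_mul,
      ← intervalIntegral.integral_of_le hx.le, integral_rpow (Or.inl (by linarith)),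
      sub_add_cancel, Real.zero_rpow (by positivity), sub_zero, Real.rpow_add hx, Real.rpow_natCast]
    rw [div_mul_div_comm, mul_comm s.re, inv_mul_eq_div, div_div, mul_comm (s.re + j)]
    gcongr
    linarith

theorem integral_exp_neg_mul_cpow_Ioi_add_one {x : ℝ} (hx : 0 < x) (s : ℂ) (hs : s ≠ 0) :
    ∫ t : ℝ in Ioi x, ((Real.exp (-t) : ℝ) : ℂ) * (t : ℂ) ^ s =
      ((Real.exp (-x) : ℝ) : ℂ) * (x : ℂ) ^ s +
        s * ∫ t : ℝ in Ioi x, ((Real.exp (-t) : ℝ) : ℂ) * (t : ℂ) ^ (s - 1) := by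
  have hI1 := integrableOn_exp_neg_mul_cpow_Ioi hx s
  have hI2 := (integrableOn_exp_neg_mul_cpow_Ioi hx (s - 1)).const_mul s
  have h := integral_Ioi_of_hasDerivAt_of_tendsto' (a := x) (m := 0)
    (f := fun t : ℝ => ((Real.exp (-t) : ℝ) : ℂ) * (t : ℂ) ^ s)
    (f' := fun t : ℝ => s * (((Real.exp (-t) : ℝ) : ℂ) * (t : ℂ) ^ (s - 1)) -
      ((Real.exp (-t) : ℝ) : ℂ) * (t : ℂ) ^ s) ?_ (hI2.sub hI1) ?_
  · rw [integral_sub hI2 hI1, integral_const_mul] at h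
    linear_combination -h
  · intro t ht
    have ht0 : t ≠ 0 := (hx.trans_le ht).ne'
    have h1 : HasDerivAt (fun t : ℝ => ((Real.exp (-t) : ℝ) : ℂ))
        ((-Real.exp (-t) : ℝ) : ℂ) t := by
      have := (hasDerivAt_neg t).exp.ofReal_comp
      simpa using this
    refine (h1.mul (hasDerivAt_ofReal_cpow_const ht0 hs)).congr_deriv ?_
    push_cast
    ring
  · rw [tendsto_zero_iff_norm_tendsto_zero]
    refine (tendsto_rpow_mul_exp_neg_mul_atTop_nhds_zero s.re 1 one_pos).congr' ?_
    filter_upwards [eventually_gt_atTop 0] with t ht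
    rw [norm_mul, norm_real, Real.norm_of_nonneg (Real.exp_pos _).le,
      norm_cpow_eq_rpow_re_of_pos ht, mul_comm]
    simp

/-- The lower series obeys the recursion in `s` dictated by integration by parts: compare
coefficients after subtracting it from the series of `x^s e^(-x)`. -/
theorem incompleteGamma_series_add_one {x : ℝ} (hx : 0 < x) {s : ℂ} (hs : ∀ n : ℤ, s ≠ n) :
    s * ∑' j : ℕ, (-1 : ℂ) ^ j * (x : ℂ) ^ (s + j) / ((j.factorial : ℂ) * (s + j)) =
      ((Real.exp (-x) : ℝ) : ℂ) * (x : ℂ) ^ s +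
      ∑' j : ℕ, (-1 : ℂ) ^ j * (x : ℂ) ^ (s + 1 + j) / ((j.factorial : ℂ) * (s + 1 + j)) := by
  have hx0 : (x : ℂ) ≠ 0 := ofReal_ne_zero.2 hx.ne'
  have hs1 : ∀ n : ℤ, s + 1 ≠ n := fun n h => hs (n - 1) (by push_cast; linear_combination h)
  have hne : ∀ j : ℕ, s + j ≠ 0 := fun j h => hs (-j) (by push_cast; linear_combination h)
  have hexp : HasSum (fun j : ℕ => (x : ℂ) ^ s * ((-(x : ℂ)) ^ j / (j.factorial : ℂ)))
      ((x : ℂ) ^ s * ((Real.exp (-x) : ℝ) : ℂ)) := by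
    have := NormedSpace.expSeries_div_hasSum_exp (-(x : ℂ))
    rw [← Complex.exp_eq_exp_ℂ] at this
    rw [ofReal_exp, ofReal_neg]
    exact this.mul_left _
  have hshift : HasSum (fun j : ℕ => (x : ℂ) ^ s * ((-(x : ℂ)) ^ j / (j.factorial : ℂ)) -
      s * ((-1 : ℂ) ^ j * (x : ℂ) ^ (s + j) / ((j.factorial : ℂ) * (s + j))))
      ((x : ℂ) ^ s * ((Real.exp (-x) : ℝ) : ℂ) - s * ∑' j : ℕ,
        (-1 : ℂ) ^ j * (x : ℂ) ^ (s + j) / ((j.factorial : ℂ) * (s + j))) :=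
    hexp.sub ((summable_incompleteGamma_series hx hs).hasSum.mul_left s)
  -- The term of index 0 is `x^s - s · x^s / s = 0`, so it can be removed and the rest reindexed.
  rw [← hasSum_nat_add_iff' 1] at hshift
  have h2 := (summable_incompleteGamma_series hx hs1).hasSum.neg
  have h3 := hshift.unique (h2.congr_fun ?_)
  · simp only [Finset.range_one, Finset.sum_singleton] at h3
    have : s ≠ 0 := by simpa using hne 0
    simp only [pow_zero, Nat.factorial_zero, Nat.cast_one, Nat.cast_zero, add_zero,
      one_mul, div_one, mul_div_cancel₀ _ this] at h3
    linear_combination -h3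
  · intro j
    have e1 : (x : ℂ) ^ (s + ((j + 1 : ℕ) : ℂ)) = (x : ℂ) ^ s * (x : ℂ) ^ (j + 1) := by
      rw [cpow_add _ _ hx0, cpow_natCast]
    have e2 : (x : ℂ) ^ (s + 1 + (j : ℂ)) = (x : ℂ) ^ s * (x : ℂ) ^ (j + 1) := by
      rw [← e1]; push_cast; ring_nf
    rw [e1, e2, neg_pow (x : ℂ), Nat.factorial_succ]
    have hj := hne (j + 1)
    have hj' : s + 1 + (j : ℂ) ≠ 0 := by
      rw [add_right_comm, add_assoc]; exact_mod_cast hj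
    push_cast at hj ⊢
    field_simp
    ring

/-- All three terms satisfy compatible recursions under `s ↦ s + 1`, so the formula descends from
`Re s > 0` one unit at a time. -/
theorem integral_exp_neg_mul_cpow_Ioi {x : ℝ} (hx : 0 < x) {s : ℂ} (hs : ∀ n : ℤ, s ≠ n) :
    ∫ t : ℝ in Ioi x, ((Real.exp (-t) : ℝ) : ℂ) * (t : ℂ) ^ (s - 1) =
      Complex.Gamma s -
        ∑' j : ℕ, (-1 : ℂ) ^ j * (x : ℂ) ^ (s + j) / ((j.factorial : ℂ) * (s + j)) := by
  obtain ⟨N, hN⟩ := exists_nat_gt (-s.re)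
  induction N generalizing s with
  | zero =>
    exact integral_exp_neg_mul_cpow_Ioi_of_re_pos hx (by simpa using hN)
  | succ N ih =>
    have hs1 : ∀ n : ℤ, s + 1 ≠ n := fun n h => hs (n - 1) (by push_cast; linear_combination h)
    have hs0 : s ≠ 0 := by simpa using hs 0
    have h := ih hs1 (by push_cast at hN; simp; linarith)
    rw [add_sub_cancel_right, integral_exp_neg_mul_cpow_Ioi_add_one hx s hs0,
      Complex.Gamma_add_one s hs0] at h
    have h2 := incompleteGamma_series_add_one hx hs
    apply mul_left_cancel₀ hs0
    linear_combination h + h2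

/-! ### The integral G and its expansion in power series -/

/-- The integral `∫₀^∞ exp(-t - r²/t) t^(-m-1) dt`. -/
noncomputable def besselG (m : ℂ) (r : ℝ) : ℂ :=
  ∫ t in Ioi (0 : ℝ), ((Real.exp (-t - r ^ 2 / t) : ℝ) : ℂ) * (t : ℂ) ^ (-m - 1)

/-- The part of the integral `besselG` over `(r, ∞)`. -/
noncomputable def besselTail (m : ℂ) (r : ℝ) : ℂ :=
  ∫ t in Ioi r, ((Real.exp (-t - r ^ 2 / t) : ℝ) : ℂ) * (t : ℂ) ^ (-m - 1)

theorem continuousOn_besselG_integrand (m : ℂ) (r : ℝ) :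
    ContinuousOn (fun t : ℝ => ((Real.exp (-t - r ^ 2 / t) : ℝ) : ℂ) * (t : ℂ) ^ (-m - 1))
      (Ioi 0) := by
  refine ContinuousOn.mul ?_ (continuousOn_ofReal_cpow_const _)
  refine continuous_ofReal.comp_continuousOn (Real.continuous_exp.comp_continuousOn ?_)
  exact continuousOn_neg.sub (continuousOn_const.div continuousOn_id fun t ht => (ne_of_gt ht))

theorem integrableOn_besselTail_integrand (m : ℂ) {r : ℝ} (hr : 0 < r) :
    IntegrableOn (fun t : ℝ => ((Real.exp (-t - r ^ 2 / t) : ℝ) : ℂ) * (t : ℂ) ^ (-m - 1))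
      (Ioi r) := by
  refine (integrableOn_exp_neg_mul_rpow_Ioi hr (-m - 1).re).mono'
    (((continuousOn_besselG_integrand m r).mono (Ioi_subset_Ioi hr.le)).aestronglyMeasurable
      measurableSet_Ioi) ?_
  filter_upwards [ae_restrict_mem measurableSet_Ioi] with t ht
  have ht0 : 0 < t := hr.trans ht
  rw [norm_mul, norm_real, Real.norm_of_nonneg (Real.exp_pos _).le,
    norm_cpow_eq_rpow_re_of_pos ht0]
  gcongr
  have : 0 ≤ r ^ 2 / t := by positivity
  linarith

/-- The inversion `u ↦ r²/u` preserves `t + r²/t`, and so folds the part of `G` near `0` onto a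
second tail over `(r, ∞)`. -/
theorem image_sq_div_Ioi {r : ℝ} (hr : 0 < r) : (fun u => r ^ 2 / u) '' Ioi r = Ioo 0 r := by
  ext t
  constructor
  · rintro ⟨u, hu, rfl⟩
    have hu0 : 0 < u := hr.trans hu
    refine ⟨by positivity, ?_⟩
    change r ^ 2 / u < r
    rw [div_lt_iff₀ hu0, sq]
    exact mul_lt_mul_of_pos_left hu hr
  · rintro ⟨h0, h1⟩
    refine ⟨r ^ 2 / t, ?_, by field_simp⟩
    rw [mem_Ioi, lt_div_iff₀ h0, sq]
    exact mul_lt_mul_of_pos_left h1 hr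

theorem hasDerivWithinAt_sq_div {r : ℝ} (hr : 0 < r) :
    ∀ u ∈ Ioi r, HasDerivWithinAt (fun u => r ^ 2 / u) (-(r ^ 2 / u ^ 2)) (Ioi r) u := by
  intro u hu
  have hu0 : u ≠ 0 := (hr.trans hu).ne'
  have := ((hasDerivAt_inv hu0).const_mul (r ^ 2)).hasDerivWithinAt (s := Ioi r)
  simpa [div_eq_mul_inv] using this

theorem injOn_sq_div {r : ℝ} (hr : 0 < r) : InjOn (fun u => r ^ 2 / u) (Ioi r) := by
  intro u hu v hv h
  have hu0 : u ≠ 0 := (hr.trans hu).ne'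
  have hv0 : v ≠ 0 := (hr.trans hv).ne'
  simp only at h
  field_simp at h
  exact h.symm

theorem besselG_integrand_comp_sq_div (m : ℂ) {r : ℝ} (hr : 0 < r) :
    ∀ u ∈ Ioi r, |(-(r ^ 2 / u ^ 2))| • (((Real.exp (-(r ^ 2 / u) - r ^ 2 / (r ^ 2 / u)) : ℝ) : ℂ) *
      ((r ^ 2 / u : ℝ) : ℂ) ^ (-m - 1)) = (r : ℂ) ^ (-2 * m) *
        (((Real.exp (-u - r ^ 2 / u) : ℝ) : ℂ) * (u : ℂ) ^ (- -m - 1)) := by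
  intro u hu
  have hu0 : 0 < u := hr.trans hu
  have hr0 := hr.ne'
  have hrc : (r : ℂ) ≠ 0 := ofReal_ne_zero.2 hr0
  have huc : (u : ℂ) ≠ 0 := ofReal_ne_zero.2 hu0.ne'
  have e1 : -(r ^ 2 / u) - r ^ 2 / (r ^ 2 / u) = -u - r ^ 2 / u := by field_simp; ring
  have e2 : ((r ^ 2 / u : ℝ) : ℂ) ^ (-m - 1) = (r : ℂ) ^ (-2 * m) * (r : ℂ) ^ (-2 : ℂ) *
      ((u : ℂ) ^ (- -m - 1) * (u : ℂ) ^ (2 : ℂ)) := by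
    rw [← cpow_add _ _ hrc, ← cpow_add _ _ huc, cpow_def_of_ne_zero hrc, cpow_def_of_ne_zero huc,
      cpow_def_of_ne_zero (ofReal_ne_zero.2 (by positivity)), ← Complex.exp_add,
      ← ofReal_log (by positivity), ← ofReal_log hr.le, ← ofReal_log hu0.le,
      Real.log_div (by positivity) hu0.ne', Real.log_pow]
    push_cast
    ring_nf
  rw [e1, e2, abs_neg, abs_of_pos (by positivity), real_smul, cpow_neg,
    show (2 : ℂ) = ((2 : ℕ) : ℂ) by norm_num, cpow_natCast, cpow_natCast]
  push_cast
  field_simp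

theorem integrableOn_besselG_integrand (m : ℂ) {r : ℝ} (hr : 0 < r) :
    IntegrableOn (fun t : ℝ => ((Real.exp (-t - r ^ 2 / t) : ℝ) : ℂ) * (t : ℂ) ^ (-m - 1))
      (Ioi 0) := by
  rw [← Ioc_union_Ioi_eq_Ioi hr.le, integrableOn_union]
  refine ⟨?_, integrableOn_besselTail_integrand m hr⟩
  rw [integrableOn_Ioc_iff_integrableOn_Ioo, ← image_sq_div_Ioi hr,
    integrableOn_image_iff_integrableOn_abs_deriv_smul measurableSet_Ioi
      (hasDerivWithinAt_sq_div hr) (injOn_sq_div hr),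
    integrableOn_congr_fun (besselG_integrand_comp_sq_div m hr) measurableSet_Ioi]
  exact (integrableOn_besselTail_integrand (-m) hr).const_mul _

/-- The inversion reverses the sign of `m` in the power of `t`. Working with tails only is what
allows arbitrary complex `m` later: no convergence question arises at `0`. -/
theorem besselG_eq_tail_add_tail (m : ℂ) {r : ℝ} (hr : 0 < r) :
    besselG m r = besselTail m r + (r : ℂ) ^ (-2 * m) * besselTail (-m) r := by
  have h := integrableOn_besselG_integrand m hr
  have hsplit := setIntegral_union (μ := volume) (Ioc_disjoint_Ioi le_rfl) measurableSet_Ioi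
    (h.mono_set (Ioc_subset_Ioi_self : Ioc 0 r ⊆ Ioi 0)) (h.mono_set (Ioi_subset_Ioi hr.le))
  rw [Ioc_union_Ioi_eq_Ioi hr.le] at hsplit
  rw [besselG, hsplit, add_comm, besselTail, besselTail, integral_Ioc_eq_integral_Ioo,
    ← image_sq_div_Ioi hr,
    integral_image_eq_integral_abs_deriv_smul measurableSet_Ioi
      (hasDerivWithinAt_sq_div hr) (injOn_sq_div hr),
    setIntegral_congr_fun measurableSet_Ioi (besselG_integrand_comp_sq_div m hr),
    integral_const_mul]

theorem cpow_mul_besselG {r : ℝ} (hr : 0 < r) (m : ℂ) :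
    (r : ℂ) ^ m * besselG m r =
      (r : ℂ) ^ m * besselTail m r + (r : ℂ) ^ (-m) * besselTail (-m) r := by
  have hrc : (r : ℂ) ≠ 0 := ofReal_ne_zero.2 hr.ne'
  rw [besselG_eq_tail_add_tail m hr, mul_add, ← mul_assoc, ← cpow_add _ _ hrc]
  ring_nf

theorem cpow_mul_besselG_neg {r : ℝ} (hr : 0 < r) (m : ℂ) :
    (r : ℂ) ^ (-m) * besselG (-m) r = (r : ℂ) ^ m * besselG m r := by
  rw [cpow_mul_besselG hr, cpow_mul_besselG hr, neg_neg, add_comm]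

/-- Expand `exp(-r²/t)`. On `t > r` one has `(r²/t)^k ≤ r^k`, so the `k`-th term is dominated by
`r^k / k!` times a fixed integrable function. -/
theorem hasSum_besselTail {r : ℝ} (hr : 0 < r) (m : ℂ) :
    HasSum (fun k : ℕ => (-(r : ℂ) ^ 2) ^ k / (k.factorial : ℂ) *
      ∫ t in Ioi r, ((Real.exp (-t) : ℝ) : ℂ) * (t : ℂ) ^ ((-m - k) - 1)) (besselTail m r) := by
  have hF : ∀ k : ℕ, IntegrableOn (fun t : ℝ => (-(r : ℂ) ^ 2) ^ k / (k.factorial : ℂ) *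
      (((Real.exp (-t) : ℝ) : ℂ) * (t : ℂ) ^ ((-m - k) - 1))) (Ioi r) := fun k =>
    (integrableOn_exp_neg_mul_cpow_Ioi hr _).const_mul _
  have hS : Summable fun k : ℕ => ∫ t in Ioi r, ‖(-(r : ℂ) ^ 2) ^ k / (k.factorial : ℂ) *
      (((Real.exp (-t) : ℝ) : ℂ) * (t : ℂ) ^ ((-m - k) - 1))‖ := by
    refine Summable.of_nonneg_of_le (fun k => integral_nonneg fun t => norm_nonneg _)
      (fun k => ?_) ((Real.summable_pow_div_factorial r).mul_right
        (∫ t in Ioi r, Real.exp (-t) * t ^ (-m - 1).re))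
    rw [← integral_const_mul]
    refine setIntegral_mono_on (hF k).norm ((integrableOn_exp_neg_mul_rpow_Ioi hr _).const_mul _)
      measurableSet_Ioi fun t ht => ?_
    have ht0 : 0 < t := hr.trans ht
    rw [norm_mul, norm_mul, norm_real, Real.norm_of_nonneg (Real.exp_pos _).le,
      norm_cpow_eq_rpow_re_of_pos ht0, norm_div, norm_pow, norm_neg, norm_pow, norm_real,
      Real.norm_of_nonneg hr.le, Complex.norm_natCast,
      show (-m - k - 1).re = (-m - 1).re - k by simp; ring, Real.rpow_sub ht0, Real.rpow_natCast]
    have h1 : (r ^ 2) ^ k / t ^ k ≤ r ^ k := by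
      rw [← div_pow]
      gcongr
      rw [div_le_iff₀ ht0, sq]
      exact mul_le_mul_of_nonneg_left (le_of_lt (show r < t from ht)) hr.le
    calc (r ^ 2) ^ k / k.factorial * (Real.exp (-t) * (t ^ (-m - 1).re / t ^ k))
        = ((r ^ 2) ^ k / t ^ k) / k.factorial * (Real.exp (-t) * t ^ (-m - 1).re) := by ring
      _ ≤ _ := by gcongr
  have h := hasSum_integral_of_summable_integral_norm hF hS
  simp_rw [integral_const_mul] at h
  refine (?_ : besselTail m r = _) ▸ h
  refine setIntegral_congr_fun measurableSet_Ioi fun t ht => ?_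
  have ht0 : 0 < t := hr.trans ht
  have htc : (t : ℂ) ≠ 0 := ofReal_ne_zero.2 ht0.ne'
  have : ∀ k : ℕ, (-(r : ℂ) ^ 2) ^ k / (k.factorial : ℂ) *
      (((Real.exp (-t) : ℝ) : ℂ) * (t : ℂ) ^ ((-m - k) - 1)) =
      (-(r : ℂ) ^ 2 / t) ^ k / (k.factorial : ℂ) *
      (((Real.exp (-t) : ℝ) : ℂ) * (t : ℂ) ^ (-m - 1)) := fun k => by
    rw [show -m - (k : ℂ) - 1 = (-m - 1) - k by ring, cpow_sub _ _ htc, cpow_natCast, div_pow]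
    ring
  simp_rw [this]
  rw [tsum_mul_right, sub_eq_add_neg, Real.exp_add, mul_comm (Real.exp (-t)),
    show -(r ^ 2 / t) = -r ^ 2 / t by ring]
  push_cast
  rw [Complex.exp_eq_exp_ℂ, NormedSpace.exp_eq_tsum_div, mul_assoc]

/-- The reflection formula, with the sign `(-1)^k` from the antiperiodicity of the sine. It turns
the complete Gamma parts of the tail into the coefficients of `besselSeries`. -/
theorem Gamma_neg_sub_natCast {m : ℂ} (hm : ∀ n : ℤ, m ≠ n) (k : ℕ) :
    (-1 : ℂ) ^ k * Complex.Gamma (-m - k) =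
      -((Real.pi : ℂ) / Complex.sin ((Real.pi : ℂ) * m)) / Complex.Gamma (m + k + 1) := by
  have hG : Complex.Gamma (m + k + 1) ≠ 0 := Complex.Gamma_ne_zero fun n h =>
    hm (-n - k - 1) (by push_cast; linear_combination h)
  have h := Complex.Gamma_mul_Gamma_one_sub (-m - k)
  rw [show 1 - (-m - (k : ℂ)) = m + k + 1 by ring,
    show (Real.pi : ℂ) * (-m - k) = -((Real.pi : ℂ) * m + k * Real.pi) by ring, Complex.sin_neg,
    Complex.sin_antiperiodic.add_nat_mul_eq] at h
  rw [eq_div_iff hG, mul_assoc, h]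
  rcases neg_one_pow_eq_or ℂ k with h1 | h1 <;> rw [h1] <;> simp [div_neg]

/-- The general term of an absolutely convergent double series, antisymmetric under exchanging the
indices together with `m ↦ -m`. -/
noncomputable def besselDoubleTerm (m : ℂ) (r : ℝ) (k j : ℕ) : ℂ :=
  (-(r : ℂ)) ^ k / (k.factorial : ℂ) * ((-(r : ℂ)) ^ j / (j.factorial : ℂ)) / (j - k - m)

theorem summable_besselDoubleTerm {r : ℝ} (hr : 0 < r) {m : ℂ} (hm : ∀ n : ℤ, m ≠ n) :
    Summable (Function.uncurry (besselDoubleTerm m r)) := by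
  obtain ⟨δ, hδ, hb⟩ := exists_pos_le_norm_add_intCast hm
  have hs := Real.summable_pow_div_factorial r
  refine Summable.of_norm_bounded (g := fun p : ℕ × ℕ =>
    (r ^ p.1 / p.1.factorial) * (r ^ p.2 / p.2.factorial) / δ)
    ((hs.mul_of_nonneg hs (fun n => by positivity) (fun n => by positivity)).div_const δ) ?_
  rintro ⟨k, j⟩
  have h1 : δ ≤ ‖(j : ℂ) - k - m‖ := by
    rw [← norm_neg]
    have := hb (k - j)
    rwa [show m + ((k - j : ℤ) : ℂ) = -((j : ℂ) - k - m) by push_cast; ring] at this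
  simp only [Function.uncurry_apply_pair, besselDoubleTerm]
  simp only [norm_div, norm_mul, norm_pow, norm_neg, norm_real, Real.norm_of_nonneg hr.le,
    Complex.norm_natCast]
  gcongr

theorem tsum_besselDoubleTerm_neg {r : ℝ} (hr : 0 < r) {m : ℂ} (hm : ∀ n : ℤ, m ≠ n) :
    ∑' k, ∑' j, besselDoubleTerm (-m) r k j = -∑' k, ∑' j, besselDoubleTerm m r k j := by
  have h : ∀ k j, besselDoubleTerm (-m) r k j = -besselDoubleTerm m r j k := fun k j => by
    rw [besselDoubleTerm, besselDoubleTerm, show (j : ℂ) - k - -m = -(k - j - m) by ring, div_neg,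
      mul_comm ((-(r : ℂ)) ^ k / (k.factorial : ℂ))]
  simp_rw [h, tsum_neg]
  rw [(summable_besselDoubleTerm hr hm).tsum_comm]

/-- Each incomplete Gamma function in the expansion splits into `Γ(-m-k)`, which sums to a Bessel
series, and a lower series, which sums to the double series. -/
theorem cpow_mul_besselTail {r : ℝ} (hr : 0 < r) {m : ℂ} (hm : ∀ n : ℤ, m ≠ n) :
    (r : ℂ) ^ m * besselTail m r =
      -((Real.pi : ℂ) / Complex.sin ((Real.pi : ℂ) * m)) *
          ((r : ℂ) ^ m * besselSeries m ((r : ℂ) ^ 2)) -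
        ∑' k, ∑' j, besselDoubleTerm m r k j := by
  have hrc : (r : ℂ) ≠ 0 := ofReal_ne_zero.2 hr.ne'
  obtain ⟨u, hu, hub⟩ := exists_bound_besselSeries_term m ‖(r : ℂ) ^ 2‖
  have hA : HasSum (fun k : ℕ => -((Real.pi : ℂ) / Complex.sin ((Real.pi : ℂ) * m)) *
      ((r : ℂ) ^ m * (((r : ℂ) ^ 2) ^ k / ((k.factorial : ℂ) * Complex.Gamma (m + k + 1)))))
      (-((Real.pi : ℂ) / Complex.sin ((Real.pi : ℂ) * m)) *
          ((r : ℂ) ^ m * besselSeries m ((r : ℂ) ^ 2))) :=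
    ((Summable.of_norm_bounded hu fun n => hub n _ le_rfl).hasSum.mul_left _).mul_left _
  have hB : HasSum (fun k : ℕ => ∑' j, besselDoubleTerm m r k j)
      (∑' k, ∑' j, besselDoubleTerm m r k j) :=
    (summable_besselDoubleTerm hr hm).prod.hasSum
  refine ((hasSum_besselTail hr m).mul_left ((r : ℂ) ^ m)).unique ((hA.sub hB).congr_fun ?_)
  intro k
  have hmk : ∀ n : ℤ, -m - k ≠ n := fun n h => hm (-n - k) (by push_cast; linear_combination -h)
  rw [integral_exp_neg_mul_cpow_Ioi hr hmk]
  have h1 := Gamma_neg_sub_natCast hm k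
  have h2 : (r : ℂ) ^ m * ((-(r : ℂ) ^ 2) ^ k / (k.factorial : ℂ)) *
      ∑' j : ℕ, (-1 : ℂ) ^ j * (r : ℂ) ^ (-m - k + j) / ((j.factorial : ℂ) * (-m - k + j)) =
      ∑' j, besselDoubleTerm m r k j := by
    rw [← tsum_mul_left]
    refine tsum_congr fun j => ?_
    rw [besselDoubleTerm, cpow_add _ _ hrc, cpow_sub _ _ hrc, cpow_neg, cpow_natCast, cpow_natCast,
      show (j : ℂ) - k - m = -m - k + j by ring, neg_pow, neg_pow (r : ℂ), neg_pow (r : ℂ) j]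
    have : (r : ℂ) ^ m ≠ 0 := by simp [cpow_eq_zero_iff, hrc]
    field_simp
    rw [← pow_mul, ← pow_mul, mul_comm]
  rw [← h2]
  have h3 : (-(r : ℂ) ^ 2) ^ k * Complex.Gamma (-m - k) = ((r : ℂ) ^ 2) ^ k *
      (-((Real.pi : ℂ) / Complex.sin ((Real.pi : ℂ) * m)) / Complex.Gamma (m + k + 1)) := by
    rw [← h1, neg_pow]; ring
  rw [mul_sub, mul_sub, ← mul_assoc, ← mul_assoc ((r : ℂ) ^ m)]
  congr 1
  calc _ = (r : ℂ) ^ m / (k.factorial : ℂ) * ((-(r : ℂ) ^ 2) ^ k * Complex.Gamma (-m - k)) := by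
        ring
    _ = _ := by rw [h3]; ring

/-- Adding the tails for `m` and `-m` cancels the antisymmetric double series. -/
theorem cpow_mul_besselG_eq_besselSeries {r : ℝ} (hr : 0 < r) {m : ℂ} (hm : ∀ n : ℤ, m ≠ n) :
    (r : ℂ) ^ m * besselG m r = (Real.pi : ℂ) / Complex.sin ((Real.pi : ℂ) * m) *
      ((r : ℂ) ^ (-m) * besselSeries (-m) ((r : ℂ) ^ 2) -
        (r : ℂ) ^ m * besselSeries m ((r : ℂ) ^ 2)) := by
  have hm' : ∀ n : ℤ, -m ≠ n := fun n h => hm (-n) (by push_cast; linear_combination -h)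
  rw [cpow_mul_besselG hr, cpow_mul_besselTail hr hm, cpow_mul_besselTail hr hm',
    tsum_besselDoubleTerm_neg hr hm, mul_neg, Complex.sin_neg, div_neg]
  ring

/-! ### The elementary case of index -1/2 -/

/-- Legendre's duplication formula combines `n! Γ(n+1/2)` into `(2n)!` up to a power of 2 and `√π`.
-/
theorem besselSeries_neg_half (r : ℂ) :
    besselSeries (-(1 / 2)) (r ^ 2) =
      ((Real.sqrt Real.pi : ℝ) : ℂ)⁻¹ * Complex.cosh (2 * r) := by
  rw [besselSeries, ← (Complex.hasSum_cosh (2 * r)).tsum_eq, ← tsum_mul_left]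
  refine tsum_congr fun n => ?_
  have h := Complex.Gamma_mul_Gamma_add_half ((n : ℂ) + 1 / 2)
  rw [show (n : ℂ) + 1 / 2 + 1 / 2 = n + 1 by ring, Complex.Gamma_nat_eq_factorial,
    show 2 * ((n : ℂ) + 1 / 2) = ((2 * n : ℕ) : ℂ) + 1 by push_cast; ring,
    Complex.Gamma_nat_eq_factorial,
    show 1 - (((2 * n : ℕ) : ℂ) + 1) = -((2 * n : ℕ) : ℂ) by ring, cpow_neg, cpow_natCast] at h
  rw [show -(1 / 2) + (n : ℂ) + 1 = n + 1 / 2 by ring, mul_comm (n.factorial : ℂ), h, mul_pow,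
    ← pow_mul]
  field_simp

theorem besselSeries_half {r : ℂ} (hr : r ≠ 0) :
    besselSeries (1 / 2) (r ^ 2) =
      ((Real.sqrt Real.pi : ℝ) : ℂ)⁻¹ * Complex.sinh (2 * r) / r := by
  rw [besselSeries, ← (Complex.hasSum_sinh (2 * r)).tsum_eq, ← tsum_mul_left, ← tsum_div_const]
  refine tsum_congr fun n => ?_
  have h := Complex.Gamma_mul_Gamma_add_half ((n : ℂ) + 1)
  rw [Complex.Gamma_nat_eq_factorial,
    show 2 * ((n : ℂ) + 1) = ((2 * n + 1 : ℕ) : ℂ) + 1 by push_cast; ring,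
    Complex.Gamma_nat_eq_factorial,
    show 1 - (((2 * n + 1 : ℕ) : ℂ) + 1) = -((2 * n + 1 : ℕ) : ℂ) by ring, cpow_neg,
    cpow_natCast] at h
  rw [show 1 / 2 + (n : ℂ) + 1 = n + 1 + 1 / 2 by ring, h, mul_pow, ← pow_mul, pow_succ r]
  field_simp

theorem ne_intCast_of_two_mul_eq_neg_one {m : ℂ} (hm : 2 * m = -1) : ∀ n : ℤ, m ≠ n := by
  rintro n rfl
  have : 2 * n = -1 := by exact_mod_cast hm
  lia

/-- The difference `cosh - sinh` collapses to an exponential. This is the inner integral needed for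
the Fubini argument in `besselF_ofReal`. -/
theorem besselG_neg_half {r : ℝ} (hr : 0 < r) :
    besselG (-(1 / 2)) r = ((Real.sqrt Real.pi * Real.exp (-(2 * r)) : ℝ) : ℂ) := by
  have hrc : (r : ℂ) ≠ 0 := ofReal_ne_zero.2 hr.ne'
  have h := cpow_mul_besselG_eq_besselSeries hr
    (ne_intCast_of_two_mul_eq_neg_one (m := -(1 / 2)) (by norm_num))
  have hs : Complex.sin ((Real.pi : ℂ) * -(1 / 2)) = -1 := by
    rw [show (Real.pi : ℂ) * -(1 / 2) = -((Real.pi : ℂ) / 2) by ring, Complex.sin_neg,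
      Complex.sin_pi_div_two]
  have hp : ((Real.sqrt Real.pi : ℝ) : ℂ) * ((Real.sqrt Real.pi : ℝ) : ℂ) = (Real.pi : ℂ) := by
    rw [← ofReal_mul, Real.mul_self_sqrt Real.pi_pos.le]
  have h2 : (r : ℂ) ^ (-(1 / 2) : ℂ) ≠ 0 := by simp [cpow_eq_zero_iff, hrc]
  have h3 : (r : ℂ) ^ (1 / 2 : ℂ) = r * (r : ℂ) ^ (-(1 / 2) : ℂ) := by
    conv_rhs => rw [← cpow_one (r : ℂ), cpow_one, mul_comm]
    nth_rewrite 3 [← cpow_one (r : ℂ)]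
    rw [← cpow_add _ _ hrc]
    norm_num
  rw [hs, neg_neg, besselSeries_neg_half, besselSeries_half hrc, h3] at h
  apply mul_left_cancel₀ h2
  rw [h, ofReal_mul, ofReal_exp, ← hp]
  push_cast
  rw [← Complex.cosh_sub_sinh]
  field_simp
  ring

theorem integral_exp_mul_rpow_neg_half {r s : ℝ} (hr : 0 < r) (hs : 0 < s) :
    ∫ t in Ioi (0 : ℝ), ((Real.exp (-(t * s) - r ^ 2 / t) : ℝ) : ℂ) * (t : ℂ) ^ (-(1 / 2) : ℂ) =
      ((Real.sqrt Real.pi * Real.exp (-(2 * (r * √s))) / √s : ℝ) : ℂ) := by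
  have hs2 : 0 < √s := Real.sqrt_pos.2 hs
  have hss : √s * √s = s := Real.mul_self_sqrt hs.le
  have h := besselG_neg_half (mul_pos hr hs2)
  rw [besselG, ← mul_zero s, ← integral_comp_mul_left_Ioi' _ _ hs] at h
  have h2 : ∀ t ∈ Ioi (0 : ℝ), ((Real.exp (-(s * t) - (r * √s) ^ 2 / (s * t)) : ℝ) : ℂ) *
      ((s * t : ℝ) : ℂ) ^ (-(-(1 / 2)) - 1 : ℂ) = ((√s)⁻¹ : ℂ) *
      (((Real.exp (-(t * s) - r ^ 2 / t) : ℝ) : ℂ) * (t : ℂ) ^ (-(1 / 2) : ℂ)) := by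
    intro t ht
    have ht0 : 0 < t := ht
    rw [ofReal_mul, mul_cpow_ofReal_nonneg hs.le ht0.le,
      show (r * √s) ^ 2 / (s * t) = r ^ 2 / t by rw [mul_pow, Real.sq_sqrt hs.le]; field_simp,
      show (-(-(1 / 2)) - 1 : ℂ) = -(1 / 2) by norm_num, cpow_neg (s : ℂ), Real.sqrt_eq_rpow,
      ofReal_cpow hs.le, mul_comm s t]
    push_cast
    ring
  rw [setIntegral_congr_fun measurableSet_Ioi h2, integral_const_mul, real_smul] at h
  have hsc : (√s : ℂ) ≠ 0 := ofReal_ne_zero.2 hs2.ne'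
  have e : (s : ℂ) = √s * √s := by rw [← ofReal_mul, hss]
  rw [e, mul_assoc, mul_inv_cancel_left₀ hsc] at h
  rw [ofReal_div, eq_div_iff hsc, mul_comm, h]

/-! ### The representation F and its value on the positive axis -/

/-- The integral representation of the MacDonald function for dimension one. -/
noncomputable def besselF (m z : ℂ) : ℂ :=
  Complex.exp (-z) * (Complex.Gamma (m + 1 / 2))⁻¹ *
    ∫ t in Ioi (0 : ℝ), ((Real.exp (-t) : ℝ) : ℂ) * ((t : ℂ) * (1 + t / (2 * z))) ^ (m - 1 / 2)

theorem image_sqrt_one_add_sub_one {z : ℝ} (hz : 0 < z) :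
    (fun q => z * (√(1 + q) - 1)) '' Ioi 0 = Ioi 0 := by
  ext t
  constructor
  · rintro ⟨q, hq, rfl⟩
    have : 1 < √(1 + q) := by
      rw [Real.lt_sqrt zero_le_one]
      linarith [mem_Ioi.1 hq]
    exact mul_pos hz (by linarith)
  · intro ht
    have ht0 : 0 < t := ht
    have h1 : 0 < t / z := by positivity
    refine ⟨(1 + t / z) ^ 2 - 1, ?_, ?_⟩
    · rw [mem_Ioi]; nlinarith
    · simp only [add_sub_cancel]
      rw [Real.sqrt_sq (by positivity)]
      field_simp
      ring

/-- Substitute `t = 2r(√(1+q) - 1)`, chosen so that `t(1 + t/(4r)) = rq`. -/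
theorem integral_besselF_eq {r : ℝ} (hr : 0 < r) (m : ℂ) :
    ∫ t in Ioi (0 : ℝ), ((Real.exp (-t) : ℝ) : ℂ) *
        ((t : ℂ) * (1 + t / (2 * ((2 * r : ℝ) : ℂ)))) ^ (m - 1 / 2) =
      Complex.exp (2 * r) * (r : ℂ) ^ (m + 1 / 2) * ∫ q in Ioi (0 : ℝ), (q : ℂ) ^ (m - 1 / 2) *
        ((Real.exp (-(2 * (r * √(1 + q)))) / √(1 + q) : ℝ) : ℂ) := by
  have hrc : (r : ℂ) ≠ 0 := ofReal_ne_zero.2 hr.ne'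
  have hd : ∀ q ∈ Ioi (0 : ℝ), HasDerivWithinAt (fun q => 2 * r * (√(1 + q) - 1))
      (r / √(1 + q)) (Ioi 0) q := by
    intro q hq
    have hq0 : (1 + q) ≠ 0 := by have := mem_Ioi.1 hq; positivity
    have := (((hasDerivAt_id q).const_add 1).sqrt hq0).sub_const 1 |>.const_mul (2 * r)
    refine (this.congr_deriv ?_).hasDerivWithinAt
    simp only [id]
    field_simp
  have hinj : InjOn (fun q : ℝ => 2 * r * (√(1 + q) - 1)) (Ioi 0) := by
    intro p hp q hq h
    have h1 : √(1 + p) = √(1 + q) := by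
      have := mul_left_cancel₀ (by positivity) h
      linarith
    have := (Real.sqrt_inj (by linarith [mem_Ioi.1 hp]) (by linarith [mem_Ioi.1 hq])).1 h1
    linarith
  rw [← integral_const_mul]
  conv_lhs => rw [← image_sqrt_one_add_sub_one (mul_pos two_pos hr)]
  rw [integral_image_eq_integral_abs_deriv_smul measurableSet_Ioi hd hinj]
  refine setIntegral_congr_fun measurableSet_Ioi fun q hq => ?_
  have hq0 : 0 < q := hq
  have hss : √(1 + q) * √(1 + q) = 1 + q := Real.mul_self_sqrt (by positivity)
  have e1 : ((2 * r * (√(1 + q) - 1) : ℝ) : ℂ) * (1 + ((2 * r * (√(1 + q) - 1) : ℝ) : ℂ) /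
      (2 * ((2 * r : ℝ) : ℂ))) = (r : ℂ) * q := by
    have hs2 : (√(1 + q) : ℂ) * √(1 + q) = 1 + q := by exact_mod_cast congrArg ofReal hss
    push_cast
    field_simp
    linear_combination hs2
  have e2 : Real.exp (-(2 * r * (√(1 + q) - 1))) =
      Real.exp (2 * r) * Real.exp (-(2 * (r * √(1 + q)))) := by
    rw [← Real.exp_add]; ring_nf
  have e3 : (r : ℂ) ^ (m + 1 / 2) = r * (r : ℂ) ^ (m - 1 / 2) := by
    rw [show m + 1 / 2 = (m - 1 / 2) + 1 by ring, cpow_add _ _ hrc, cpow_one, mul_comm]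
  rw [e1, e2, e3, mul_cpow_ofReal_nonneg hr.le hq0.le, abs_of_pos (by positivity), real_smul]
  push_cast
  ring

theorem integral_cpow_mul_ofReal_exp_neg_mul {s : ℂ} (hs : 0 < s.re) {t : ℝ} (ht : 0 < t) :
    ∫ q in Ioi (0 : ℝ), (q : ℂ) ^ (s - 1) * ((Real.exp (-(t * q)) : ℝ) : ℂ) =
      (t : ℂ) ^ (-s) * Complex.Gamma s := by
  have h := Complex.integral_cpow_mul_exp_neg_mul_Ioi hs ht
  rw [one_div, inv_cpow _ _ (by rw [arg_ofReal_of_nonneg ht.le]; exact Real.pi_pos.ne),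
    ← cpow_neg] at h
  rw [← h]
  push_cast
  rfl

theorem integrableOn_rpow_mul_exp_neg_mul {p t : ℝ} (hp : 0 < p) (ht : 0 < t) :
    IntegrableOn (fun q => q ^ (p - 1) * Real.exp (-(t * q))) (Ioi 0) := by
  have := integrableOn_rpow_mul_exp_neg_mul_rpow (p := 1) (s := p - 1) (b := t) (by linarith)
    one_pos ht
  simpa using this

/-- Integrate `q^(m-1/2) t^(-1/2) exp(-t(1+q) - r²/t)` in both orders. Integrating in `q` first
gives `Γ(m+1/2) G_m(r)`; integrating in `t` first is the index -1/2 case and gives the integral in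
`F`. -/
theorem besselF_ofReal {r : ℝ} (hr : 0 < r) {m : ℂ} (hm : -(1 / 2) < m.re) :
    besselF m ((2 * r : ℝ) : ℂ) =
      ((Real.sqrt Real.pi : ℝ) : ℂ)⁻¹ * (r : ℂ) ^ (m + 1 / 2) * besselG m r := by
  have hm' : 0 < (m + 1 / 2).re := by simp; linarith
  have hG : Complex.Gamma (m + 1 / 2) ≠ 0 := Complex.Gamma_ne_zero_of_re_pos hm'
  have hm2 : (m + 1 / 2) - 1 = m - 1 / 2 := by ring
  let f : ℝ → ℝ → ℂ := fun q t => (q : ℂ) ^ (m - 1 / 2) *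
    (((Real.exp (-(t * (1 + q)) - r ^ 2 / t) : ℝ) : ℂ) * (t : ℂ) ^ (-(1 / 2) : ℂ))
  have hf : ∀ q t, f q t = (((Real.exp (-t - r ^ 2 / t) : ℝ) : ℂ) * (t : ℂ) ^ (-(1 / 2) : ℂ)) *
      ((q : ℂ) ^ (m + 1 / 2 - 1) * ((Real.exp (-(t * q)) : ℝ) : ℂ)) := fun q t => by
    simp only [f]
    rw [show -(t * (1 + q)) - r ^ 2 / t = (-t - r ^ 2 / t) + -(t * q) by ring, Real.exp_add, hm2]
    push_cast
    ring
  have hin : ∀ t ∈ Ioi (0 : ℝ), ∫ q in Ioi (0 : ℝ), f q t = Complex.Gamma (m + 1 / 2) *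
        (((Real.exp (-t - r ^ 2 / t) : ℝ) : ℂ) * (t : ℂ) ^ (-m - 1)) := by
    intro t ht
    have htc : (t : ℂ) ≠ 0 := ofReal_ne_zero.2 (ne_of_gt ht)
    simp_rw [hf]
    rw [integral_const_mul, integral_cpow_mul_ofReal_exp_neg_mul hm' ht,
      show -m - 1 = -(1 / 2) + -(m + 1 / 2) by ring, cpow_add _ _ htc]
    ring
  have hnorm : ∀ t ∈ Ioi (0 : ℝ), ∀ q ∈ Ioi (0 : ℝ), ‖f q t‖ =
      (Real.exp (-t - r ^ 2 / t) * t ^ (-(1 / 2) : ℝ)) *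
        (q ^ ((m.re + 1 / 2) - 1) * Real.exp (-(t * q))) := by
    intro t ht q hq
    rw [hf, norm_mul, norm_mul, norm_mul, norm_real, norm_real, Real.norm_of_nonneg (Real.exp_pos _).le,
      Real.norm_of_nonneg (Real.exp_pos _).le, norm_cpow_eq_rpow_re_of_pos ht,
      norm_cpow_eq_rpow_re_of_pos hq]
    norm_num
  have hp : 0 < m.re + 1 / 2 := by linarith
  have hmeas : AEStronglyMeasurable (Function.uncurry f)
      ((volume.restrict (Ioi 0)).prod (volume.restrict (Ioi 0))) := by
    refine Measurable.aestronglyMeasurable ?_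
    simp only [f, Function.uncurry_def]
    fun_prop
  have hint : Integrable (Function.uncurry f)
      ((volume.restrict (Ioi 0)).prod (volume.restrict (Ioi 0))) := by
    rw [integrable_prod_iff' hmeas]
    constructor
    · filter_upwards [ae_restrict_mem measurableSet_Ioi] with t ht
      have hI := (integrableOn_rpow_mul_exp_neg_mul hp ht).const_mul
        (Real.exp (-t - r ^ 2 / t) * t ^ (-(1 / 2) : ℝ))
      refine hI.mono' ?_ ?_
      · refine Measurable.aestronglyMeasurable ?_
        simp only [f, Function.uncurry_def]
        fun_prop
      · filter_upwards [ae_restrict_mem measurableSet_Ioi] with q hq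
        exact (hnorm t ht q hq).le
    · have hI := ((integrableOn_besselG_integrand m hr).norm).mul_const (Real.Gamma (m.re + 1 / 2))
      refine hI.congr ?_
      filter_upwards [ae_restrict_mem measurableSet_Ioi] with t ht
      have ht0 : 0 < t := ht
      simp only [Function.uncurry_apply_pair]
      rw [setIntegral_congr_fun measurableSet_Ioi (hnorm t ht), integral_const_mul,
        Real.integral_rpow_mul_exp_neg_mul_Ioi hp ht, norm_mul, norm_real,
        Real.norm_of_nonneg (Real.exp_pos _).le, norm_cpow_eq_rpow_re_of_pos ht, one_div t,
        Real.inv_rpow ht0.le, ← Real.rpow_neg ht0.le,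
        show (-m - 1).re = -(1 / 2) + -(m.re + 1 / 2) by simp; ring, Real.rpow_add ht0]
      ring
  have hswap := integral_integral_swap hint
  rw [setIntegral_congr_fun measurableSet_Ioi hin, integral_const_mul] at hswap
  have hout : ∀ q ∈ Ioi (0 : ℝ), ∫ t in Ioi (0 : ℝ), f q t = ((Real.sqrt Real.pi : ℝ) : ℂ) *
      ((q : ℂ) ^ (m - 1 / 2) * ((Real.exp (-(2 * (r * √(1 + q)))) / √(1 + q) : ℝ) : ℂ)) := by
    intro q hq
    have hq1 : 0 < 1 + q := by have := mem_Ioi.1 hq; positivity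
    simp only [f]
    rw [integral_const_mul, integral_exp_mul_rpow_neg_half hr hq1]
    push_cast
    ring
  rw [setIntegral_congr_fun measurableSet_Ioi hout, integral_const_mul] at hswap
  rw [besselF, integral_besselF_eq hr, besselG]
  have hexp : Complex.exp (-((2 * r : ℝ) : ℂ)) * Complex.exp (2 * r) = 1 := by
    rw [← Complex.exp_add]; simp
  set A := ∫ q in Ioi (0 : ℝ), (q : ℂ) ^ (m - 1 / 2) *
    ((Real.exp (-(2 * (r * √(1 + q)))) / √(1 + q) : ℝ) : ℂ)
  set B := ∫ t in Ioi (0 : ℝ), ((Real.exp (-t - r ^ 2 / t) : ℝ) : ℂ) * (t : ℂ) ^ (-m - 1)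
  calc _ = (Complex.exp (-((2 * r : ℝ) : ℂ)) * Complex.exp (2 * r)) *
        (Complex.Gamma (m + 1 / 2))⁻¹ * (r : ℂ) ^ (m + 1 / 2) * A := by ring
    _ = _ := by
      rw [hexp]
      generalize (r : ℂ) ^ (m + 1 / 2) = R
      generalize Complex.Gamma (m + 1 / 2) = Γ at hG hswap
      field_simp
      linear_combination R * hswap

/-! ### Bounds for F on the slit plane, holomorphy in z and in m -/

/-- The cosine of half the argument of `a`. -/
noncomputable def cosHalfArg (a : ℂ) : ℝ := √((1 + a.re / ‖a‖) / 2)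

theorem neg_norm_lt_re_of_mem_slitPlane {a : ℂ} (ha : a ∈ slitPlane) : -‖a‖ < a.re := by
  have h0 : 0 < ‖a‖ := norm_pos_iff.2 (slitPlane_ne_zero ha)
  rcases mem_slitPlane_iff.1 ha with h | h
  · linarith
  · have := Complex.abs_re_lt_norm.2 h
    linarith [neg_abs_le a.re]

theorem cosHalfArg_pos {a : ℂ} (ha : a ∈ slitPlane) : 0 < cosHalfArg a := by
  have h0 : 0 < ‖a‖ := norm_pos_iff.2 (slitPlane_ne_zero ha)
  refine Real.sqrt_pos.2 (div_pos ?_ two_pos)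
  have : -1 < a.re / ‖a‖ := by
    rw [lt_div_iff₀ h0]
    linarith [neg_norm_lt_re_of_mem_slitPlane ha]
  linarith

theorem continuousOn_cosHalfArg : ContinuousOn cosHalfArg slitPlane := by
  refine Real.continuous_sqrt.comp_continuousOn ?_
  refine (continuousOn_const.add (continuous_re.continuousOn.div continuous_norm.continuousOn
    fun a ha => ?_)).div_const 2
  exact norm_ne_zero_iff.2 (slitPlane_ne_zero ha)

theorem cosHalfArg_mul_ofReal (a : ℂ) {x : ℝ} (hx : 0 < x) :
    cosHalfArg (a * x) = cosHalfArg a := by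
  rw [cosHalfArg, cosHalfArg, norm_mul, norm_real, Real.norm_of_nonneg hx.le, re_mul_ofReal,
    mul_div_mul_right _ _ hx.ne']

/-- With `θ = arg a`, `|a + s|² - cos²(θ/2) (|a| + s)² = sin²(θ/2) (|a| - s)² ≥ 0`. The constant
depends only on the direction of `a`, hence survives the scaling `a ↦ ax`. -/
theorem cosHalfArg_mul_le_norm {a : ℂ} (ha : a ∈ slitPlane) {s : ℝ} (hs : 0 ≤ s) :
    cosHalfArg a * (1 + s / ‖a‖) ≤ ‖1 + s / a‖ := by
  have ha0 := slitPlane_ne_zero ha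
  have h0 : 0 < ‖a‖ := norm_pos_iff.2 ha0
  have hpos : 0 ≤ (1 + a.re / ‖a‖) / 2 := by
    have : -1 < a.re / ‖a‖ := by
      rw [lt_div_iff₀ h0]
      linarith [neg_norm_lt_re_of_mem_slitPlane ha]
    linarith
  have e1 : 1 + (s : ℂ) / a = (a + s) / a := by field_simp
  have e2 : 1 + s / ‖a‖ = (‖a‖ + s) / ‖a‖ := by field_simp
  rw [e1, norm_div, e2, ← mul_div_assoc]
  gcongr
  refine le_of_sq_le_sq ?_ (norm_nonneg _)
  rw [mul_pow, cosHalfArg, Real.sq_sqrt hpos, ← normSq_eq_norm_sq, normSq_apply, add_re, add_im,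
    ofReal_re, ofReal_im]
  have h2 : a.re * a.re + a.im * a.im = ‖a‖ * ‖a‖ := by
    rw [← normSq_apply, normSq_eq_norm_sq, sq]
  have h3 : a.re ≤ ‖a‖ := re_le_norm a
  have h4 : (1 + a.re / ‖a‖) / 2 * (‖a‖ + s) ^ 2 =
      (a.re + s) * (a.re + s) + (a.im + 0) * (a.im + 0) -
        (1 - a.re / ‖a‖) / 2 * (‖a‖ - s) ^ 2 := by
    have : a.re = a.re / ‖a‖ * ‖a‖ := by field_simp
    set ρ := a.re / ‖a‖
    have e : (a.re + s) * (a.re + s) + (a.im + 0) * (a.im + 0) =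
      ‖a‖ * ‖a‖ + 2 * s * a.re + s * s := by rw [← h2]; ring
    rw [e, this]
    ring
  have h5 : a.re / ‖a‖ ≤ 1 := (div_le_one h0).2 h3
  have h6 : 0 ≤ (1 - a.re / ‖a‖) / 2 * (‖a‖ - s) ^ 2 :=
    mul_nonneg (by linarith) (sq_nonneg _)
  linarith

theorem norm_one_add_div_le (a : ℂ) {s : ℝ} (hs : 0 ≤ s) : ‖1 + s / a‖ ≤ 1 + s / ‖a‖ := by
  refine (norm_add_le _ _).trans ?_
  rw [norm_one, norm_div, norm_real, Real.norm_of_nonneg hs]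

/-- The upper bound on `u` serves `p ≥ 0`, the lower bound serves `p ≤ 0`; the factor `1 + κ^p`
covers both signs at once. -/
theorem rpow_le_of_mul_le_of_le {κ u B : ℝ} (p : ℝ) (hκ : 0 < κ) (hB : 1 ≤ B) (h1 : κ * B ≤ u)
    (h2 : u ≤ B) : u ^ p ≤ (1 + κ ^ p) * B ^ max p 0 := by
  have hu : 0 < u := (by positivity : 0 < κ * B).trans_le h1
  have hκp : 0 < κ ^ p := Real.rpow_pos_of_pos hκ p
  rcases le_total 0 p with hp | hp
  · rw [max_eq_left hp]
    have h3 : u ^ p ≤ B ^ p := Real.rpow_le_rpow hu.le h2 hp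
    nlinarith [Real.rpow_nonneg (zero_le_one.trans hB) p]
  · rw [max_eq_right hp, Real.rpow_zero, mul_one]
    have h3 : u ^ p ≤ κ ^ p :=
      Real.rpow_le_rpow_of_nonpos hκ (by nlinarith) hp
    linarith

/-- The constant in the bound of the integrand of `besselF` with exponent `p`. -/
noncomputable def besselFConst (p : ℝ) (z : ℂ) : ℝ :=
  (1 + cosHalfArg z ^ p) * (1 + 1 / (2 * ‖z‖)) ^ max p 0

theorem besselFConst_nonneg (p : ℝ) (z : ℂ) : 0 ≤ besselFConst p z := by
  have : 0 ≤ cosHalfArg z := Real.sqrt_nonneg _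
  unfold besselFConst
  positivity

theorem continuousOn_besselFConst (p : ℝ) : ContinuousOn (besselFConst p) slitPlane := by
  intro z hz
  have hz0 := norm_ne_zero_iff.2 (slitPlane_ne_zero hz)
  refine ContinuousWithinAt.mul ?_ ?_
  · exact continuousWithinAt_const.add ((continuousOn_cosHalfArg z hz).rpow_const
      (Or.inl (cosHalfArg_pos hz).ne'))
  · refine ContinuousWithinAt.rpow_const ?_ (Or.inr (le_max_right _ _))
    exact (continuousAt_const.add (continuousAt_const.div (by fun_prop)
      (by positivity))).continuousWithinAt

theorem norm_mul_one_add_div_rpow_le {z : ℂ} (hz : z ∈ slitPlane) (p : ℝ) {t : ℝ} (ht : 0 < t) :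
    ‖(t : ℂ) * (1 + t / (2 * z))‖ ^ p ≤ besselFConst p z * (t ^ p * (1 + t) ^ max p 0) := by
  have hz0 : 0 < ‖z‖ := norm_pos_iff.2 (slitPlane_ne_zero hz)
  have e : (t : ℂ) / (2 * z) = ((t / 2 : ℝ) : ℂ) / z := by push_cast; field_simp
  rw [e, norm_mul, norm_real, Real.norm_of_nonneg ht.le, Real.mul_rpow ht.le (norm_nonneg _)]
  have h1 := rpow_le_of_mul_le_of_le p (cosHalfArg_pos hz)
    (by have : 0 ≤ t / 2 / ‖z‖ := by positivity
        linarith) (cosHalfArg_mul_le_norm hz (by positivity : 0 ≤ t / 2))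
    (norm_one_add_div_le z (by positivity : 0 ≤ t / 2))
  have h2 : (1 + t / 2 / ‖z‖) ^ max p 0 ≤
      (1 + 1 / (2 * ‖z‖)) ^ max p 0 * (1 + t) ^ max p 0 := by
    rw [← Real.mul_rpow (by positivity) (by positivity)]
    refine Real.rpow_le_rpow (by positivity) ?_ (le_max_right _ _)
    have h3 : (1 + 1 / (2 * ‖z‖)) * (1 + t) = 1 + t / 2 / ‖z‖ + (t + 1 / (2 * ‖z‖)) := by
      field_simp
      ring
    have : 0 < 1 / (2 * ‖z‖) := by positivity
    rw [h3]
    linarith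
  have hc : 0 ≤ 1 + cosHalfArg z ^ p := by
    have : 0 ≤ cosHalfArg z := Real.sqrt_nonneg _
    positivity
  calc t ^ p * ‖1 + ((t / 2 : ℝ) : ℂ) / z‖ ^ p
      ≤ t ^ p * ((1 + cosHalfArg z ^ p) *
          ((1 + 1 / (2 * ‖z‖)) ^ max p 0 * (1 + t) ^ max p 0)) := by
        gcongr
        exact h1.trans (by gcongr)
    _ = _ := by rw [besselFConst]; ring

theorem one_add_rpow_le {t q : ℝ} (ht : 0 < t) (hq : 0 ≤ q) :
    (1 + t) ^ q ≤ 2 ^ q * (1 + t ^ q) := by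
  rcases le_total t 1 with h | h
  · calc (1 + t) ^ q ≤ 2 ^ q * 1 := by
          rw [mul_one]; exact Real.rpow_le_rpow (by positivity) (by linarith) hq
      _ ≤ _ := by
          gcongr
          have : 0 ≤ t ^ q := by positivity
          linarith
  · calc (1 + t) ^ q ≤ (2 * t) ^ q := Real.rpow_le_rpow (by positivity) (by linarith) hq
      _ = 2 ^ q * t ^ q := Real.mul_rpow (by norm_num) ht.le
      _ ≤ _ := by gcongr; linarith

theorem integrableOn_exp_neg_mul_rpow_mul_rpow {p : ℝ} (hp : -1 < p) :
    IntegrableOn (fun t => Real.exp (-t) * (t ^ p * (1 + t) ^ max p 0)) (Ioi 0) := by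
  have hq : 0 ≤ max p 0 := le_max_right _ _
  have hI := ((Real.GammaIntegral_convergent (s := p + 1) (by linarith)).add
    (Real.GammaIntegral_convergent (s := p + max p 0 + 1) (by linarith))).const_mul (2 ^ max p 0)
  refine Integrable.mono' hI (Measurable.aestronglyMeasurable (by fun_prop)) ?_
  filter_upwards [ae_restrict_mem measurableSet_Ioi] with t ht
  have ht0 : 0 < t := ht
  rw [Real.norm_of_nonneg (by positivity)]
  have h1 := one_add_rpow_le ht0 hq
  calc Real.exp (-t) * (t ^ p * (1 + t) ^ max p 0)
      ≤ Real.exp (-t) * (t ^ p * (2 ^ max p 0 * (1 + t ^ max p 0))) := by gcongr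
    _ = _ := by
      simp only [Pi.add_apply, add_sub_cancel_right]
      rw [Real.rpow_add ht0]
      ring

/-- The imaginary part of `1 + t/(2z)` vanishes only for real `z`, and then `z > 0`. Hence the
principal power in `F` is holomorphic in `z`. -/
theorem mul_one_add_div_mem_slitPlane {z : ℂ} (hz : z ∈ slitPlane) {t : ℝ} (ht : 0 < t) :
    (t : ℂ) * (1 + t / (2 * z)) ∈ slitPlane := by
  have hn : 0 < normSq (2 * z) :=
    normSq_pos.2 (mul_ne_zero two_ne_zero (slitPlane_ne_zero hz))
  rw [mem_slitPlane_iff] at hz ⊢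
  rw [re_ofReal_mul, im_ofReal_mul]
  rcases eq_or_ne z.im 0 with h | h
  · left
    have hre := hz.resolve_right (not_not.2 h)
    have : (1 + (t : ℂ) / (2 * z)).re = 1 + t * (2 * z.re) / normSq (2 * z) := by
      simp [div_re]
    rw [this]
    positivity
  · right
    have : (1 + (t : ℂ) / (2 * z)).im = -(t * (2 * z.im) / normSq (2 * z)) := by
      simp [div_im]
    rw [this]
    exact mul_ne_zero ht.ne' (neg_ne_zero.2 (div_ne_zero
      (mul_ne_zero ht.ne' (mul_ne_zero two_ne_zero h)) hn.ne'))

theorem norm_cpow_le_rpow_mul_exp (w ν : ℂ) : ‖w ^ ν‖ ≤ ‖w‖ ^ ν.re * Real.exp (Real.pi * |ν.im|) := by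
  refine (norm_cpow_le w ν).trans ?_
  rw [div_eq_mul_inv, ← Real.exp_neg]
  gcongr
  calc -(w.arg * ν.im) ≤ |w.arg * ν.im| := neg_le_abs _
    _ = |w.arg| * |ν.im| := abs_mul _ _
    _ ≤ _ := by gcongr; exact abs_arg_le_pi w

theorem norm_besselF_integrand_le {z : ℂ} (hz : z ∈ slitPlane) (ν : ℂ) {t : ℝ} (ht : 0 < t) :
    ‖((Real.exp (-t) : ℝ) : ℂ) * ((t : ℂ) * (1 + t / (2 * z))) ^ ν‖ ≤
      Real.exp (Real.pi * |ν.im|) * besselFConst ν.re z *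
        (Real.exp (-t) * (t ^ ν.re * (1 + t) ^ max ν.re 0)) := by
  rw [norm_mul, norm_real, Real.norm_of_nonneg (Real.exp_pos _).le]
  calc _ ≤ Real.exp (-t) * (‖(t : ℂ) * (1 + t / (2 * z))‖ ^ ν.re *
        Real.exp (Real.pi * |ν.im|)) := by
        gcongr; exact norm_cpow_le_rpow_mul_exp _ _
    _ ≤ Real.exp (-t) * (besselFConst ν.re z * (t ^ ν.re * (1 + t) ^ max ν.re 0) *
        Real.exp (Real.pi * |ν.im|)) := by
        gcongr; exact norm_mul_one_add_div_rpow_le hz _ ht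
    _ = _ := by ring

theorem norm_besselF_le {m : ℂ} (hm : -(1 / 2) < m.re) : ∃ C : ℝ, 0 ≤ C ∧ ∀ z ∈ slitPlane,
    ‖besselF m z‖ ≤ C * besselFConst (m.re - 1 / 2) z * Real.exp (-z.re) := by
  have hν : (m - 1 / 2).re = m.re - 1 / 2 := by simp
  have hI := integrableOn_exp_neg_mul_rpow_mul_rpow (p := m.re - 1 / 2) (by linarith)
  refine ⟨‖(Complex.Gamma (m + 1 / 2))⁻¹‖ * (Real.exp (Real.pi * |(m - 1 / 2).im|) *
    ∫ t in Ioi (0 : ℝ), Real.exp (-t) * (t ^ (m.re - 1 / 2) * (1 + t) ^ max (m.re - 1 / 2) 0)),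
    ?_, fun z hz => ?_⟩
  · refine mul_nonneg (norm_nonneg _) (mul_nonneg (Real.exp_pos _).le ?_)
    refine setIntegral_nonneg measurableSet_Ioi fun t ht => ?_
    have : 0 < t := ht
    positivity
  · rw [besselF, norm_mul, norm_mul, Complex.norm_exp, neg_re]
    have h := norm_integral_le_of_norm_le (hI.const_mul
      (Real.exp (Real.pi * |(m - 1 / 2).im|) * besselFConst (m.re - 1 / 2) z))
      (f := fun t : ℝ => ((Real.exp (-t) : ℝ) : ℂ) *
        ((t : ℂ) * (1 + t / (2 * z))) ^ (m - 1 / 2)) ?_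
    · rw [integral_const_mul] at h
      refine (mul_le_mul_of_nonneg_left h (by positivity)).trans_eq ?_
      ring
    · filter_upwards [ae_restrict_mem measurableSet_Ioi] with t ht
      have := norm_besselF_integrand_le hz (m - 1 / 2) ht
      rwa [hν] at this

theorem differentiableOn_besselF {m : ℂ} (hm : -(1 / 2) < m.re) :
    DifferentiableOn ℂ (besselF m) slitPlane := by
  have hν : (m - 1 / 2).re = m.re - 1 / 2 := by simp
  have hI := integrableOn_exp_neg_mul_rpow_mul_rpow (p := m.re - 1 / 2) (by linarith)
  refine DifferentiableOn.mul (by fun_prop)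
    (differentiableOn_integral_of_locally_dominated isOpen_slitPlane (fun z hz => ?_) ?_ ?_)
  · exact Measurable.aestronglyMeasurable (by fun_prop)
  · filter_upwards [ae_restrict_mem measurableSet_Ioi] with t ht z hz
    have hz0 := slitPlane_ne_zero hz
    have h1 : DifferentiableAt ℂ (fun z : ℂ => (t : ℂ) * (1 + t / (2 * z))) z :=
      DifferentiableAt.const_mul (DifferentiableAt.const_add _
        ((differentiableAt_const _).div (by fun_prop) (by simpa using hz0))) _
    exact ((h1.cpow (differentiableAt_const _) (mul_one_add_div_mem_slitPlane hz ht)).const_mul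
      _).differentiableWithinAt
  · intro z₀ hz₀
    have hc := (continuousOn_besselFConst (m.re - 1 / 2)).continuousAt
      (isOpen_slitPlane.mem_nhds hz₀)
    refine ⟨_, inter_mem (isOpen_slitPlane.mem_nhds hz₀)
      (hc.eventually_lt_const (lt_add_one (besselFConst (m.re - 1 / 2) z₀))), _,
      hI.const_mul (Real.exp (Real.pi * |(m - 1 / 2).im|) *
        (besselFConst (m.re - 1 / 2) z₀ + 1)), ?_⟩
    filter_upwards [ae_restrict_mem measurableSet_Ioi] with t ht z hz
    have ht0 : 0 < t := ht
    refine (norm_besselF_integrand_le hz.1 (m - 1 / 2) ht).trans ?_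
    rw [hν]
    have h2 : besselFConst (m.re - 1 / 2) z < besselFConst (m.re - 1 / 2) z₀ + 1 := hz.2
    gcongr

theorem rpow_le_rpow_add_rpow {x p p₁ p₂ : ℝ} (hx : 0 < x) (h1 : p₁ ≤ p) (h2 : p ≤ p₂) :
    x ^ p ≤ x ^ p₁ + x ^ p₂ := by
  rcases le_total x 1 with h | h
  · linarith [Real.rpow_le_rpow_of_exponent_ge hx h h1, Real.rpow_pos_of_pos hx p₂]
  · linarith [Real.rpow_le_rpow_of_exponent_le h h2, Real.rpow_pos_of_pos hx p₁]

/-- Domination near `m₀` uses the two extreme exponents: a power lying between two others is at most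
their sum. -/
theorem differentiableOn_besselF_index {z : ℂ} (hz : z ∈ slitPlane) :
    DifferentiableOn ℂ (fun m => besselF m z) {m | -(1 / 2) < m.re} := by
  have hopen : IsOpen {m : ℂ | -(1 / 2) < m.re} := isOpen_lt continuous_const continuous_re
  have hb : ∀ p : ℝ, -1 < p → IntegrableOn
      (fun t : ℝ => Real.exp (-t) * ‖(t : ℂ) * (1 + t / (2 * z))‖ ^ p) (Ioi 0) := by
    intro p hp
    refine ((integrableOn_exp_neg_mul_rpow_mul_rpow hp).const_mul (besselFConst p z)).mono'
      (Measurable.aestronglyMeasurable (by fun_prop)) ?_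
    filter_upwards [ae_restrict_mem measurableSet_Ioi] with t ht
    rw [Real.norm_of_nonneg (by positivity)]
    calc _ ≤ Real.exp (-t) * (besselFConst p z * (t ^ p * (1 + t) ^ max p 0)) := by
          gcongr; exact norm_mul_one_add_div_rpow_le hz p ht
      _ = _ := by ring
  refine DifferentiableOn.mul (DifferentiableOn.const_mul ?_ _)
    (differentiableOn_integral_of_locally_dominated hopen (fun m hm => ?_) ?_ ?_)
  · exact (Complex.differentiable_one_div_Gamma.comp
      (differentiable_id.add_const (1 / 2))).differentiableOn
  · exact Measurable.aestronglyMeasurable (by fun_prop)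
  · filter_upwards [ae_restrict_mem measurableSet_Ioi] with t ht
    have h0 := slitPlane_ne_zero (mul_one_add_div_mem_slitPlane hz ht)
    refine fun m _ => (DifferentiableAt.const_mul (DifferentiableAt.const_cpow (by fun_prop)
      (Or.inl h0)) _).differentiableWithinAt
  · intro m₀ hm₀
    -- With `δ < Re m₀ + 1/2` both exponents `Re m₀ - 1/2 ± δ` exceed -1.
    obtain ⟨δ, hδ0, hδ⟩ := exists_between (show (0 : ℝ) < m₀.re + 1 / 2 by
      have : -(1 / 2) < m₀.re := hm₀
      linarith)
    refine ⟨_, Metric.ball_mem_nhds m₀ hδ0, _, ((hb (m₀.re - 1 / 2 - δ) (by linarith)).add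
      (hb (m₀.re - 1 / 2 + δ) (by linarith))).const_mul (Real.exp (Real.pi * (|m₀.im| + δ))), ?_⟩
    filter_upwards [ae_restrict_mem measurableSet_Ioi] with t ht m hm
    rw [Metric.mem_ball, dist_eq_norm] at hm
    have hre := (abs_le.1 ((abs_re_le_norm (m - m₀)).trans hm.le))
    have him := (abs_im_le_norm (m - m₀)).trans hm.le
    rw [sub_re] at hre
    rw [sub_im] at him
    have hx : 0 < ‖(t : ℂ) * (1 + t / (2 * z))‖ :=
      norm_pos_iff.2 (slitPlane_ne_zero (mul_one_add_div_mem_slitPlane hz ht))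
    have him2 : |(m - 1 / 2).im| ≤ |m₀.im| + δ := by
      have : (m - 1 / 2).im = m₀.im + (m.im - m₀.im) := by simp
      rw [this]
      exact (abs_add_le _ _).trans (by linarith)
    have hre2 : (m - 1 / 2).re = m.re - 1 / 2 := by simp
    rw [norm_mul, norm_real, Real.norm_of_nonneg (Real.exp_pos _).le]
    calc _ ≤ Real.exp (-t) * (‖(t : ℂ) * (1 + t / (2 * z))‖ ^ (m - 1 / 2).re *
          Real.exp (Real.pi * |(m - 1 / 2).im|)) := by
          gcongr; exact norm_cpow_le_rpow_mul_exp _ _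
      _ ≤ Real.exp (-t) * ((‖(t : ℂ) * (1 + t / (2 * z))‖ ^ (m₀.re - 1 / 2 - δ) +
          ‖(t : ℂ) * (1 + t / (2 * z))‖ ^ (m₀.re - 1 / 2 + δ)) *
          Real.exp (Real.pi * (|m₀.im| + δ))) := by
          gcongr
          exact rpow_le_rpow_add_rpow hx (by linarith) (by linarith)
      _ = _ := by simp only [Pi.add_apply]; ring

/-! ### Identification of K with F, including integer indices -/

/-- The identity theorem: real points to the right of `x₀` accumulate at `x₀`. -/
theorem eqOn_of_eq_on_real {U : Set ℂ} (hU : IsOpen U) (hc : IsPreconnected U) {f g : ℂ → ℂ}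
    (hf : DifferentiableOn ℂ f U) (hg : DifferentiableOn ℂ g U) {x₀ : ℝ} (hx₀ : (x₀ : ℂ) ∈ U)
    (h : ∀ x : ℝ, x₀ < x → (x : ℂ) ∈ U → f x = g x) : EqOn f g U := by
  refine (hf.analyticOnNhd hU).eqOn_of_preconnected_of_frequently_eq (hg.analyticOnNhd hU) hc hx₀ ?_
  have ht : Tendsto (fun x : ℝ => (x : ℂ)) (𝓝[>] x₀) (𝓝[≠] (x₀ : ℂ)) := by
    refine tendsto_nhdsWithin_iff.2
      ⟨(continuous_ofReal.tendsto x₀).mono_left nhdsWithin_le_nhds, ?_⟩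
    filter_upwards [self_mem_nhdsWithin] with x hx
    exact fun he => (ne_of_gt hx) (ofReal_injective he)
  refine ht.frequently (Eventually.frequently ?_)
  have hU' : ∀ᶠ x : ℝ in 𝓝[>] x₀, (x : ℂ) ∈ U :=
    ((continuous_ofReal.tendsto x₀).mono_left nhdsWithin_le_nhds).eventually (hU.mem_nhds hx₀)
  filter_upwards [self_mem_nhdsWithin, hU'] with x hx hxU
  exact h x hx hxU

theorem isPreconnected_slitPlane : IsPreconnected slitPlane :=
  (starConvex_one_slitPlane.isPathConnected one_mem_slitPlane).isConnected.isPreconnected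

/-- The quotient defining the MacDonald function at non-integer parameters. -/
noncomputable def macdonaldQuotient (z μ : ℂ) : ℂ :=
  (-besselI1 μ z + besselI1 (-μ) z) / Complex.sin ((Real.pi : ℂ) * μ)

theorem macdonaldQuotient_neg (z μ : ℂ) : macdonaldQuotient z (-μ) = macdonaldQuotient z μ := by
  rw [macdonaldQuotient, macdonaldQuotient, neg_neg, mul_neg, Complex.sin_neg, div_neg, ← neg_div]
  ring_nf

theorem macdonaldQuotient_ofReal {r : ℝ} (hr : 0 < r) {m : ℂ} (hm : ∀ n : ℤ, m ≠ n)
    (hre : -(1 / 2) < m.re) :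
    macdonaldQuotient ((2 * r : ℝ) : ℂ) m = besselF m ((2 * r : ℝ) : ℂ) := by
  have hrc : (r : ℂ) ≠ 0 := ofReal_ne_zero.2 hr.ne'
  have h2r : ((2 * r : ℝ) : ℂ) ≠ 0 := ofReal_ne_zero.2 (by positivity)
  have hp : ((Real.sqrt Real.pi : ℝ) : ℂ) * ((Real.sqrt Real.pi : ℝ) : ℂ) = (Real.pi : ℂ) := by
    rw [← ofReal_mul, Real.mul_self_sqrt Real.pi_pos.le]
  have h := cpow_mul_besselG_eq_besselSeries hr hm
  have e1 : ((2 * r : ℝ) : ℂ) / 2 = r := by push_cast; field_simp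
  have e2 : ((2 * r : ℝ) : ℂ) ^ 2 / 4 = (r : ℂ) ^ 2 := by push_cast; ring
  rw [besselF_ofReal hr hre, macdonaldQuotient, besselI1_eq h2r, besselI1_eq h2r, e1, e2,
    cpow_add _ _ hrc, cpow_add _ _ hrc]
  generalize Complex.sin ((Real.pi : ℂ) * m) = s at *
  rw [← hp] at h
  set R := (r : ℂ) ^ (1 / 2 : ℂ)
  have h' : ((Real.sqrt Real.pi : ℝ) : ℂ)⁻¹ * ((r : ℂ) ^ m * besselG m r) =
      ((Real.sqrt Real.pi : ℝ) : ℂ) / s * ((r : ℂ) ^ (-m) * besselSeries (-m) ((r : ℂ) ^ 2) -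
        (r : ℂ) ^ m * besselSeries m ((r : ℂ) ^ 2)) := by
    rw [h]; field_simp
  linear_combination -R * h'

theorem macdonaldQuotient_eq_besselF {m : ℂ} (hm : ∀ n : ℤ, m ≠ n) (hre : -(1 / 2) < m.re)
    {z : ℂ} (hz : z ∈ slitPlane) : macdonaldQuotient z m = besselF m z := by
  refine eqOn_of_eq_on_real isOpen_slitPlane isPreconnected_slitPlane
    (f := fun z => macdonaldQuotient z m)
    (((differentiableOn_besselI1 m).neg.add (differentiableOn_besselI1 (-m))).div_const _)
    (differentiableOn_besselF hre) (x₀ := 1) (by simp) (fun x hx _ => ?_) hz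
  have := macdonaldQuotient_ofReal (r := x / 2) (by linarith) hm hre
  rwa [mul_div_cancel₀ x two_ne_zero] at this

/-- Close to `m`, apart from `m` itself, the non-integer formula is available; this is what computes
the limit in `extendToIntegers`. -/
theorem eventually_ne_intCast (m : ℂ) : ∀ᶠ μ : ℂ in 𝓝[≠] m, ∀ n : ℤ, μ ≠ n := by
  have hcl : IsClosed (((↑) : ℤ → ℂ) '' {n : ℤ | (n : ℂ) ≠ m}) :=
    Complex.isClosedEmbedding_intCast.isClosedMap _ (isClosed_discrete _)
  have hmem : (((↑) : ℤ → ℂ) '' {n : ℤ | (n : ℂ) ≠ m})ᶜ ∈ 𝓝 m :=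
    hcl.isOpen_compl.mem_nhds (by rintro ⟨n, hn, rfl⟩; exact hn rfl)
  filter_upwards [self_mem_nhdsWithin, nhdsWithin_le_nhds hmem] with μ hμ hμ' n hn
  exact hμ' ⟨n, fun h => hμ (hn.trans h), hn.symm⟩

theorem tendsto_macdonaldQuotient {m : ℂ} (hre : -(1 / 2) < m.re) {z : ℂ} (hz : z ∈ slitPlane) :
    Tendsto (macdonaldQuotient z) (𝓝[≠] m) (𝓝 (besselF m z)) := by
  have hopen : IsOpen {m : ℂ | -(1 / 2) < m.re} := isOpen_lt continuous_const continuous_re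
  have h : Tendsto (fun μ => besselF μ z) (𝓝[≠] m) (𝓝 (besselF m z)) :=
    ((differentiableOn_besselF_index hz).continuousOn.continuousAt
      (hopen.mem_nhds hre)).tendsto.mono_left nhdsWithin_le_nhds
  refine h.congr' ?_
  filter_upwards [eventually_ne_intCast m, nhdsWithin_le_nhds (hopen.mem_nhds hre)] with μ h1 h2
  exact (macdonaldQuotient_eq_besselF h1 h2 hz).symm

theorem tendsto_macdonaldQuotient_neg {m : ℂ} (hre : -(1 / 2) < m.re) {z : ℂ}
    (hz : z ∈ slitPlane) :
    Tendsto (macdonaldQuotient z) (𝓝[≠] (-m)) (𝓝 (besselF m z)) := by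
  have hneg : Tendsto (fun μ : ℂ => -μ) (𝓝[≠] (-m)) (𝓝[≠] m) := by
    refine tendsto_nhdsWithin_iff.2 ⟨?_, ?_⟩
    · exact (continuous_neg.tendsto' (-m) m (neg_neg m)).mono_left nhdsWithin_le_nhds
    · filter_upwards [self_mem_nhdsWithin] with μ hμ h
      exact hμ (by rw [mem_singleton_iff] at h ⊢; rw [← h, neg_neg])
  exact ((tendsto_macdonaldQuotient hre hz).comp hneg).congr fun μ => macdonaldQuotient_neg z μ

theorem macdonaldK1_eq_besselF {m : ℂ} (hre : -(1 / 2) < m.re) {z : ℂ} (hz : z ∈ slitPlane) :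
    macdonaldK1 m z = besselF m z := by
  rw [macdonaldK1, extendToIntegers]
  split_ifs with h
  · exact (tendsto_macdonaldQuotient hre hz).limUnder_eq
  · exact macdonaldQuotient_eq_besselF (fun n hn => h ⟨n, hn⟩) hre hz

theorem macdonaldK1_neg_eq_besselF {m : ℂ} (hre : -(1 / 2) < m.re) {z : ℂ} (hz : z ∈ slitPlane) :
    macdonaldK1 (-m) z = besselF m z := by
  rw [macdonaldK1, extendToIntegers]
  split_ifs with h
  · exact (tendsto_macdonaldQuotient_neg hre hz).limUnder_eq
  · refine (macdonaldQuotient_neg z m).trans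
      (macdonaldQuotient_eq_besselF (fun n hn => h ⟨-n, ?_⟩) hre hz)
    rw [hn]; push_cast; rfl

/-- `F` is available only for `Re μ > -1/2`, but `K` is even in its index, so a sign can be chosen
once for all `z`. -/
theorem exists_index_macdonaldK1_eq_besselF (m : ℂ) : ∃ μ : ℂ, (μ = m ∨ μ = -m) ∧ 0 ≤ μ.re ∧
    ∀ z ∈ slitPlane, macdonaldK1 m z = besselF μ z := by
  rcases le_total 0 m.re with h | h
  · exact ⟨m, Or.inl rfl, h, fun z hz => macdonaldK1_eq_besselF (by linarith) hz⟩
  · refine ⟨-m, Or.inr rfl, by simpa using h, fun z hz => ?_⟩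
    have := macdonaldK1_neg_eq_besselF (m := -m) (by simp; linarith) hz
    rwa [neg_neg] at this

theorem tendsto_macdonaldQuotient_macdonaldK1 (m : ℂ) {z : ℂ} (hz : z ∈ slitPlane) :
    Tendsto (macdonaldQuotient z) (𝓝[≠] m) (𝓝 (macdonaldK1 m z)) := by
  obtain ⟨μ, hμ, hre, h⟩ := exists_index_macdonaldK1_eq_besselF m
  rw [h z hz]
  rcases hμ with rfl | rfl
  · exact tendsto_macdonaldQuotient (by linarith) hz
  · have := tendsto_macdonaldQuotient_neg (m := -m) (by linarith) hz
    rwa [neg_neg] at this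

/-! ### Hankel functions as rotated MacDonald functions -/

/-- The quotient defining the Hankel functions at non-integer parameters. -/
noncomputable def hankelQuotient (ε : ℤˣ) (z μ : ℂ) : ℂ :=
  ((ε : ℤ) : ℂ) * I *
    (Complex.exp (-(((ε : ℤ) : ℂ) * I * (Real.pi : ℂ) * μ)) * besselJ1 μ z - besselJ1 (-μ) z) /
      Complex.sin ((Real.pi : ℂ) * μ)

theorem besselJ1_eq_besselI1 (ε : ℤˣ) {w : ℂ} (hw : 0 < w.re) (μ : ℂ) :
    besselJ1 μ (((ε : ℤ) : ℂ) * I * w) =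
      Complex.exp (((ε : ℤ) : ℂ) * I * Real.pi / 2 * (μ + 1 / 2)) * besselI1 μ w := by
  have hw0 : w ≠ 0 := fun h => by simp [h] at hw
  have hε0 : ((ε : ℤ) : ℂ) ≠ 0 := by exact_mod_cast ε.ne_zero
  have hε2 : ((ε : ℤ) : ℂ) ^ 2 = 1 := by
    rcases Int.units_eq_one_or ε with rfl | rfl <;> simp
  have hz0 : ((ε : ℤ) : ℂ) * I * w ≠ 0 := mul_ne_zero (mul_ne_zero hε0 I_ne_zero) hw0
  rw [besselJ1_eq hz0, besselI1_eq hw0]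
  have e1 : -((((ε : ℤ) : ℂ) * I * w) ^ 2 / 4) = w ^ 2 / 4 := by
    rw [mul_pow, mul_pow, hε2, I_sq]; ring
  have harg := abs_lt.1 (abs_arg_lt_pi_div_two_iff.2 (Or.inl (show 0 < (w / 2).re by simpa using hw)))
  -- As `|arg(w/2)| < π/2`, rotation by `±π/2` stays within the principal branch.
  have hlog : Complex.log (((ε : ℤ) : ℂ) * I * w / 2) =
      ((ε : ℤ) : ℂ) * I * Real.pi / 2 + Complex.log (w / 2) := by
    have hw2 : w / 2 ≠ 0 := div_ne_zero hw0 two_ne_zero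
    have hlog1 : Complex.log (((ε : ℤ) : ℂ) * I) = ((ε : ℤ) : ℂ) * I * Real.pi / 2 := by
      rcases Int.units_eq_one_or ε with rfl | rfl
      · simp [Complex.log_I]; ring
      · simp [Complex.log_neg_I]; ring
    have harg1 : Complex.arg (((ε : ℤ) : ℂ) * I) = ((ε : ℤ) : ℝ) * Real.pi / 2 := by
      rcases Int.units_eq_one_or ε with rfl | rfl
      · simp
      · simp; ring
    rw [mul_div_assoc, Complex.log_mul (mul_ne_zero hε0 I_ne_zero) hw2, hlog1]
    rw [harg1]
    rcases Int.units_eq_one_or ε with rfl | rfl <;> constructor <;> push_cast <;> linarith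
  rw [e1, cpow_def_of_ne_zero (div_ne_zero hz0 two_ne_zero),
    cpow_def_of_ne_zero (div_ne_zero hw0 two_ne_zero), hlog, add_mul, Complex.exp_add]
  ring

/-- The factor relating the Hankel functions to the MacDonald function. -/
noncomputable def hankelFactor (ε : ℤˣ) (μ : ℂ) : ℂ :=
  -(((ε : ℤ) : ℂ) * I) * Complex.exp (((ε : ℤ) : ℂ) * I * Real.pi / 2 * (1 / 2 - μ))

/-- The factor `e^(-εiπμ)` in front of `J_μ` equalizes the two phases, so they come out in common
and leave `I_μ - I_{-μ}`. -/
theorem hankelQuotient_eq (ε : ℤˣ) {w : ℂ} (hw : 0 < w.re) (μ : ℂ) :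
    hankelQuotient ε (((ε : ℤ) : ℂ) * I * w) μ = hankelFactor ε μ * macdonaldQuotient w μ := by
  rw [hankelQuotient, hankelFactor, macdonaldQuotient, besselJ1_eq_besselI1 ε hw,
    besselJ1_eq_besselI1 ε hw, ← mul_assoc, ← Complex.exp_add,
    show -(((ε : ℤ) : ℂ) * I * Real.pi * μ) + ((ε : ℤ) : ℂ) * I * Real.pi / 2 * (μ + 1 / 2) =
      ((ε : ℤ) : ℂ) * I * Real.pi / 2 * (1 / 2 - μ) by ring,
    show -μ + 1 / 2 = 1 / 2 - μ by ring]
  ring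

theorem hankelH1_eq (ε : ℤˣ) {w : ℂ} (hw : 0 < w.re) (m : ℂ) :
    hankelH1 ε m (((ε : ℤ) : ℂ) * I * w) = hankelFactor ε m * macdonaldK1 m w := by
  rw [hankelH1, extendToIntegers]
  split_ifs with h
  · have hw' : w ∈ slitPlane := Or.inl hw
    have hc : Continuous (hankelFactor ε) := by unfold hankelFactor; fun_prop
    have ht := ((hc.tendsto m).mono_left (nhdsWithin_le_nhds (s := {m}ᶜ))).mul
      (tendsto_macdonaldQuotient_macdonaldK1 m hw')
    refine Tendsto.limUnder_eq (ht.congr fun μ => (hankelQuotient_eq ε hw μ).symm)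
  · rw [macdonaldK1, extendToIntegers, if_neg h]
    exact hankelQuotient_eq ε hw m

/-! ### The rational integral V -/

theorem image_div_one_add_Ioi : (fun w : ℝ => w / (1 + w)) '' Ioi 0 = Ioo 0 1 := by
  ext x
  constructor
  · rintro ⟨w, hw, rfl⟩
    have hw0 : 0 < w := hw
    exact ⟨by positivity, by rw [div_lt_one (by positivity)]; linarith⟩
  · rintro ⟨h0, h1⟩
    have : 0 < 1 - x := by linarith
    refine ⟨x / (1 - x), div_pos h0 this, ?_⟩
    field_simp
    ring

theorem integral_cpow_div_one_add_pow {u v : ℂ} {N : ℕ} (huv : u + v = N) :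
    ∫ w in Ioi (0 : ℝ), (w : ℂ) ^ (u - 1) / (1 + (w : ℂ)) ^ N = Complex.betaIntegral u v := by
  have hd : ∀ w ∈ Ioi (0 : ℝ), HasDerivWithinAt (fun w : ℝ => w / (1 + w))
      (1 / (1 + w) ^ 2) (Ioi 0) w := by
    intro w hw
    have hw0 : (1 + w) ≠ 0 := by have := mem_Ioi.1 hw; positivity
    refine (((hasDerivAt_id w).div ((hasDerivAt_id w).const_add 1) hw0).congr_deriv
      ?_).hasDerivWithinAt
    simp
  have hinj : InjOn (fun w : ℝ => w / (1 + w)) (Ioi 0) := by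
    intro w hw y hy h
    have hw0 : (1 + w) ≠ 0 := by have := mem_Ioi.1 hw; positivity
    have hy0 : (1 + y) ≠ 0 := by have := mem_Ioi.1 hy; positivity
    simp only at h
    rw [div_eq_div_iff hw0 hy0] at h
    linarith
  rw [Complex.betaIntegral, intervalIntegral.integral_of_le zero_le_one,
    integral_Ioc_eq_integral_Ioo, ← image_div_one_add_Ioi,
    integral_image_eq_integral_abs_deriv_smul measurableSet_Ioi hd hinj]
  refine setIntegral_congr_fun measurableSet_Ioi fun w hw => ?_
  have hw0 : 0 < w := hw
  have h1 : 0 < 1 + w := by positivity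
  have h1c : ((1 + w : ℝ) : ℂ) ≠ 0 := ofReal_ne_zero.2 h1.ne'
  have e1 : 1 - ((w / (1 + w) : ℝ) : ℂ) = (((1 + w)⁻¹ : ℝ) : ℂ) := by
    push_cast at h1c ⊢
    field_simp
    ring
  have e2 : ((w / (1 + w) : ℝ) : ℂ) ^ (u - 1) =
      (w : ℂ) ^ (u - 1) * (((1 + w)⁻¹ : ℝ) : ℂ) ^ (u - 1) := by
    rw [div_eq_mul_inv, ofReal_mul, mul_cpow_ofReal_nonneg hw0.le (inv_pos.2 h1).le]
  have hi : (((1 + w)⁻¹ : ℝ) : ℂ) ≠ 0 := ofReal_ne_zero.2 (inv_pos.2 h1).ne'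
  have e3 : (((1 + w)⁻¹ : ℝ) : ℂ) ^ (u - 1) * (((1 + w)⁻¹ : ℝ) : ℂ) ^ (v - 1) =
      (1 + (w : ℂ)) ^ 2 / (1 + (w : ℂ)) ^ N := by
    rw [← cpow_add _ _ hi, show u - 1 + (v - 1) = (N : ℂ) - (2 : ℕ) by push_cast; rw [← huv]; ring,
      cpow_sub _ _ hi, cpow_natCast, cpow_natCast, ofReal_inv, inv_pow, inv_pow]
    push_cast at h1c ⊢
    field_simp
  rw [e1, e2, mul_assoc, e3, abs_of_pos (by positivity), real_smul]
  push_cast at h1c ⊢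
  field_simp

theorem integral_cpow_div_add_pow {u v : ℂ} {N : ℕ} (huv : u + v = N) {c : ℝ} (hc : 0 < c) :
    ∫ w in Ioi (0 : ℝ), (w : ℂ) ^ (u - 1) / ((w : ℂ) + c) ^ N =
      (c : ℂ) ^ (u - N) * Complex.betaIntegral u v := by
  have hcc : (c : ℂ) ≠ 0 := ofReal_ne_zero.2 hc.ne'
  rw [← integral_cpow_div_one_add_pow huv, ← mul_zero c, ← integral_comp_mul_left_Ioi' _ _ hc,
    mul_zero, real_smul, ← integral_const_mul, ← integral_const_mul]
  refine setIntegral_congr_fun measurableSet_Ioi fun w hw => ?_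
  have hw0 : 0 < w := hw
  have e : ((c * w : ℝ) : ℂ) + c = c * (1 + w) := by push_cast; ring
  rw [e, ofReal_mul, mul_cpow_ofReal_nonneg hc.le hw0.le, cpow_sub _ _ hcc, cpow_sub _ _ hcc,
    cpow_natCast, cpow_one, mul_pow]
  field_simp

theorem integrableOn_Ioi_of_rpow_bounds {g : ℝ → ℂ}
    (hmeas : AEStronglyMeasurable g (volume.restrict (Ioi 0))) {C α β : ℝ} (hα : -1 < α)
    (hβ : β < -1) (h1 : ∀ w ∈ Ioc (0 : ℝ) 1, ‖g w‖ ≤ C * w ^ α)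
    (h2 : ∀ w ∈ Ioi (1 : ℝ), ‖g w‖ ≤ C * w ^ β) : IntegrableOn g (Ioi 0) := by
  rw [← Ioc_union_Ioi_eq_Ioi zero_le_one, integrableOn_union]
  constructor
  · have hI : IntegrableOn (fun w : ℝ => w ^ α) (Ioc 0 1) := by
      have := intervalIntegral.intervalIntegrable_rpow' (a := 0) (b := 1) hα
      rwa [intervalIntegrable_iff_integrableOn_Ioc_of_le zero_le_one] at this
    refine (hI.const_mul C).mono' (hmeas.mono_set Ioc_subset_Ioi_self) ?_
    filter_upwards [ae_restrict_mem measurableSet_Ioc] with w hw using h1 w hw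
  · refine ((integrableOn_Ioi_rpow_of_lt hβ one_pos).const_mul C).mono'
      (hmeas.mono_set (Ioi_subset_Ioi zero_le_one)) ?_
    filter_upwards [ae_restrict_mem measurableSet_Ioi] with w hw using h2 w hw

/-- The exponents `p₁ ≤ Re s ≤ p₂` are kept free so that the same estimate gives integrability (both
equal to `Re s`) and domination uniform over a neighbourhood in the index. -/
theorem norm_rational_kernel_le {c : ℝ} (hc : 0 < c) {s : ℂ} {w p₁ p₂ : ℝ} (hw : 0 < w)
    (h1 : p₁ ≤ s.re) (h2 : s.re ≤ p₂) :
    (w ≤ 1 → ‖(w : ℂ) ^ (s + 1) / ((1 + (w : ℂ)) ^ 2 * ((w : ℂ) + c) ^ 2)‖ ≤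
      max 1 (c ^ 2)⁻¹ * w ^ (p₁ + 1)) ∧
    (1 ≤ w → ‖(w : ℂ) ^ (s + 1) / ((1 + (w : ℂ)) ^ 2 * ((w : ℂ) + c) ^ 2)‖ ≤
      max 1 (c ^ 2)⁻¹ * w ^ (p₂ - 3)) := by
  have e1 : (1 + (w : ℂ)) = ((1 + w : ℝ) : ℂ) := by push_cast; rfl
  have e2 : (w : ℂ) + c = ((w + c : ℝ) : ℂ) := by push_cast; rfl
  rw [e1, e2, norm_div, norm_mul, norm_pow, norm_pow, norm_real, norm_real,
    Real.norm_of_nonneg (by positivity), Real.norm_of_nonneg (by positivity),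
    norm_cpow_eq_rpow_re_of_pos hw, add_re, one_re]
  constructor
  · intro h
    have h3 : w ^ (s.re + 1) ≤ w ^ (p₁ + 1) :=
      Real.rpow_le_rpow_of_exponent_ge hw h (by linarith)
    have h4 : c ^ 2 ≤ (1 + w) ^ 2 * (w + c) ^ 2 := by
      have a1 : 1 ≤ (1 + w) ^ 2 := by nlinarith
      have a2 : c ^ 2 ≤ (w + c) ^ 2 := by nlinarith
      nlinarith [sq_nonneg c]
    calc w ^ (s.re + 1) / ((1 + w) ^ 2 * (w + c) ^ 2) ≤ w ^ (p₁ + 1) / c ^ 2 := by gcongr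
      _ = (c ^ 2)⁻¹ * w ^ (p₁ + 1) := by rw [div_eq_inv_mul]
      _ ≤ _ := by gcongr; exact le_max_right _ _
  · intro h
    have h3 : w ^ (s.re + 1) ≤ w ^ (p₂ + 1) :=
      Real.rpow_le_rpow_of_exponent_le h (by linarith)
    have h4 : w ^ 4 ≤ (1 + w) ^ 2 * (w + c) ^ 2 := by
      have a1 : w ^ 2 ≤ (1 + w) ^ 2 := by nlinarith
      have a2 : w ^ 2 ≤ (w + c) ^ 2 := by nlinarith
      calc w ^ 4 = w ^ 2 * w ^ 2 := by ring
        _ ≤ _ := by gcongr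
    calc w ^ (s.re + 1) / ((1 + w) ^ 2 * (w + c) ^ 2) ≤ w ^ (p₂ + 1) / w ^ 4 := by gcongr
      _ = 1 * w ^ (p₂ - 3) := by
        rw [show p₂ - 3 = p₂ + 1 - (4 : ℕ) by push_cast; ring, Real.rpow_sub hw, Real.rpow_natCast,
          one_mul]
      _ ≤ _ := by gcongr; exact le_max_left _ _

/-- The integral `∫₀^∞ w^(m+1) / ((1+w)² (w+c)²) dw`. -/
noncomputable def rationalIntegral (c : ℝ) (m : ℂ) : ℂ :=
  ∫ w in Ioi (0 : ℝ), (w : ℂ) ^ (m + 1) / ((1 + (w : ℂ)) ^ 2 * ((w : ℂ) + c) ^ 2)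

theorem measurable_rational_kernel (c : ℝ) (m : ℂ) :
    Measurable fun w : ℝ => (w : ℂ) ^ (m + 1) / ((1 + (w : ℂ)) ^ 2 * ((w : ℂ) + c) ^ 2) := by
  fun_prop

theorem integrableOn_rational_kernel {c : ℝ} (hc : 0 < c) {m : ℂ} (h1 : -2 < m.re)
    (h2 : m.re < 2) : IntegrableOn
      (fun w : ℝ => (w : ℂ) ^ (m + 1) / ((1 + (w : ℂ)) ^ 2 * ((w : ℂ) + c) ^ 2)) (Ioi 0) :=
  integrableOn_Ioi_of_rpow_bounds (measurable_rational_kernel c m).aestronglyMeasurable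
    (α := m.re + 1) (β := m.re - 3) (by linarith) (by linarith)
    (fun _ hw => (norm_rational_kernel_le hc hw.1 le_rfl le_rfl).1 hw.2)
    (fun _ hw => (norm_rational_kernel_le hc (zero_lt_one.trans hw) le_rfl le_rfl).2 (le_of_lt hw))

/-- The vertical strip `-2 < Re m < 2`. -/
def strip : Set ℂ := {m | -2 < m.re ∧ m.re < 2}

theorem isOpen_strip : IsOpen strip :=
  (isOpen_lt continuous_const continuous_re).inter (isOpen_lt continuous_re continuous_const)

theorem isPreconnected_strip : IsPreconnected strip :=
  ((convex_halfSpace_re_gt (-2)).inter (convex_halfSpace_re_lt 2)).isPreconnected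

theorem differentiableOn_rationalIntegral {c : ℝ} (hc : 0 < c) :
    DifferentiableOn ℂ (rationalIntegral c) strip := by
  refine differentiableOn_integral_of_locally_dominated isOpen_strip
    (fun m _ => (measurable_rational_kernel c m).aestronglyMeasurable) ?_ ?_
  · filter_upwards [ae_restrict_mem measurableSet_Ioi] with w hw m _
    have h0 : (w : ℂ) ≠ 0 := ofReal_ne_zero.2 (ne_of_gt hw)
    exact ((DifferentiableAt.const_cpow (by fun_prop) (Or.inl h0)).div_const
      _).differentiableWithinAt
  · intro m₀ hm₀
    obtain ⟨p₁, hp₁, hp₁'⟩ := exists_between hm₀.1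
    obtain ⟨p₂, hp₂, hp₂'⟩ := exists_between hm₀.2
    refine ⟨{m | p₁ < m.re ∧ m.re < p₂}, ((isOpen_lt continuous_const continuous_re).inter
      (isOpen_lt continuous_re continuous_const)).mem_nhds ⟨hp₁', hp₂⟩,
      fun w => max 1 (c ^ 2)⁻¹ * if w ≤ 1 then w ^ (p₁ + 1) else w ^ (p₂ - 3), ?_, ?_⟩
    · have hmeas : Measurable fun w : ℝ =>
          ((max 1 (c ^ 2)⁻¹ * if w ≤ 1 then w ^ (p₁ + 1) else w ^ (p₂ - 3) : ℝ) : ℂ) := by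
        refine measurable_ofReal.comp (Measurable.const_mul (Measurable.ite measurableSet_Iic ?_ ?_) _)
        · fun_prop
        · fun_prop
      have h := integrableOn_Ioi_of_rpow_bounds hmeas.aestronglyMeasurable
        (C := max 1 (c ^ 2)⁻¹) (α := p₁ + 1) (β := p₂ - 3) (by linarith) (by linarith) ?_ ?_
      · simpa using h.re
      · intro w hw
        have := hw.1
        rw [norm_real, if_pos hw.2, Real.norm_of_nonneg (by positivity)]
      · intro w hw
        have : 0 < w := zero_lt_one.trans hw
        rw [norm_real, if_neg (not_le.2 hw), Real.norm_of_nonneg (by positivity)]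
    · filter_upwards [ae_restrict_mem measurableSet_Ioi] with w hw m hm
      split_ifs with h
      · exact (norm_rational_kernel_le hc hw hm.1.le hm.2.le).1 h
      · exact (norm_rational_kernel_le hc hw hm.1.le hm.2.le).2 (le_of_not_ge h)

theorem betaIntegral_add_one_neg {m : ℂ} (h1 : -1 < m.re) (h2 : m.re < 0) :
    Complex.betaIntegral (m + 1) (-m) = -((Real.pi : ℂ) / Complex.sin (Real.pi * m)) := by
  have h := Complex.Gamma_mul_Gamma_eq_betaIntegral (s := m + 1) (t := -m)
    (by simp; linarith) (by simpa using h2)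
  rw [show m + 1 + -m = 1 by ring, Complex.Gamma_one, one_mul] at h
  have h3 := Complex.Gamma_mul_Gamma_one_sub (-m)
  rw [show 1 - -m = m + 1 by ring, mul_neg, Complex.sin_neg, div_neg] at h3
  rw [← h, mul_comm, h3]

theorem betaIntegral_add_two_neg {m : ℂ} (h1 : -1 < m.re) (h2 : m.re < 0) :
    Complex.betaIntegral (m + 2) (-m) =
      -((m + 1) * ((Real.pi : ℂ) / Complex.sin (Real.pi * m))) := by
  have h := Complex.Gamma_mul_Gamma_eq_betaIntegral (s := m + 2) (t := -m)
    (by simp; linarith) (by simpa using h2)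
  have hm1 : m + 1 ≠ 0 := fun h => by
    have := congrArg re h; simp at this; linarith
  have h3 := Complex.Gamma_mul_Gamma_one_sub (-m)
  rw [show 1 - -m = m + 1 by ring, mul_neg, Complex.sin_neg, div_neg] at h3
  rw [show m + 2 + -m = 1 + 1 by ring, Complex.Gamma_add_one 1 one_ne_zero, Complex.Gamma_one,
    one_mul, one_mul, show m + 2 = m + 1 + 1 by ring, Complex.Gamma_add_one _ hm1] at h
  rw [show m + 2 = m + 1 + 1 by ring, ← h, mul_assoc, mul_comm (Complex.Gamma (m + 1)), h3]
  ring

theorem integrableOn_cpow_div_add_pow {c : ℝ} (hc : 0 < c) {s : ℂ} {N : ℕ} (h1 : -1 < s.re)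
    (h2 : s.re < N - 1) : IntegrableOn (fun w : ℝ => (w : ℂ) ^ s / ((w : ℂ) + c) ^ N) (Ioi 0) := by
  have hn : ∀ w : ℝ, 0 < w → ‖(w : ℂ) ^ s / ((w : ℂ) + c) ^ N‖ = w ^ s.re / (w + c) ^ N := by
    intro w hw
    have e2 : (w : ℂ) + c = ((w + c : ℝ) : ℂ) := by push_cast; rfl
    rw [e2, norm_div, norm_pow, norm_real, Real.norm_of_nonneg (by positivity),
      norm_cpow_eq_rpow_re_of_pos hw]
  refine integrableOn_Ioi_of_rpow_bounds (C := max 1 (c ^ N)⁻¹) (α := s.re) (β := s.re - N)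
    (Measurable.aestronglyMeasurable (by fun_prop)) h1 (by linarith) (fun w hw => ?_)
    (fun w hw => ?_)
  · have hw0 := hw.1
    rw [hn w hw.1]
    calc w ^ s.re / (w + c) ^ N ≤ w ^ s.re / c ^ N := by gcongr; linarith
      _ = (c ^ N)⁻¹ * w ^ s.re := by rw [div_eq_inv_mul]
      _ ≤ _ := by gcongr; exact le_max_right _ _
  · have hw0 : 0 < w := zero_lt_one.trans hw
    rw [hn w hw0]
    calc w ^ s.re / (w + c) ^ N ≤ w ^ s.re / w ^ N := by gcongr; linarith
      _ = 1 * w ^ (s.re - N) := by rw [Real.rpow_sub hw0, Real.rpow_natCast, one_mul]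
      _ ≤ _ := by gcongr; exact le_max_left _ _

/-- Partial fractions reduce `V` to integrals of `w^(m+1)/(w+c)²` and `w^m/(w+c)`, at `c` and at 1.
All of them converge for `-1 < Re m < 0`, and they are Beta integrals known from the reflection
formula. -/
theorem rationalIntegral_eq_of_re_neg {c : ℝ} (hc : 0 < c) {m : ℂ} (h1 : -1 < m.re)
    (h2 : m.re < 0) :
    Complex.sin (Real.pi * m) * ((c : ℂ) - 1) ^ 3 * rationalIntegral c m =
      -(Real.pi * ((m + 1) * (c - 1) * (1 + (c : ℂ) ^ m) - 2 * ((c : ℂ) ^ (m + 1) - 1))) := by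
  have hcc : (c : ℂ) ≠ 0 := ofReal_ne_zero.2 hc.ne'
  have hsin : Complex.sin (Real.pi * m) ≠ 0 := by
    intro h
    obtain ⟨k, hk⟩ := Complex.sin_eq_zero_iff.1 h
    have hpi : (Real.pi : ℂ) ≠ 0 := ofReal_ne_zero.2 Real.pi_ne_zero
    have hm : m = (k : ℂ) := mul_left_cancel₀ hpi (by rw [hk]; ring)
    rw [hm, intCast_re] at h1 h2
    have h3 : (-1 : ℤ) < k := by exact_mod_cast h1
    have h4 : k < 0 := by exact_mod_cast h2
    lia
  have hre1 : (m + 1).re = m.re + 1 := by simp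
  have I1 := fun {c : ℝ} (hc : 0 < c) => integrableOn_cpow_div_add_pow hc (s := m + 1) (N := 2)
    (by rw [hre1]; linarith) (by rw [hre1]; push_cast; linarith)
  have I2 := fun {c : ℝ} (hc : 0 < c) => integrableOn_cpow_div_add_pow hc (s := m) (N := 1)
    h1 (by push_cast; linarith)
  have J1 : ∀ {c : ℝ}, 0 < c → ∫ w in Ioi (0 : ℝ), (w : ℂ) ^ (m + 1) / ((w : ℂ) + c) ^ 2 =
      (c : ℂ) ^ m * -((m + 1) * ((Real.pi : ℂ) / Complex.sin (Real.pi * m))) := by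
    intro c hc
    have := integral_cpow_div_add_pow (u := m + 2) (v := -m) (N := 2) (by push_cast; ring) hc
    rwa [betaIntegral_add_two_neg h1 h2, show m + 2 - 1 = m + 1 by ring, Nat.cast_ofNat,
      add_sub_cancel_right] at this
  have J2 : ∀ {c : ℝ}, 0 < c → ∫ w in Ioi (0 : ℝ), (w : ℂ) ^ m / ((w : ℂ) + c) ^ 1 =
      (c : ℂ) ^ m * -((Real.pi : ℂ) / Complex.sin (Real.pi * m)) := by
    intro c hc
    have := integral_cpow_div_add_pow (u := m + 1) (v := -m) (N := 1) (by push_cast; ring) hc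
    rwa [betaIntegral_add_one_neg h1 h2, add_sub_cancel_right, Nat.cast_one,
      add_sub_cancel_right] at this
  have key : ((c : ℂ) - 1) ^ 3 * rationalIntegral c m = ∫ w in Ioi (0 : ℝ),
      ((((c : ℂ) - 1) * ((w : ℂ) ^ (m + 1) / ((w : ℂ) + (1 : ℝ)) ^ 2) +
        ((c : ℂ) - 1) * ((w : ℂ) ^ (m + 1) / ((w : ℂ) + c) ^ 2)) -
        (2 * c * ((w : ℂ) ^ m / ((w : ℂ) + c) ^ 1) -
          2 * ((w : ℂ) ^ m / ((w : ℂ) + (1 : ℝ)) ^ 1))) := by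
    rw [rationalIntegral, ← integral_const_mul]
    refine setIntegral_congr_fun measurableSet_Ioi fun w hw => ?_
    have hw0 : 0 < w := hw
    have hwc : (w : ℂ) ≠ 0 := ofReal_ne_zero.2 hw0.ne'
    have d1 : (w : ℂ) + 1 ≠ 0 := by
      have : ((w + 1 : ℝ) : ℂ) ≠ 0 := ofReal_ne_zero.2 (by positivity)
      simpa using this
    have d2 : (w : ℂ) + c ≠ 0 := by
      have : ((w + c : ℝ) : ℂ) ≠ 0 := ofReal_ne_zero.2 (by positivity)
      simpa using this
    simp only [ofReal_one]
    rw [cpow_add _ _ hwc, cpow_one, add_comm (1 : ℂ)]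
    generalize (w : ℂ) ^ m = W
    field_simp
    ring
  have h3 := integral_sub (((I1 one_pos).const_mul ((c : ℂ) - 1)).add
    ((I1 hc).const_mul ((c : ℂ) - 1)))
    (((I2 hc).const_mul (2 * (c : ℂ))).sub ((I2 one_pos).const_mul 2))
  have h4 := integral_add ((I1 one_pos).const_mul ((c : ℂ) - 1))
    ((I1 hc).const_mul ((c : ℂ) - 1))
  have h5 := integral_sub ((I2 hc).const_mul (2 * (c : ℂ))) ((I2 one_pos).const_mul 2)
  simp only [integral_const_mul] at h4 h5
  rw [J1 one_pos, J1 hc] at h4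
  rw [J2 one_pos, J2 hc] at h5
  rw [mul_assoc, key]
  refine (congrArg _ (h3.trans (congrArg₂ _ h4 h5))).trans ?_
  rw [ofReal_one, one_cpow, cpow_add _ _ hcc, cpow_one]
  field_simp
  ring

/-- Both sides are holomorphic on the strip and agree near `-1/2`. The denominators are multiplied
out so that integer `m` and `c = 1` need no exception. -/
theorem rationalIntegral_eq {c : ℝ} (hc : 0 < c) {m : ℂ} (hm : m ∈ strip) :
    Complex.sin (Real.pi * m) * ((c : ℂ) - 1) ^ 3 * rationalIntegral c m =
      -(Real.pi * ((m + 1) * (c - 1) * (1 + (c : ℂ) ^ m) - 2 * ((c : ℂ) ^ (m + 1) - 1))) := by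
  have hcc : (c : ℂ) ≠ 0 := ofReal_ne_zero.2 hc.ne'
  have hcp : Differentiable ℂ fun m : ℂ => (c : ℂ) ^ m := fun m =>
    DifferentiableAt.const_cpow differentiableAt_id (Or.inl hcc)
  have hL : DifferentiableOn ℂ (fun m => Complex.sin (Real.pi * m) * ((c : ℂ) - 1) ^ 3 *
      rationalIntegral c m) strip :=
    DifferentiableOn.mul (by fun_prop) (differentiableOn_rationalIntegral hc)
  have hR : DifferentiableOn ℂ (fun m : ℂ => -(Real.pi * ((m + 1) * (c - 1) * (1 + (c : ℂ) ^ m) -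
      2 * ((c : ℂ) ^ (m + 1) - 1)))) strip := by
    fun_prop
  refine (hL.analyticOnNhd isOpen_strip).eqOn_of_preconnected_of_eventuallyEq
    (hR.analyticOnNhd isOpen_strip) isPreconnected_strip (z₀ := -(1 / 2)) ?_ ?_ hm
  · constructor <;> norm_num
  · have h : {m : ℂ | -1 < m.re ∧ m.re < 0} ∈ 𝓝 (-(1 / 2) : ℂ) :=
      ((isOpen_lt continuous_const continuous_re).inter
        (isOpen_lt continuous_re continuous_const)).mem_nhds (by constructor <;> norm_num)
    filter_upwards [h] with m hm
    exact rationalIntegral_eq_of_re_neg hc hm.1 hm.2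

theorem zero_mem_strip : (0 : ℂ) ∈ strip := by constructor <;> norm_num

theorem rationalIntegral_zero {c : ℝ} (hc : 0 < c) :
    ((c : ℂ) - 1) ^ 3 * rationalIntegral c 0 =
      (c + 1) * Complex.log c - 2 * (c - 1) := by
  have hcc : (c : ℂ) ≠ 0 := ofReal_ne_zero.2 hc.ne'
  have hpi : (Real.pi : ℂ) ≠ 0 := ofReal_ne_zero.2 Real.pi_ne_zero
  have hV := ((differentiableOn_rationalIntegral hc).differentiableAt
    (isOpen_strip.mem_nhds zero_mem_strip)).hasDerivAt
  have hS : HasDerivAt (fun m : ℂ => Complex.sin (Real.pi * m)) (Real.pi : ℂ) 0 := by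
    have := ((hasDerivAt_id (0 : ℂ)).const_mul (Real.pi : ℂ)).csin
    simpa using this
  have hP : HasDerivAt (fun m : ℂ => (c : ℂ) ^ m) (Complex.log c) 0 := by
    have := (hasDerivAt_id (0 : ℂ)).const_cpow (c := (c : ℂ)) (Or.inl hcc)
    simpa using this
  have hP1 : HasDerivAt (fun m : ℂ => (c : ℂ) ^ (m + 1)) (c * Complex.log c) 0 := by
    have := ((hasDerivAt_id (0 : ℂ)).add_const 1).const_cpow (c := (c : ℂ)) (Or.inl hcc)
    simpa using this
  -- At `m = 0` both sides vanish, so the derivatives are compared. The unknown derivative of `V` is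
  -- multiplied by `sin 0 = 0`.
  have hL := (hS.mul_const (((c : ℂ) - 1) ^ 3)).mul hV
  have hM := ((hasDerivAt_id (0 : ℂ)).add_const 1).mul_const ((c : ℂ) - 1)
  have hR := (((hM.mul (hP.const_add 1)).sub ((hP1.sub_const 1).const_mul 2)).const_mul
    (Real.pi : ℂ)).neg
  have he := hL.congr_of_eventuallyEq (f₁ := fun m : ℂ => -(Real.pi * ((m + 1) * (c - 1) *
    (1 + (c : ℂ) ^ m) - 2 * ((c : ℂ) ^ (m + 1) - 1)))) (by
      filter_upwards [isOpen_strip.mem_nhds zero_mem_strip] with m hm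
      exact (rationalIntegral_eq hc hm).symm)
  have h := he.unique hR
  simp only [mul_zero, Complex.sin_zero, zero_mul, add_zero, cpow_zero, id, zero_add, one_mul] at h
  apply mul_left_cancel₀ hpi
  linear_combination h

/-- At `c = 1` the general formula reads `0 = 0`, but the kernel is `w^(m+1)/(1+w)^4`, a Beta
integral with `Γ(4) = 6`. -/
theorem rationalIntegral_one_eq {m : ℂ} (hm : m ∈ strip) :
    rationalIntegral 1 m = Complex.Gamma (m + 2) * Complex.Gamma (2 - m) / 6 := by
  have h := integral_cpow_div_one_add_pow (u := m + 2) (v := 2 - m) (N := 4) (by push_cast; ring)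
  have h2 := Complex.Gamma_mul_Gamma_eq_betaIntegral (s := m + 2) (t := 2 - m)
    (by simp; linarith [hm.1]) (by simp; linarith [hm.2])
  have h6 : Complex.Gamma 4 = 6 := by
    have := Complex.Gamma_nat_eq_factorial 3
    rw [show ((3 : ℕ) : ℂ) + 1 = 4 by norm_num] at this
    rw [this]
    norm_num [Nat.factorial]
  rw [show m + 2 + (2 - m) = 4 by ring, h6, ← h] at h2
  rw [eq_div_iff (by norm_num), h2, mul_comm, rationalIntegral]
  congr 1
  refine setIntegral_congr_fun measurableSet_Ioi fun w _ => ?_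
  simp only [ofReal_one]
  ring_nf

theorem rationalIntegral_one_eq_of_ne_intCast {m : ℂ} (hm : m ∈ strip) (hz : ∀ n : ℤ, m ≠ n) :
    rationalIntegral 1 m = m * (1 - m ^ 2) * Real.pi / (6 * Complex.sin (Real.pi * m)) := by
  have h0 : m ≠ 0 := by simpa using hz 0
  have h1 : m + 1 ≠ 0 := fun h => hz (-1) (by push_cast; linear_combination h)
  have h2 : 1 - m ≠ 0 := fun h => hz 1 (by push_cast; linear_combination -h)
  have h3 := Complex.Gamma_mul_Gamma_one_sub m
  rw [rationalIntegral_one_eq hm, show m + 2 = m + 1 + 1 by ring, Complex.Gamma_add_one _ h1,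
    Complex.Gamma_add_one _ h0, show 2 - m = 1 - m + 1 by ring, Complex.Gamma_add_one _ h2]
  calc _ = (m + 1) * m * (1 - m) * (Complex.Gamma m * Complex.Gamma (1 - m)) / 6 := by ring
    _ = _ := by rw [h3]; ring

theorem rationalIntegral_one_zero : rationalIntegral 1 0 = 1 / 6 := by
  have h := Complex.Gamma_nat_eq_factorial 1
  rw [show ((1 : ℕ) : ℂ) + 1 = 2 by norm_num, Nat.factorial_one, Nat.cast_one] at h
  rw [rationalIntegral_one_eq zero_mem_strip, zero_add, sub_zero, h, one_mul]

theorem rationalIntegral_one_one : rationalIntegral 1 1 = 1 / 3 := by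
  have h := Complex.Gamma_nat_eq_factorial 2
  rw [show ((2 : ℕ) : ℂ) + 1 = 1 + 2 by norm_num, Nat.factorial_two] at h
  rw [rationalIntegral_one_eq (by constructor <;> norm_num), h,
    show (2 : ℂ) - 1 = 1 by norm_num, Complex.Gamma_one]
  norm_num

/-! ### The triple integral for positive a and b -/

theorem integrableOn_pow_three_mul_exp {B : ℝ} (hB : 0 < B) :
    IntegrableOn (fun x : ℝ => x ^ 3 * Real.exp (-B * x ^ 2)) (Ioi 0) := by
  have := integrableOn_rpow_mul_exp_neg_mul_sq hB (s := (3 : ℕ)) (by norm_num)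
  simpa only [Real.rpow_natCast] using this

theorem integral_pow_three_mul_exp {B : ℝ} (hB : 0 < B) :
    ∫ x in Ioi (0 : ℝ), x ^ 3 * Real.exp (-B * x ^ 2) = 1 / (2 * B ^ 2) := by
  have h := _root_.integral_rpow_mul_exp_neg_mul_rpow (p := (2 : ℕ)) (q := (3 : ℕ)) (b := B)
    (by norm_num) (by norm_num) hB
  simp only [Real.rpow_natCast] at h
  rw [h, show -(((3 : ℕ) : ℝ) + 1) / ((2 : ℕ) : ℝ) = -((2 : ℕ) : ℝ) by norm_num,
    show (((3 : ℕ) : ℝ) + 1) / ((2 : ℕ) : ℝ) = 2 by norm_num, Real.rpow_neg hB.le,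
    Real.rpow_natCast, Real.Gamma_two]
  push_cast
  field_simp

theorem integrableOn_mul_exp_neg {t : ℝ} (ht : 0 < t) :
    IntegrableOn (fun s : ℝ => s * Real.exp (-(s * t))) (Ioi 0) := by
  have := integrableOn_rpow_mul_exp_neg_mul (p := 2) two_pos ht
  norm_num at this
  simpa only [mul_comm] using this

theorem integral_mul_exp_neg {t : ℝ} (ht : 0 < t) :
    ∫ s in Ioi (0 : ℝ), s * Real.exp (-(s * t)) = 1 / t ^ 2 := by
  have h := Real.integral_rpow_mul_exp_neg_mul_Ioi (a := (2 : ℕ)) (by norm_num) ht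
  rw [show ((2 : ℕ) : ℝ) - 1 = (1 : ℕ) by norm_num] at h
  simp only [Real.rpow_natCast, pow_one] at h
  rw [Nat.cast_ofNat, Real.Gamma_two, mul_one, one_div_pow] at h
  rw [← h]
  refine integral_congr_ae (Eventually.of_forall fun s => ?_)
  simp only [mul_comm s t]

/-- The quadratic coefficient in the exponent of `besselTripleKernel`. -/
noncomputable def besselTripleCoeff (a b w : ℝ) : ℝ := (a ^ 2 + b ^ 2 / w) / 4

/-- The integrand of the triple integral representing `∫ x³ G_m(ax/2) G_{-m}(bx/2) dx`. -/
noncomputable def besselTripleKernel (a b : ℝ) (m : ℂ) (p : ℝ × ℝ) (x : ℝ) : ℂ :=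
  (p.1 : ℂ) ^ (m - 1) * ((x ^ 3 * Real.exp (-(besselTripleCoeff a b p.1 / p.2) * x ^ 2) *
    (p.2⁻¹ * Real.exp (-(p.2 * (1 + p.1)))) : ℝ) : ℂ)

section

variable {a b : ℝ} {m : ℂ}

theorem besselTripleCoeff_pos (ha : 0 < a) {w : ℝ} (hw : 0 < w) :
    0 < besselTripleCoeff a b w := by
  unfold besselTripleCoeff; positivity

theorem measurable_besselTripleKernel :
    Measurable (Function.uncurry (besselTripleKernel a b m)) := by
  unfold besselTripleKernel besselTripleCoeff Function.uncurry
  fun_prop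

theorem integral_besselTripleKernel (ha : 0 < a) {w s : ℝ} (hw : 0 < w) (hs : 0 < s) :
    ∫ x in Ioi (0 : ℝ), besselTripleKernel a b m (w, s) x =
      (w : ℂ) ^ (m - 1) * ((1 / (2 * besselTripleCoeff a b w ^ 2) *
        (s * Real.exp (-(s * (1 + w)))) : ℝ) : ℂ) := by
  have hA := besselTripleCoeff_pos (b := b) ha hw
  simp only [besselTripleKernel]
  rw [integral_const_mul, integral_complex_ofReal, integral_mul_const,
    integral_pow_three_mul_exp (div_pos hA hs)]
  congr 2
  field_simp

theorem integral_norm_besselTripleKernel (ha : 0 < a) {w s : ℝ} (hw : 0 < w) (hs : 0 < s) :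
    ∫ x in Ioi (0 : ℝ), ‖besselTripleKernel a b m (w, s) x‖ =
      w ^ (m.re - 1) * (1 / (2 * besselTripleCoeff a b w ^ 2) *
        (s * Real.exp (-(s * (1 + w))))) := by
  have hA := besselTripleCoeff_pos (b := b) ha hw
  have : ∀ x ∈ Ioi (0 : ℝ), ‖besselTripleKernel a b m (w, s) x‖ = w ^ (m.re - 1) *
      (x ^ 3 * Real.exp (-(besselTripleCoeff a b w / s) * x ^ 2) *
        (s⁻¹ * Real.exp (-(s * (1 + w))))) := by
    intro x hx
    have hx0 : 0 < x := hx
    rw [besselTripleKernel, norm_mul, norm_cpow_eq_rpow_re_of_pos hw, norm_real,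
      Real.norm_of_nonneg (by positivity), sub_re, one_re]
  rw [setIntegral_congr_fun measurableSet_Ioi this, integral_const_mul, integral_mul_const,
    integral_pow_three_mul_exp (div_pos hA hs)]
  congr 1
  field_simp

theorem integrableOn_besselTripleKernel (ha : 0 < a) {w s : ℝ} (hw : 0 < w) (hs : 0 < s) :
    IntegrableOn (besselTripleKernel a b m (w, s)) (Ioi 0) :=
  (((integrableOn_pow_three_mul_exp (div_pos (besselTripleCoeff_pos (b := b) ha hw) hs)).mul_const
    _).ofReal).const_mul _

theorem cpow_mul_besselTripleCoeff (ha : 0 < a) (hb : 0 < b) {w : ℝ} (hw : 0 < w) :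
    (w : ℂ) ^ (m - 1) * ((1 / (2 * besselTripleCoeff a b w ^ 2) * (1 / (1 + w) ^ 2) : ℝ) : ℂ) =
      8 / (a : ℂ) ^ 4 * ((w : ℂ) ^ (m + 1) /
        ((1 + (w : ℂ)) ^ 2 * ((w : ℂ) + ((b ^ 2 / a ^ 2 : ℝ) : ℂ)) ^ 2)) := by
  have hwc : (w : ℂ) ≠ 0 := ofReal_ne_zero.2 hw.ne'
  have e : (w : ℂ) ^ (m + 1) = (w : ℂ) ^ (m - 1) * (w : ℂ) ^ 2 := by
    rw [show m + 1 = m - 1 + (2 : ℕ) by push_cast; ring, cpow_add _ _ hwc, cpow_natCast]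
  have e2 : 1 / (2 * besselTripleCoeff a b w ^ 2) * (1 / (1 + w) ^ 2) =
      8 / a ^ 4 * (w ^ 2 / ((1 + w) ^ 2 * (w + b ^ 2 / a ^ 2) ^ 2)) := by
    unfold besselTripleCoeff
    have e3 : (a ^ 2 + b ^ 2 / w) / 4 = (a ^ 2 * w + b ^ 2) / (4 * w) := by field_simp
    have e4 : w + b ^ 2 / a ^ 2 = (a ^ 2 * w + b ^ 2) / a ^ 2 := by field_simp
    rw [e3, e4]
    field_simp
    norm_num
  rw [e, e2]
  push_cast
  ring

/-- The norm of the kernel is the kernel at the exponent `Re m`, so integrating it in the order `x`,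
`s`, `w` ends in the norm of the integrand of `V`, integrable on the strip. -/
theorem integrable_besselTripleKernel (ha : 0 < a) (hb : 0 < b) (hm : m ∈ strip) :
    Integrable (Function.uncurry (besselTripleKernel a b m))
      (((volume.restrict (Ioi (0 : ℝ))).prod (volume.restrict (Ioi (0 : ℝ)))).prod
        (volume.restrict (Ioi (0 : ℝ)))) := by
  have hae : ∀ᵐ p ∂((volume.restrict (Ioi (0 : ℝ))).prod (volume.restrict (Ioi (0 : ℝ)))),
      p ∈ Ioi (0 : ℝ) ×ˢ Ioi (0 : ℝ) := by
    rw [Measure.prod_restrict]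
    exact ae_restrict_mem (measurableSet_Ioi.prod measurableSet_Ioi)
  rw [integrable_prod_iff measurable_besselTripleKernel.aestronglyMeasurable]
  constructor
  · filter_upwards [hae] with p hp
    exact integrableOn_besselTripleKernel ha hp.1 hp.2
  · let g : ℝ × ℝ → ℝ := fun p => p.1 ^ (m.re - 1) *
      (1 / (2 * besselTripleCoeff a b p.1 ^ 2) * (p.2 * Real.exp (-(p.2 * (1 + p.1)))))
    have hg : Measurable g := by
      simp only [g, besselTripleCoeff]
      fun_prop
    have hgi : Integrable g ((volume.restrict (Ioi (0 : ℝ))).prod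
        (volume.restrict (Ioi (0 : ℝ)))) := by
      rw [integrable_prod_iff hg.aestronglyMeasurable]
      constructor
      · filter_upwards [ae_restrict_mem measurableSet_Ioi] with w hw
        have hw0 : 0 < w := hw
        exact ((integrableOn_mul_exp_neg (show 0 < 1 + w by positivity)).const_mul
          (1 / (2 * besselTripleCoeff a b w ^ 2))).const_mul (w ^ (m.re - 1))
      · have hI := ((integrableOn_rational_kernel (c := b ^ 2 / a ^ 2) (by positivity)
          hm.1 hm.2).const_mul (8 / (a : ℂ) ^ 4)).norm
        refine hI.congr ?_
        filter_upwards [ae_restrict_mem measurableSet_Ioi] with w hw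
        have hw0 : 0 < w := hw
        rw [← cpow_mul_besselTripleCoeff ha hb hw, norm_mul, norm_cpow_eq_rpow_re_of_pos hw,
          norm_real, Real.norm_of_nonneg (by positivity), sub_re, one_re]
        have : ∀ s ∈ Ioi (0 : ℝ), ‖g (w, s)‖ = w ^ (m.re - 1) *
            (1 / (2 * besselTripleCoeff a b w ^ 2) * (s * Real.exp (-(s * (1 + w))))) := by
          intro s hs
          have hs0 : 0 < s := hs
          exact Real.norm_of_nonneg (by positivity)
        rw [setIntegral_congr_fun measurableSet_Ioi this, integral_const_mul, integral_const_mul,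
          integral_mul_exp_neg (by positivity)]
    refine hgi.congr ?_
    filter_upwards [hae] with p hp
    exact (integral_norm_besselTripleKernel ha hp.1 hp.2).symm

/-- The variables of the two `G` integrals are `s` and `sw`. The rescaling by `s` makes the exponent
proportional to `1 + w` and `x²/s`, hence explicitly integrable in `x` and then in `s`. -/
theorem integral_integral_besselTripleKernel {s x : ℝ} (hs : 0 < s) :
    ∫ w in Ioi (0 : ℝ), besselTripleKernel a b m (w, s) x =
      (x : ℂ) ^ 3 * besselG (-m) (b * x / 2) *
        (((Real.exp (-s - (a * x / 2) ^ 2 / s) : ℝ) : ℂ) * (s : ℂ) ^ (-m - 1)) := by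
  have hsc : (s : ℂ) ≠ 0 := ofReal_ne_zero.2 hs.ne'
  have hG : besselG (-m) (b * x / 2) = s * ∫ w in Ioi (0 : ℝ),
      ((Real.exp (-(s * w) - (b * x / 2) ^ 2 / (s * w)) : ℝ) : ℂ) *
        ((s * w : ℝ) : ℂ) ^ (- -m - 1) := by
    rw [besselG, ← mul_zero s, ← integral_comp_mul_left_Ioi' _ _ hs, mul_zero, real_smul]
  rw [hG, ← integral_const_mul, ← integral_const_mul, ← integral_mul_const]
  refine setIntegral_congr_fun measurableSet_Ioi fun w hw => ?_
  have hw0 : 0 < w := hw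
  have e1 : Real.exp (-(besselTripleCoeff a b w / s) * x ^ 2) * Real.exp (-(s * (1 + w))) =
      Real.exp (-(s * w) - (b * x / 2) ^ 2 / (s * w)) * Real.exp (-s - (a * x / 2) ^ 2 / s) := by
    rw [← Real.exp_add, ← Real.exp_add]
    congr 1
    unfold besselTripleCoeff
    field_simp
    ring
  have e2 : ((s * w : ℝ) : ℂ) ^ (- -m - 1) = (s : ℂ) ^ (m - 1) * (w : ℂ) ^ (m - 1) := by
    rw [neg_neg, ofReal_mul, mul_cpow_ofReal_nonneg hs.le hw0.le]
  have e3 : (s : ℂ) ^ (m - 1) * (s : ℂ) ^ (-m - 1) = ((s : ℂ) ^ 2)⁻¹ := by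
    rw [← cpow_add _ _ hsc, show m - 1 + (-m - 1) = -((2 : ℕ) : ℂ) by push_cast; ring, cpow_neg,
      cpow_natCast]
  have e1' := congrArg ((↑) : ℝ → ℂ) e1
  rw [ofReal_mul, ofReal_mul] at e1'
  simp only [besselTripleKernel]
  rw [e2]
  simp only [ofReal_mul, ofReal_pow, ofReal_inv]
  calc _ = (w : ℂ) ^ (m - 1) * (x : ℂ) ^ 3 * (s : ℂ)⁻¹ *
        (((Real.exp (-(besselTripleCoeff a b w / s) * x ^ 2) : ℝ) : ℂ) *
          ((Real.exp (-(s * (1 + w))) : ℝ) : ℂ)) := by ring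
    _ = (w : ℂ) ^ (m - 1) * (x : ℂ) ^ 3 * (s * ((s : ℂ) ^ 2)⁻¹) *
        (((Real.exp (-(s * w) - (b * x / 2) ^ 2 / (s * w)) : ℝ) : ℂ) *
          ((Real.exp (-s - (a * x / 2) ^ 2 / s) : ℝ) : ℂ)) := by
        rw [e1']; congr 2; field_simp
    _ = _ := by rw [← e3]; ring

theorem integral_pow_three_mul_besselG_mul_besselG (ha : 0 < a) (hb : 0 < b) (hm : m ∈ strip) :
    ∫ x in Ioi (0 : ℝ), (x : ℂ) ^ 3 * (besselG m (a * x / 2) * besselG (-m) (b * x / 2)) =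
      8 / (a : ℂ) ^ 4 * rationalIntegral (b ^ 2 / a ^ 2) m := by
  have hint := integrable_besselTripleKernel ha hb hm
  have hswap := integral_integral_swap hint
  have h1 : ∫ x in Ioi (0 : ℝ), ∫ p, besselTripleKernel a b m p x
      ∂((volume.restrict (Ioi (0 : ℝ))).prod (volume.restrict (Ioi (0 : ℝ)))) =
      ∫ x in Ioi (0 : ℝ), (x : ℂ) ^ 3 * (besselG m (a * x / 2) * besselG (-m) (b * x / 2)) := by
    refine integral_congr_ae ?_
    filter_upwards [hint.prod_left_ae] with x hx
    refine (integral_prod_symm _ hx).trans ?_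
    simp only [Function.uncurry_apply_pair]
    rw [setIntegral_congr_fun measurableSet_Ioi fun s hs =>
        integral_integral_besselTripleKernel (a := a) (b := b) (m := m) (x := x) hs,
      integral_const_mul, besselG]
    simp only [besselG]
    ring
  have h2 : ∫ p, (∫ x in Ioi (0 : ℝ), besselTripleKernel a b m p x)
      ∂((volume.restrict (Ioi (0 : ℝ))).prod (volume.restrict (Ioi (0 : ℝ)))) =
      8 / (a : ℂ) ^ 4 * rationalIntegral (b ^ 2 / a ^ 2) m := by
    have := integral_prod (fun p => ∫ x in Ioi (0 : ℝ), besselTripleKernel a b m p x)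
      hint.integral_prod_left
    refine this.trans ?_
    rw [rationalIntegral, ← integral_const_mul]
    refine setIntegral_congr_fun measurableSet_Ioi fun w hw => ?_
    have hw0 : 0 < w := hw
    rw [setIntegral_congr_fun measurableSet_Ioi fun s hs =>
        integral_besselTripleKernel (b := b) (m := m) ha hw hs, integral_const_mul,
      integral_complex_ofReal, integral_const_mul, integral_mul_exp_neg (by positivity)]
    exact cpow_mul_besselTripleCoeff ha hb hw
  rw [← h1, ← hswap, h2]

end

/-! ### The integral of x² F(ax) F(bx): convergence and analytic continuation -/

/-- The integrand `x² F_m(ax) F_m(bx)`. -/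
noncomputable def besselProd (m a b : ℂ) (x : ℝ) : ℂ :=
  (x : ℂ) ^ 2 * besselF m (a * x) * besselF m (b * x)

theorem mul_ofReal_mem_slitPlane {a : ℂ} (ha : a ∈ slitPlane) {x : ℝ} (hx : 0 < x) :
    a * x ∈ slitPlane := by
  rw [mem_slitPlane_iff] at ha ⊢
  rw [re_mul_ofReal, im_mul_ofReal]
  exact ha.imp (fun h => mul_pos h hx) fun h => mul_ne_zero h hx.ne'

theorem besselFConst_mul_ofReal_le (p : ℝ) {a : ℂ} (ha : a ∈ slitPlane) {x : ℝ} (hx : 0 < x) :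
    besselFConst p (a * x) ≤ besselFConst p a * (1 + 1 / x) ^ max p 0 := by
  have hκ := (cosHalfArg_pos ha).le
  rw [besselFConst, besselFConst, cosHalfArg_mul_ofReal a hx, norm_mul, norm_real,
    Real.norm_of_nonneg hx.le, mul_assoc, ← Real.mul_rpow (by positivity) (by positivity)]
  refine mul_le_mul_of_nonneg_left (Real.rpow_le_rpow (by positivity) ?_ (le_max_right _ _))
    (by positivity)
  have h1 : (1 + 1 / (2 * ‖a‖)) * (1 + 1 / x) =
      1 + 1 / (2 * (‖a‖ * x)) + (1 / x + 1 / (2 * ‖a‖)) := by field_simp; ring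
  have : 0 ≤ 1 / x + 1 / (2 * ‖a‖) := by positivity
  linarith

/-- A dominating function for `besselProd`. -/
noncomputable def besselProdBound (p σ x : ℝ) : ℝ :=
  x ^ 2 * ((1 + 1 / x) ^ max p 0 * (1 + 1 / x) ^ max p 0) * Real.exp (-(σ * x))

theorem exists_norm_besselProd_le {m : ℂ} (hm : -(1 / 2) < m.re) : ∃ C : ℝ, 0 ≤ C ∧
    ∀ a ∈ slitPlane, ∀ b ∈ slitPlane, ∀ x : ℝ, 0 < x → ‖besselProd m a b x‖ ≤
      C * (besselFConst (m.re - 1 / 2) a * besselFConst (m.re - 1 / 2) b) *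
        besselProdBound (m.re - 1 / 2) (a + b).re x := by
  obtain ⟨C, hC, hb⟩ := norm_besselF_le hm
  set p := m.re - 1 / 2
  have key : ∀ a ∈ slitPlane, ∀ x : ℝ, 0 < x → ‖besselF m (a * x)‖ ≤
      C * (besselFConst p a * (1 + 1 / x) ^ max p 0) * Real.exp (-(a.re * x)) := by
    intro a ha x hx
    refine (hb _ (mul_ofReal_mem_slitPlane ha hx)).trans ?_
    rw [re_mul_ofReal]
    gcongr
    exact besselFConst_mul_ofReal_le p ha hx
  refine ⟨C * C, mul_nonneg hC hC, fun a ha b hb x hx => ?_⟩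
  rw [besselProd, norm_mul, norm_mul, norm_pow, norm_real, Real.norm_of_nonneg hx.le]
  have ka := besselFConst_nonneg p a
  calc _ ≤ x ^ 2 * (C * (besselFConst p a * (1 + 1 / x) ^ max p 0) * Real.exp (-(a.re * x))) *
        (C * (besselFConst p b * (1 + 1 / x) ^ max p 0) * Real.exp (-(b.re * x))) := by
        gcongr
        · exact key a ha x hx
        · exact key b hb x hx
    _ = _ := by
        rw [besselProdBound, add_re, add_mul, neg_add, Real.exp_add]
        ring

/-- Near `0` the bound behaves like `x^(2-2q)` with `q = max p 0`, integrable since `q < 3/2`. For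
`p = Re m - 1/2` this is the restriction `Re m < 2`. -/
theorem integrableOn_besselProdBound {p σ : ℝ} (hp : p < 3 / 2) (hσ : 0 < σ) :
    IntegrableOn (besselProdBound p σ) (Ioi 0) := by
  set q := max p 0 with hq
  have hq0 : 0 ≤ q := le_max_right _ _
  have hq1 : q < 3 / 2 := max_lt hp (by norm_num)
  have hI := ((integrableOn_rpow_mul_exp_neg_mul (p := 2 - (q + q) + 1) (by linarith) hσ).add
    (integrableOn_rpow_mul_exp_neg_mul (p := 3) (by norm_num) hσ)).const_mul (2 ^ (q + q))
  refine Integrable.mono' hI (Measurable.aestronglyMeasurable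
    (by unfold besselProdBound; fun_prop)) ?_
  filter_upwards [ae_restrict_mem measurableSet_Ioi] with x hx
  have hx0 : 0 < x := hx
  rw [besselProdBound, Real.norm_of_nonneg (by positivity)]
  rw [← hq, ← Real.rpow_add (by positivity), show 1 + 1 / x = (1 + x) / x by field_simp; ring,
    Real.div_rpow (by positivity) hx0.le]
  have h1 := one_add_rpow_le hx0 (add_nonneg hq0 hq0)
  have h2 : x ^ (2 - (q + q)) = x ^ 2 / x ^ (q + q) := by
    rw [Real.rpow_sub hx0, Real.rpow_two]
  calc x ^ 2 * ((1 + x) ^ (q + q) / x ^ (q + q)) * Real.exp (-(σ * x))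
      ≤ x ^ 2 * (2 ^ (q + q) * (1 + x ^ (q + q)) / x ^ (q + q)) * Real.exp (-(σ * x)) := by gcongr
    _ = _ := by
      simp only [Pi.add_apply, add_sub_cancel_right]
      rw [h2, show (3 : ℝ) - 1 = 2 by norm_num, Real.rpow_two]
      field_simp

theorem aestronglyMeasurable_besselProd {m : ℂ} (hm : -(1 / 2) < m.re) {a b : ℂ}
    (ha : a ∈ slitPlane) (hb : b ∈ slitPlane) :
    AEStronglyMeasurable (besselProd m a b) (volume.restrict (Ioi 0)) := by
  have h : ∀ a ∈ slitPlane, ContinuousOn (fun x : ℝ => besselF m (a * x)) (Ioi 0) := fun a ha =>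
    (differentiableOn_besselF hm).continuousOn.comp (by fun_prop)
      fun x hx => mul_ofReal_mem_slitPlane ha hx
  exact (((by fun_prop : Continuous fun x : ℝ => (x : ℂ) ^ 2).continuousOn.mul (h a ha)).mul
    (h b hb)).aestronglyMeasurable measurableSet_Ioi

theorem integrableOn_besselProd {m : ℂ} (hm : -(1 / 2) < m.re) (hm2 : m.re < 2) {a b : ℂ}
    (ha : a ∈ slitPlane) (hb : b ∈ slitPlane) (hab : 0 < (a + b).re) :
    IntegrableOn (besselProd m a b) (Ioi 0) := by
  obtain ⟨C, hC, h⟩ := exists_norm_besselProd_le hm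
  refine ((integrableOn_besselProdBound (p := m.re - 1 / 2) (by linarith) hab).const_mul
    (C * (besselFConst (m.re - 1 / 2) a * besselFConst (m.re - 1 / 2) b))).mono'
    (aestronglyMeasurable_besselProd hm ha hb) ?_
  filter_upwards [ae_restrict_mem measurableSet_Ioi] with x hx
  exact h a ha b hb x hx

theorem besselProdBound_anti (p : ℝ) {σ τ x : ℝ} (hx : 0 < x) (h : σ ≤ τ) :
    besselProdBound p τ x ≤ besselProdBound p σ x := by
  unfold besselProdBound
  gcongr

theorem differentiableOn_integral_besselProd {m : ℂ} (hm : -(1 / 2) < m.re) (hm2 : m.re < 2)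
    {U : Set ℂ} (hU : IsOpen U) {α β : ℂ → ℂ} (hα : DifferentiableOn ℂ α U)
    (hβ : DifferentiableOn ℂ β U) (hαs : ∀ ζ ∈ U, α ζ ∈ slitPlane)
    (hβs : ∀ ζ ∈ U, β ζ ∈ slitPlane) (hre : ∀ ζ ∈ U, 0 < (α ζ + β ζ).re) :
    DifferentiableOn ℂ (fun ζ => ∫ x in Ioi (0 : ℝ), besselProd m (α ζ) (β ζ) x) U := by
  obtain ⟨C, hC, hbd⟩ := exists_norm_besselProd_le hm
  refine differentiableOn_integral_of_locally_dominated hU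
    (fun ζ hζ => aestronglyMeasurable_besselProd hm (hαs ζ hζ) (hβs ζ hζ)) ?_ ?_
  · filter_upwards [ae_restrict_mem measurableSet_Ioi] with x hx
    have hF : ∀ γ : ℂ → ℂ, DifferentiableOn ℂ γ U → (∀ ζ ∈ U, γ ζ ∈ slitPlane) →
        DifferentiableOn ℂ (fun ζ => besselF m (γ ζ * x)) U := fun γ hγ hγs =>
      (differentiableOn_besselF hm).comp (hγ.mul_const _)
        fun ζ hζ => mul_ofReal_mem_slitPlane (hγs ζ hζ) hx
    exact ((hF α hα hαs).const_mul _).mul (hF β hβ hβs)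
  · intro ζ₀ hζ₀
    set p := m.re - 1 / 2 with hp
    have hfa : ContinuousAt (fun ζ => besselFConst p (α ζ)) ζ₀ :=
      ContinuousAt.comp (f := α) ((continuousOn_besselFConst p).continuousAt
        (isOpen_slitPlane.mem_nhds (hαs _ hζ₀))) (hα.continuousOn.continuousAt (hU.mem_nhds hζ₀))
    have hfb : ContinuousAt (fun ζ => besselFConst p (β ζ)) ζ₀ :=
      ContinuousAt.comp (f := β) ((continuousOn_besselFConst p).continuousAt
        (isOpen_slitPlane.mem_nhds (hβs _ hζ₀))) (hβ.continuousOn.continuousAt (hU.mem_nhds hζ₀))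
    have hs : ContinuousAt (fun ζ => (α ζ + β ζ).re) ζ₀ :=
      continuous_re.continuousAt.comp
        ((hα.add hβ).continuousOn.continuousAt (hU.mem_nhds hζ₀))
    obtain ⟨σ, hσ0, hσ⟩ := exists_between (hre ζ₀ hζ₀)
    have hev := (hfa.eventually_lt_const (lt_add_one _)).and
      ((hfb.eventually_lt_const (lt_add_one _)).and
        ((hs.eventually_const_lt hσ).and (hU.mem_nhds hζ₀)))
    refine ⟨_, hev, _, (integrableOn_besselProdBound (p := p) (by rw [hp]; linarith)
      hσ0).const_mul (C * ((besselFConst p (α ζ₀) + 1) * (besselFConst p (β ζ₀) + 1))), ?_⟩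
    filter_upwards [ae_restrict_mem measurableSet_Ioi] with x hx ζ hζ
    obtain ⟨h1, h2, h3, h4⟩ := hζ
    have hx0 : 0 < x := hx
    have k2 := besselFConst_nonneg p (β ζ)
    have k3 := besselFConst_nonneg p (α ζ₀)
    have k4 := besselFConst_nonneg p (β ζ₀)
    refine (hbd _ (hαs ζ h4) _ (hβs ζ h4) x hx0).trans ?_
    have h5 := besselProdBound_anti p hx0 h3.le
    have h6 : 0 ≤ besselProdBound p (α ζ + β ζ).re x := by unfold besselProdBound; positivity
    gcongr

theorem integral_besselProd_ofReal {m : ℂ} (hm : -(1 / 2) < m.re) (hm2 : m.re < 2) {a b : ℝ}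
    (ha : 0 < a) (hb : 0 < b) :
    ∫ x in Ioi (0 : ℝ), besselProd m a b x =
      4 / Real.pi * ((a : ℂ) ^ (1 / 2 + m) * (b : ℂ) ^ (1 / 2 - m)) / (a : ℂ) ^ 4 *
        rationalIntegral (b ^ 2 / a ^ 2) m := by
  have hp : ((Real.sqrt Real.pi : ℝ) : ℂ) * ((Real.sqrt Real.pi : ℝ) : ℂ) = (Real.pi : ℂ) := by
    rw [← ofReal_mul, Real.mul_self_sqrt Real.pi_pos.le]
  have h := integral_pow_three_mul_besselG_mul_besselG ha hb (m := m) ⟨by linarith, hm2⟩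
  have hx : ∀ x ∈ Ioi (0 : ℝ), besselProd m a b x =
      (a : ℂ) ^ (1 / 2 + m) * (b : ℂ) ^ (1 / 2 - m) / (2 * Real.pi) *
        ((x : ℂ) ^ 3 * (besselG m (a * x / 2) * besselG (-m) (b * x / 2))) := by
    intro x hx
    have hx0 : 0 < x := hx
    have hx2 : 0 < x / 2 := by positivity
    have hxc : ((x / 2 : ℝ) : ℂ) ≠ 0 := ofReal_ne_zero.2 hx2.ne'
    have e : ∀ c : ℝ, (c : ℂ) * x = ((2 * (c * x / 2) : ℝ) : ℂ) := fun c => by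
      push_cast; ring
    have hax : 0 < a * x / 2 := by positivity
    have hbx : 0 < b * x / 2 := by positivity
    have hbc : ((b * x / 2 : ℝ) : ℂ) ≠ 0 := ofReal_ne_zero.2 hbx.ne'
    -- Evenness of `r^m G_m(r)` flips the index of the second factor only; the powers of `x/2` then
    -- combine to the exponent 1.
    have e1 : ((b * x / 2 : ℝ) : ℂ) ^ (m + 1 / 2) * besselG m (b * x / 2) =
        ((b * x / 2 : ℝ) : ℂ) ^ (1 / 2 - m) * besselG (-m) (b * x / 2) := by
      rw [add_comm m, cpow_add _ _ hbc, mul_assoc, ← cpow_mul_besselG_neg hbx, ← mul_assoc,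
        ← cpow_add _ _ hbc, ← sub_eq_add_neg]
    have e2 : ((a * x / 2 : ℝ) : ℂ) ^ (m + 1 / 2) =
        (a : ℂ) ^ (1 / 2 + m) * ((x / 2 : ℝ) : ℂ) ^ (m + 1 / 2) := by
      rw [mul_div_assoc, ofReal_mul, mul_cpow_ofReal_nonneg ha.le hx2.le, add_comm m]
    have e3 : ((b * x / 2 : ℝ) : ℂ) ^ (1 / 2 - m) =
        (b : ℂ) ^ (1 / 2 - m) * ((x / 2 : ℝ) : ℂ) ^ (1 / 2 - m) := by
      rw [mul_div_assoc, ofReal_mul, mul_cpow_ofReal_nonneg hb.le hx2.le]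
    have e4 : ((x / 2 : ℝ) : ℂ) ^ (m + 1 / 2) * ((x / 2 : ℝ) : ℂ) ^ (1 / 2 - m) = x / 2 := by
      rw [← cpow_add _ _ hxc, show m + 1 / 2 + (1 / 2 - m) = 1 by ring, cpow_one]
      push_cast; rfl
    rw [besselProd, e a, e b, besselF_ofReal hax hm, besselF_ofReal hbx hm,
      mul_assoc _ _ (besselG m (b * x / 2)), e1, e2, e3, ← hp]
    generalize ((Real.sqrt Real.pi : ℝ) : ℂ) = S
    generalize (a : ℂ) ^ (1 / 2 + m) = A
    generalize (b : ℂ) ^ (1 / 2 - m) = B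
    calc _ = (x : ℂ) ^ 2 * S⁻¹ * S⁻¹ * A * B *
          (((x / 2 : ℝ) : ℂ) ^ (m + 1 / 2) * ((x / 2 : ℝ) : ℂ) ^ (1 / 2 - m)) *
          (besselG m (a * x / 2) * besselG (-m) (b * x / 2)) := by ring
      _ = _ := by rw [e4, div_eq_mul_inv (A * B), mul_inv, mul_inv]; ring
  rw [setIntegral_congr_fun measurableSet_Ioi hx, integral_const_mul, h]
  generalize (a : ℂ) ^ (1 / 2 + m) = A
  generalize (b : ℂ) ^ (1 / 2 - m) = B
  field_simp
  ring

theorem ofReal_div_cpow_sq {a b : ℝ} (ha : 0 < a) (hb : 0 < b) (m : ℂ) :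
    ((b ^ 2 / a ^ 2 : ℝ) : ℂ) ^ m = ((b : ℂ) ^ m) ^ 2 / ((a : ℂ) ^ m) ^ 2 := by
  have hac : (a : ℂ) ≠ 0 := ofReal_ne_zero.2 ha.ne'
  have hbc : (b : ℂ) ≠ 0 := ofReal_ne_zero.2 hb.ne'
  rw [cpow_def_of_ne_zero (ofReal_ne_zero.2 (by positivity)), cpow_def_of_ne_zero hac,
    cpow_def_of_ne_zero hbc, ← Complex.exp_nat_mul, ← Complex.exp_nat_mul, ← Complex.exp_sub,
    ← ofReal_log (by positivity), ← ofReal_log ha.le, ← ofReal_log hb.le,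
    Real.log_div (by positivity) (by positivity), Real.log_pow, Real.log_pow]
  push_cast
  ring_nf

theorem integral_besselProd_ofReal_eq {m : ℂ} (hm : -(1 / 2) < m.re) (hm2 : m.re < 2) {a b : ℝ}
    (ha : 0 < a) (hb : 0 < b) :
    Complex.sin (Real.pi * m) * ((b : ℂ) ^ 2 - (a : ℂ) ^ 2) ^ 3 *
      ∫ x in Ioi (0 : ℝ), besselProd m a b x =
      4 * (a : ℂ) ^ (1 / 2 - m) * (b : ℂ) ^ (1 / 2 - m) *
        ((m - 1) * ((a : ℂ) ^ (2 * m + 2) - (b : ℂ) ^ (2 * m + 2)) +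
          (m + 1) * (a : ℂ) ^ 2 * (b : ℂ) ^ 2 *
            ((b : ℂ) ^ (2 * m - 2) - (a : ℂ) ^ (2 * m - 2))) := by
  have hac : (a : ℂ) ≠ 0 := ofReal_ne_zero.2 ha.ne'
  have hbc : (b : ℂ) ≠ 0 := ofReal_ne_zero.2 hb.ne'
  have hc : 0 < b ^ 2 / a ^ 2 := by positivity
  have hcc : ((b ^ 2 / a ^ 2 : ℝ) : ℂ) ≠ 0 := ofReal_ne_zero.2 hc.ne'
  have h := rationalIntegral_eq hc (m := m) ⟨by linarith, hm2⟩
  rw [cpow_add _ _ hcc, cpow_one, ofReal_div_cpow_sq ha hb] at h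
  have p1 : ∀ c : ℂ, c ≠ 0 → c ^ (2 * m + 2) = (c ^ m) ^ 2 * c ^ 2 := fun c hc => by
    rw [cpow_add _ _ hc, show (2 : ℂ) = ((2 : ℕ) : ℂ) by norm_num, cpow_nat_mul, cpow_natCast]
  have p2 : ∀ c : ℂ, c ≠ 0 → c ^ (2 * m - 2) = (c ^ m) ^ 2 / c ^ 2 := fun c hc => by
    rw [cpow_sub _ _ hc, show (2 : ℂ) = ((2 : ℕ) : ℂ) by norm_num, cpow_nat_mul, cpow_natCast]
  rw [integral_besselProd_ofReal hm hm2 ha hb, p1 _ hac, p1 _ hbc, p2 _ hac, p2 _ hbc,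
    cpow_add _ _ hac, cpow_sub _ _ hac, cpow_sub _ _ hbc]
  have hA : (a : ℂ) ^ m ≠ 0 := by simp [cpow_eq_zero_iff, hac]
  generalize (a : ℂ) ^ m = A at *
  generalize (b : ℂ) ^ m = B at *
  generalize (a : ℂ) ^ (1 / 2 : ℂ) = A'
  generalize (b : ℂ) ^ (1 / 2 : ℂ) = B'
  have e : ((b : ℂ) ^ 2 - (a : ℂ) ^ 2) ^ 3 = (a : ℂ) ^ 6 *
      (((b ^ 2 / a ^ 2 : ℝ) : ℂ) - 1) ^ 3 := by
    push_cast; field_simp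
  rw [e]
  calc _ = 4 / Real.pi * (A' * A * (B' / B)) * (a : ℂ) ^ 2 * (Complex.sin (Real.pi * m) *
        (((b ^ 2 / a ^ 2 : ℝ) : ℂ) - 1) ^ 3 * rationalIntegral (b ^ 2 / a ^ 2) m) := by
        field_simp
    _ = _ := by
      rw [h]
      push_cast
      field_simp
      ring

theorem integral_besselProd_zero_ofReal_eq {a b : ℝ} (ha : 0 < a) (hb : 0 < b) :
    (Real.pi : ℂ) * ((b : ℂ) ^ 2 - (a : ℂ) ^ 2) ^ 3 *
      ∫ x in Ioi (0 : ℝ), besselProd 0 a b x =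
      8 * (a : ℂ) ^ (1 / 2 : ℂ) * (b : ℂ) ^ (1 / 2 : ℂ) *
        (((a : ℂ) ^ 2 + (b : ℂ) ^ 2) * (Complex.log b - Complex.log a) -
          ((b : ℂ) ^ 2 - (a : ℂ) ^ 2)) := by
  have hac : (a : ℂ) ≠ 0 := ofReal_ne_zero.2 ha.ne'
  have hc : 0 < b ^ 2 / a ^ 2 := by positivity
  have h := rationalIntegral_zero hc
  have hlog : Complex.log ((b ^ 2 / a ^ 2 : ℝ) : ℂ) = 2 * (Complex.log b - Complex.log a) := by
    rw [← ofReal_log hc.le, ← ofReal_log ha.le, ← ofReal_log hb.le,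
      Real.log_div (by positivity) (by positivity), Real.log_pow, Real.log_pow]
    push_cast
    ring
  rw [hlog] at h
  have e : ((b : ℂ) ^ 2 - (a : ℂ) ^ 2) ^ 3 = (a : ℂ) ^ 6 *
      (((b ^ 2 / a ^ 2 : ℝ) : ℂ) - 1) ^ 3 := by
    push_cast; field_simp
  rw [integral_besselProd_ofReal (by simp) (by simp) ha hb, add_zero, sub_zero, e]
  generalize (a : ℂ) ^ (1 / 2 : ℂ) = A'
  generalize (b : ℂ) ^ (1 / 2 : ℂ) = B'
  calc _ = 4 * (A' * B') * (a : ℂ) ^ 2 * (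
        (((b ^ 2 / a ^ 2 : ℝ) : ℂ) - 1) ^ 3 * rationalIntegral (b ^ 2 / a ^ 2) 0) := by
        field_simp
    _ = _ := by
      rw [h]
      push_cast
      field_simp
      ring

/-- The slit plane is star-shaped about any positive real and the half-plane is convex; `1 + |c|` is
a positive point of both. -/
theorem isPreconnected_slitPlane_inter_re_gt (c : ℝ) :
    IsPreconnected {a : ℂ | a ∈ slitPlane ∧ 0 < (a + c).re} := by
  have hX : (0 : ℝ) < 1 + |c| := by positivity
  have hmem : 0 < (((1 + |c| : ℝ) : ℂ) + c).re := by
    rw [add_re, ofReal_re, ofReal_re]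
    linarith [neg_abs_le c]
  have hset : {a : ℂ | 0 < (a + c).re} = {a : ℂ | -c < a.re} := by
    ext a
    change 0 < (a + c).re ↔ -c < a.re
    rw [add_re, ofReal_re, neg_lt_iff_pos_add]
  have hconv : Convex ℝ {a : ℂ | 0 < (a + c).re} := hset ▸ convex_halfSpace_re_gt (-c)
  have hstar : StarConvex ℝ ((1 + |c| : ℝ) : ℂ) (slitPlane ∩ {a : ℂ | 0 < (a + c).re}) :=
    (starConvex_slitPlane (by exact_mod_cast hX)).inter (hconv.starConvex hmem)
  exact (hstar.isPathConnected ⟨Or.inl (by rwa [ofReal_re]), hmem⟩).isConnected.isPreconnected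

theorem isOpen_slitPlane_inter_re_gt (c : ℂ) :
    IsOpen {a : ℂ | a ∈ slitPlane ∧ 0 < (a + c).re} :=
  isOpen_slitPlane.inter (isOpen_lt continuous_const
    (continuous_re.comp (continuous_id.add continuous_const)))

/-- Continue first in `a` with `b > 0` fixed, then in `b` with complex `a` fixed. With the factor
`(b² - a²)³` multiplied out, the diagonal is no singularity. -/
theorem integral_besselProd_eq_of_eq_ofReal {m : ℂ} (hm : -(1 / 2) < m.re) (hm2 : m.re < 2)
    {Φ : ℂ → ℂ → ℂ} (h1 : ∀ b ∈ slitPlane, DifferentiableOn ℂ (fun a => Φ a b) slitPlane)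
    (h2 : ∀ a ∈ slitPlane, DifferentiableOn ℂ (Φ a) slitPlane) {k : ℂ}
    (h : ∀ a b : ℝ, 0 < a → 0 < b → k * ((b : ℂ) ^ 2 - (a : ℂ) ^ 2) ^ 3 *
      ∫ x in Ioi (0 : ℝ), besselProd m a b x = Φ a b) {a b : ℂ} (ha : a ∈ slitPlane)
    (hb : b ∈ slitPlane) (hab : 0 < (a + b).re) :
    k * (b ^ 2 - a ^ 2) ^ 3 * ∫ x in Ioi (0 : ℝ), besselProd m a b x = Φ a b := by
  have step : ∀ b : ℝ, 0 < b → ∀ a ∈ slitPlane, 0 < (a + b).re →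
      k * ((b : ℂ) ^ 2 - a ^ 2) ^ 3 * ∫ x in Ioi (0 : ℝ), besselProd m a b x = Φ a b := by
    intro b hb a ha hab
    have hbs : (b : ℂ) ∈ slitPlane := Or.inl (by simpa using hb)
    have hI := differentiableOn_integral_besselProd hm hm2
      (isOpen_slitPlane_inter_re_gt (b : ℂ)) differentiableOn_id
      (differentiableOn_const (b : ℂ)) (fun ζ hζ => hζ.1) (fun _ _ => hbs) (fun ζ hζ => hζ.2)
    refine eqOn_of_eq_on_real (isOpen_slitPlane_inter_re_gt (b : ℂ))
      (isPreconnected_slitPlane_inter_re_gt b)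
      (f := fun a => k * ((b : ℂ) ^ 2 - a ^ 2) ^ 3 * ∫ x in Ioi (0 : ℝ), besselProd m a b x)
      (g := fun a => Φ a b)
      (DifferentiableOn.mul (by fun_prop) hI) ((h1 _ hbs).mono fun ζ hζ => hζ.1) (x₀ := 1)
      ⟨one_mem_slitPlane, by simp; linarith⟩ (fun x hx _ => h x b (by linarith) hb) ⟨ha, hab⟩
  have hI := differentiableOn_integral_besselProd hm hm2
    (isOpen_slitPlane_inter_re_gt a) (differentiableOn_const a) differentiableOn_id
    (fun _ _ => ha) (fun ζ hζ => hζ.1) (fun ζ hζ => by rw [add_comm]; exact hζ.2)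
  have hpre : IsPreconnected {b : ℂ | b ∈ slitPlane ∧ 0 < (b + a).re} := by
    have := isPreconnected_slitPlane_inter_re_gt a.re
    simpa using this
  -- Starting at `1 + |Re a|` ensures that the real points `b` used satisfy `Re(a + b) > 0`.
  refine eqOn_of_eq_on_real (isOpen_slitPlane_inter_re_gt a) hpre
    (f := fun b => k * (b ^ 2 - a ^ 2) ^ 3 * ∫ x in Ioi (0 : ℝ), besselProd m a b x)
    (DifferentiableOn.mul (by fun_prop) hI) ((h2 a ha).mono fun ζ hζ => hζ.1)
    (x₀ := 1 + |a.re|) ⟨?_, ?_⟩ (fun x hx hx' => ?_) ⟨hb, by rwa [add_comm]⟩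
  · exact Or.inl (by rw [ofReal_re]; positivity)
  · rw [add_re, ofReal_re]; linarith [neg_abs_le a.re]
  · exact step x ((by positivity : 0 < 1 + |a.re|).trans hx) a ha (by rw [add_comm]; exact hx'.2)

/-- On the diagonal the two-variable identity is empty, so the single variable `a` is continued over
the right half-plane. -/
theorem integral_besselProd_self {m : ℂ} (hm : -(1 / 2) < m.re) (hm2 : m.re < 2) {a : ℂ}
    (ha : 0 < a.re) : (Real.pi : ℂ) * a ^ 3 * ∫ x in Ioi (0 : ℝ), besselProd m a a x =
      4 * rationalIntegral 1 m := by
  have hopen : IsOpen {a : ℂ | 0 < a.re} := isOpen_lt continuous_const continuous_re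
  have hI := differentiableOn_integral_besselProd hm hm2 hopen differentiableOn_id
    differentiableOn_id (fun ζ hζ => Or.inl hζ) (fun ζ hζ => Or.inl hζ)
    (fun ζ hζ => by
      have h : 0 < ζ.re := hζ
      simp only [id, add_re]; linarith)
  refine eqOn_of_eq_on_real hopen (convex_halfSpace_re_gt 0).isPreconnected
    (f := fun a => (Real.pi : ℂ) * a ^ 3 * ∫ x in Ioi (0 : ℝ), besselProd m a a x)
    (g := fun _ => 4 * rationalIntegral 1 m)
    (DifferentiableOn.mul (by fun_prop) hI) (differentiableOn_const _) (x₀ := 1) (by simp)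
    (fun x hx _ => ?_) ha
  have hx0 : 0 < x := zero_lt_one.trans hx
  have hxc : (x : ℂ) ≠ 0 := ofReal_ne_zero.2 hx0.ne'
  rw [integral_besselProd_ofReal hm hm2 hx0 hx0, ← cpow_add _ _ hxc,
    show (1 / 2 + m + (1 / 2 - m) : ℂ) = 1 by ring, cpow_one, div_self (by positivity)]
  field_simp

theorem differentiableOn_cpow_const (s : ℂ) : DifferentiableOn ℂ (fun a : ℂ => a ^ s) slitPlane :=
  fun _ ha => (DifferentiableAt.cpow differentiableAt_id (differentiableAt_const _)
    ha).differentiableWithinAt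

/-- The numerator of the value of `∫ x² K_m(ax) K_m(bx) dx`. -/
noncomputable def besselProdNumerator (m a b : ℂ) : ℂ :=
  4 * a ^ (1 / 2 - m) * b ^ (1 / 2 - m) *
    ((m - 1) * (a ^ (2 * m + 2) - b ^ (2 * m + 2)) +
      (m + 1) * a ^ 2 * b ^ 2 * (b ^ (2 * m - 2) - a ^ (2 * m - 2)))

/-- Oddness matches that of `sin(πm)`, so the final formula does not depend on which of `±m` was
used for `F`. -/
theorem besselProdNumerator_neg (m : ℂ) {a b : ℂ} (ha : a ≠ 0) (hb : b ≠ 0) :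
    besselProdNumerator (-m) a b = -besselProdNumerator m a b := by
  have p1 : ∀ c : ℂ, c ≠ 0 → ∀ μ : ℂ, c ^ (2 * μ + 2) = (c ^ μ) ^ 2 * c ^ 2 := fun c hc μ => by
    rw [cpow_add _ _ hc, show (2 : ℂ) = ((2 : ℕ) : ℂ) by norm_num, cpow_nat_mul, cpow_natCast]
  have p2 : ∀ c : ℂ, c ≠ 0 → ∀ μ : ℂ, c ^ (2 * μ - 2) = (c ^ μ) ^ 2 / c ^ 2 := fun c hc μ => by
    rw [cpow_sub _ _ hc, show (2 : ℂ) = ((2 : ℕ) : ℂ) by norm_num, cpow_nat_mul, cpow_natCast]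
  unfold besselProdNumerator
  rw [p1 a ha, p1 a ha, p1 b hb, p1 b hb, p2 a ha, p2 a ha, p2 b hb, p2 b hb, cpow_sub _ _ ha,
    cpow_sub _ _ ha, cpow_sub _ _ hb, cpow_sub _ _ hb, cpow_neg, cpow_neg]
  have hA : a ^ m ≠ 0 := by simp [cpow_eq_zero_iff, ha]
  have hB : b ^ m ≠ 0 := by simp [cpow_eq_zero_iff, hb]
  generalize a ^ m = A at *
  generalize b ^ m = B at *
  generalize a ^ (1 / 2 : ℂ) = A'
  generalize b ^ (1 / 2 : ℂ) = B'
  field_simp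
  ring

theorem sin_mul_integral_besselProd {m : ℂ} (hm : -(1 / 2) < m.re) (hm2 : m.re < 2) {a b : ℂ}
    (ha : a ∈ slitPlane) (hb : b ∈ slitPlane) (hab : 0 < (a + b).re) :
    Complex.sin (Real.pi * m) * (b ^ 2 - a ^ 2) ^ 3 *
      ∫ x in Ioi (0 : ℝ), besselProd m a b x = besselProdNumerator m a b := by
  have h1 := differentiableOn_cpow_const (1 / 2 - m)
  have h2 := differentiableOn_cpow_const (2 * m + 2)
  have h3 := differentiableOn_cpow_const (2 * m - 2)
  have h4 : DifferentiableOn ℂ (fun a : ℂ => a ^ 2) slitPlane := by fun_prop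
  refine integral_besselProd_eq_of_eq_ofReal hm hm2 (fun b _ => ?_) (fun a _ => ?_)
    (fun a b ha hb => integral_besselProd_ofReal_eq hm hm2 ha hb) ha hb hab
  · exact ((h1.const_mul _).mul_const _).mul (((h2.sub_const _).const_mul _).add
      (((h4.const_mul _).mul_const _).mul (h3.const_sub _)))
  · exact (h1.const_mul _).mul (((h2.const_sub _).const_mul _).add
      ((h4.const_mul _).mul (h3.sub_const _)))

theorem pi_mul_integral_besselProd_zero {a b : ℂ}
    (ha : a ∈ slitPlane) (hb : b ∈ slitPlane) (hab : 0 < (a + b).re) :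
    (Real.pi : ℂ) * (b ^ 2 - a ^ 2) ^ 3 * ∫ x in Ioi (0 : ℝ), besselProd 0 a b x =
      8 * a ^ (1 / 2 : ℂ) * b ^ (1 / 2 : ℂ) *
        ((a ^ 2 + b ^ 2) * (Complex.log b - Complex.log a) - (b ^ 2 - a ^ 2)) := by
  have h1 := differentiableOn_cpow_const (1 / 2)
  have h2 : DifferentiableOn ℂ Complex.log slitPlane := fun z hz =>
    (differentiableAt_log hz).differentiableWithinAt
  have h4 : DifferentiableOn ℂ (fun a : ℂ => a ^ 2) slitPlane := by fun_prop
  refine integral_besselProd_eq_of_eq_ofReal (by simp) (by simp)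
    (Φ := fun a b => 8 * a ^ (1 / 2 : ℂ) * b ^ (1 / 2 : ℂ) *
        ((a ^ 2 + b ^ 2) * (Complex.log b - Complex.log a) - (b ^ 2 - a ^ 2)))
    (fun b _ => ?_) (fun a _ => ?_)
    (fun a b ha hb => integral_besselProd_zero_ofReal_eq ha hb) ha hb hab
  · exact ((h1.const_mul _).mul_const _).mul
      (((h4.add_const _).mul (h2.const_sub _)).sub (h4.const_sub _))
  · exact (h1.const_mul _).mul
      (((h4.const_add _).mul (h2.sub_const _)).sub (h4.sub_const _))

/-! ### Transfer to K and to the zero energy solution -/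

theorem sin_pi_mul_ne_zero_of_ne_intCast {m : ℂ} (hm : ∀ n : ℤ, m ≠ n) : Complex.sin (Real.pi * m) ≠ 0 := by
  intro h
  obtain ⟨k, hk⟩ := Complex.sin_eq_zero_iff.1 h
  have hpi : (Real.pi : ℂ) ≠ 0 := ofReal_ne_zero.2 Real.pi_ne_zero
  exact hm k (mul_left_cancel₀ hpi (by rw [hk]; ring))

theorem ne_intCast_of_abs_re_lt_one {m : ℂ} (hm : |m.re| < 1) (h0 : m ≠ 0) (n : ℤ) : m ≠ n := by
  rintro rfl
  rw [intCast_re, ← Int.cast_abs] at hm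
  have h1 : |n| < 1 := by exact_mod_cast hm
  exact h0 (by rw [Int.abs_lt_one_iff.1 h1, Int.cast_zero])

theorem exists_index_macdonaldK1_eq_besselF_of_abs_re_lt_two {m : ℂ} (hm : |m.re| < 2) :
    ∃ μ : ℂ, (μ = m ∨ μ = -m) ∧ 0 ≤ μ.re ∧ μ.re < 2 ∧
      ∀ z ∈ slitPlane, macdonaldK1 m z = besselF μ z := by
  obtain ⟨μ, hμ, h0, h⟩ := exists_index_macdonaldK1_eq_besselF m
  refine ⟨μ, hμ, h0, ?_, h⟩
  rcases hμ with rfl | rfl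
  · exact (abs_lt.1 hm).2
  · rw [neg_re]; linarith [(abs_lt.1 hm).1]

theorem rationalIntegral_one_eq_of_eq_or_eq_neg {m μ : ℂ} (hμ : μ = m ∨ μ = -m)
    (hs : μ ∈ strip) (hm : ∀ n : ℤ, m ≠ n) :
    rationalIntegral 1 μ = m * (1 - m ^ 2) * Real.pi / (6 * Complex.sin (Real.pi * m)) := by
  rcases hμ with rfl | rfl
  · exact rationalIntegral_one_eq_of_ne_intCast hs hm
  · rw [rationalIntegral_one_eq_of_ne_intCast hs
      fun n h => hm (-n) (by push_cast; linear_combination -h), mul_neg, Complex.sin_neg, neg_sq,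
      mul_neg, div_neg]
    ring

theorem mul_ofReal_cpow {β : ℂ} (hβ : β ≠ 0) {x : ℝ} (hx : 0 < x) (c : ℂ) :
    (β * x) ^ c = β ^ c * (x : ℂ) ^ c := by
  have hxc : (x : ℂ) ≠ 0 := ofReal_ne_zero.2 hx.ne'
  rw [cpow_def_of_ne_zero (mul_ne_zero hβ hxc), cpow_def_of_ne_zero hβ, cpow_def_of_ne_zero hxc,
    mul_comm β, log_ofReal_mul hx hβ, ← Complex.exp_add, ← ofReal_log hx.le]
  ring_nf

theorem intUnits_mul_I_sq (ε : ℤˣ) : (((ε : ℤ) : ℂ) * I) ^ 2 = -1 := by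
  rcases Int.units_eq_one_or ε with rfl | rfl <;> simp

theorem hankelFactor_two_mul_sq (ε : ℤˣ) (m : ℂ) : hankelFactor ε (2 * m) ^ 2 =
    -(((ε : ℤ) : ℂ) * I) * Complex.exp (-(((ε : ℤ) : ℂ) * 2 * I * (Real.pi : ℂ) * m)) := by
  have h : Complex.exp (((ε : ℤ) : ℂ) * I * Real.pi / 2) = ((ε : ℤ) : ℂ) * I := by
    rcases Int.units_eq_one_or ε with rfl | rfl
    · rw [show (((1 : ℤˣ) : ℤ) : ℂ) * I * Real.pi / 2 = Real.pi / 2 * I by simp; ring,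
        Complex.exp_pi_div_two_mul_I]
      simp
    · rw [show (((-1 : ℤˣ) : ℤ) : ℂ) * I * Real.pi / 2 = -Real.pi / 2 * I by simp; ring,
        Complex.exp_neg_pi_div_two_mul_I]
      simp
  rw [hankelFactor, mul_pow, neg_sq, intUnits_mul_I_sq, ← Complex.exp_nat_mul,
    show ((2 : ℕ) : ℂ) * (((ε : ℤ) : ℂ) * I * Real.pi / 2 * (1 / 2 - 2 * m)) =
      ((ε : ℤ) : ℂ) * I * Real.pi / 2 + -(((ε : ℤ) : ℂ) * 2 * I * (Real.pi : ℂ) * m) by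
      push_cast; ring, Complex.exp_add, h]
  ring

theorem zeroEnergySolution_sq {ε : ℤˣ} {β m μ : ℂ} (hβ : 0 < ((ε : ℤ) : ℝ) * (β ^ (1 / 2 : ℂ)).im)
    (hμ : ∀ z ∈ slitPlane, macdonaldK1 (2 * m) z = besselF μ z) {x : ℝ} (hx : 0 < x) :
    zeroEnergySolution ε β m x ^ 2 = β ^ (1 / 2 : ℂ) * hankelFactor ε (2 * m) ^ 2 *
      ((√x : ℂ) * besselF μ (-2 * (((ε : ℤ) : ℂ) * I) * β ^ (1 / 2 : ℂ) * (√x : ℝ)) ^ 2) := by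
  have hβ0 : β ≠ 0 := by
    rintro rfl
    simp at hβ
  have hsx : 0 < √x := Real.sqrt_pos.2 hx
  have hx2 : (x : ℂ) ^ (1 / 2 : ℂ) = (√x : ℝ) := by
    rw [Real.sqrt_eq_rpow, ofReal_cpow hx.le]; norm_num
  have hre : 0 < (-2 * (((ε : ℤ) : ℂ) * I) * β ^ (1 / 2 : ℂ) * (√x : ℝ)).re := by
    rw [re_mul_ofReal]
    refine mul_pos ?_ hsx
    have : (-2 * (((ε : ℤ) : ℂ) * I) * β ^ (1 / 2 : ℂ)).re =
        2 * (((ε : ℤ) : ℝ) * (β ^ (1 / 2 : ℂ)).im) := by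
      generalize β ^ (1 / 2 : ℂ) = s
      simp [mul_re, mul_im]
      ring
    rw [this]; linarith
  -- The argument is written as `εi w` with `w = -2εi √β √x`; `Re w = 2√x · ε Im √β` is positive by
  -- hypothesis.
  have e : 2 * (β * (x : ℂ)) ^ (1 / 2 : ℂ) =
      ((ε : ℤ) : ℂ) * I * (-2 * (((ε : ℤ) : ℂ) * I) * β ^ (1 / 2 : ℂ) * (√x : ℝ)) := by
    rw [mul_ofReal_cpow hβ0 hx, hx2]
    linear_combination (2 * β ^ (1 / 2 : ℂ) * (√x : ℝ)) * intUnits_mul_I_sq ε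
  have e4 : ((β * (x : ℂ)) ^ (1 / 4 : ℂ)) ^ 2 = β ^ (1 / 2 : ℂ) * (√x : ℝ) := by
    rw [← cpow_nat_mul, show ((2 : ℕ) : ℂ) * (1 / 4) = 1 / 2 by norm_num,
      mul_ofReal_cpow hβ0 hx, hx2]
  rw [zeroEnergySolution, e, hankelH1_eq ε hre, hμ _ (Or.inl hre), mul_pow, e4]
  ring

/-- The substitution `x = t²` turns `√x dx` into `2t² dt`, so this is the diagonal integral at `a =
-2εi√β`, where `a³ = 8εi √β · β`. -/
theorem integral_zeroEnergySolution_sq {ε : ℤˣ} {β m μ : ℂ}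
    (hβ : 0 < ((ε : ℤ) : ℝ) * (β ^ (1 / 2 : ℂ)).im)
    (hμ : ∀ z ∈ slitPlane, macdonaldK1 (2 * m) z = besselF μ z) (h0 : 0 ≤ μ.re) (h2 : μ.re < 2) :
    IntegrableOn (fun x : ℝ => zeroEnergySolution ε β m x ^ 2) (Ioi 0) ∧
    ∫ x in Ioi (0 : ℝ), zeroEnergySolution ε β m x ^ 2 =
      -Complex.exp (-(((ε : ℤ) : ℂ) * 2 * I * (Real.pi : ℂ) * m)) * rationalIntegral 1 μ /
        (Real.pi * β) := by
  set s := β ^ (1 / 2 : ℂ) with hs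
  set J := ((ε : ℤ) : ℂ) * I with hJ
  have hβ0 : β ≠ 0 := by
    rintro rfl
    simp [hs] at hβ
  have hs2 : s ^ 2 = β := by
    rw [hs, ← cpow_nat_mul]; norm_num
  have hJ2 : J ^ 2 = -1 := intUnits_mul_I_sq ε
  have hpi : (Real.pi : ℂ) ≠ 0 := ofReal_ne_zero.2 Real.pi_ne_zero
  set a := -2 * J * s with ha
  have hare : 0 < a.re := by
    have : a.re = 2 * (((ε : ℤ) : ℝ) * s.im) := by
      rw [ha, hJ]
      simp [mul_re, mul_im]
      ring
    rw [this]; linarith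
  set k := s * hankelFactor ε (2 * m) ^ 2 with hk
  let g : ℝ → ℂ := fun x => k * ((√x : ℂ) * besselF μ (a * (√x : ℝ)) ^ 2)
  have hg : ∀ x ∈ Ioi (0 : ℝ), zeroEnergySolution ε β m x ^ 2 = g x := fun x hx =>
    zeroEnergySolution_sq hβ hμ hx
  have hcomp : ∀ t ∈ Ioi (0 : ℝ), (2 * t ^ ((2 : ℝ) - 1)) • g (t ^ (2 : ℝ)) =
      2 * k * besselProd μ a a t := by
    intro t ht
    have ht0 : 0 < t := ht
    simp only [g]
    rw [Real.rpow_two, Real.sqrt_sq ht0.le, show (2 : ℝ) - 1 = 1 by norm_num, Real.rpow_one,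
      real_smul, besselProd]
    push_cast
    ring
  have hI := integrableOn_besselProd (m := μ) (by linarith) h2 (a := a) (b := a) (Or.inl hare)
    (Or.inl hare) (by rw [add_re]; linarith)
  constructor
  · rw [integrableOn_congr_fun hg measurableSet_Ioi,
      ← integrableOn_Ioi_comp_rpow_iff g two_ne_zero]
    rw [abs_two, integrableOn_congr_fun hcomp measurableSet_Ioi]
    exact hI.const_mul _
  · have hself := integral_besselProd_self (m := μ) (by linarith) h2 hare
    have ha3 : a ^ 3 = 8 * J * s * β := by
      rw [ha, ← hs2]; linear_combination (-8 * J * s ^ 3) * hJ2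
    rw [setIntegral_congr_fun measurableSet_Ioi hg, ← integral_comp_rpow_Ioi_of_pos two_pos,
      setIntegral_congr_fun measurableSet_Ioi hcomp, integral_const_mul, hk,
      hankelFactor_two_mul_sq]
    rw [ha3] at hself
    generalize Complex.exp (-(((ε : ℤ) : ℂ) * 2 * I * (Real.pi : ℂ) * m)) = E
    rw [eq_div_iff (mul_ne_zero hpi hβ0)]
    rw [← hJ]
    linear_combination (-(1 / 4) * E) * hself

theorem exp_neg_pi_mul_eq_neg_one (ε : ℤˣ) {m : ℂ} (hm : m = 1 / 2 ∨ m = -1 / 2) :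
    Complex.exp (-(((ε : ℤ) : ℂ) * 2 * I * (Real.pi : ℂ) * m)) = -1 := by
  have h1 : ∀ z : ℂ, z = Real.pi * I ∨ z = -(Real.pi * I) → Complex.exp z = -1 := by
    rintro z (rfl | rfl)
    · exact Complex.exp_pi_mul_I
    · rw [Complex.exp_neg, Complex.exp_pi_mul_I]; norm_num
  apply h1
  rcases Int.units_eq_one_or ε with rfl | rfl <;> rcases hm with rfl | rfl
  · right; simp; ring
  · left; simp; ring
  · left; simp; ring
  · right; simp; ring

theorem propositionB3 :
    -- the integral of the square of the zero energy solution
    (∀ (ε : ℤˣ) (β m : ℂ), 0 < ((ε : ℤ) : ℝ) * (β ^ (1 / 2 : ℂ)).im → |m.re| < 1 →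
      IntegrableOn (fun x : ℝ => zeroEnergySolution ε β m x ^ 2) (Ioi 0) ∧
      (m ≠ 0 → m ≠ 1 / 2 → m ≠ -1 / 2 →
        ∫ x in Ioi (0 : ℝ), zeroEnergySolution ε β m x ^ 2 =
          m * (4 * m ^ 2 - 1) * Complex.exp (-(((ε : ℤ) : ℂ) * 2 * I * (Real.pi : ℂ) * m)) /
            (3 * β * Complex.sin (2 * (Real.pi : ℂ) * m))) ∧
      (m = 0 →
        ∫ x in Ioi (0 : ℝ), zeroEnergySolution ε β m x ^ 2 = -1 / (6 * (Real.pi : ℂ) * β)) ∧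
      (m = 1 / 2 ∨ m = -1 / 2 →
        ∫ x in Ioi (0 : ℝ), zeroEnergySolution ε β m x ^ 2 = 1 / (3 * (Real.pi : ℂ) * β))) ∧
    -- the integral of `x² K_m(a x) K_m(b x)` and its limiting cases
    (∀ a b m : ℂ, a ∈ slitPlane → b ∈ slitPlane → 0 < (a + b).re → |m.re| < 1 →
      IntegrableOn
        (fun x : ℝ => (x : ℂ) ^ 2 * macdonaldK1 m (a * (x : ℂ)) * macdonaldK1 m (b * (x : ℂ)))
        (Ioi 0) ∧
      (a ≠ b → m ≠ 0 →
        ∫ x in Ioi (0 : ℝ),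
            (x : ℂ) ^ 2 * macdonaldK1 m (a * (x : ℂ)) * macdonaldK1 m (b * (x : ℂ)) =
          4 * a ^ (1 / 2 - m) * b ^ (1 / 2 - m) *
              ((m - 1) * (a ^ (2 * m + 2) - b ^ (2 * m + 2)) +
                (m + 1) * a ^ 2 * b ^ 2 * (b ^ (2 * m - 2) - a ^ (2 * m - 2))) /
            (Complex.sin ((Real.pi : ℂ) * m) * (b ^ 2 - a ^ 2) ^ 3)) ∧
      (a ≠ b → m = 0 →
        ∫ x in Ioi (0 : ℝ),
            (x : ℂ) ^ 2 * macdonaldK1 m (a * (x : ℂ)) * macdonaldK1 m (b * (x : ℂ)) =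
          -(8 * a ^ (1 / 2 : ℂ) * b ^ (1 / 2 : ℂ)) / ((Real.pi : ℂ) * (b ^ 2 - a ^ 2) ^ 2) +
            8 * a ^ (1 / 2 : ℂ) * b ^ (1 / 2 : ℂ) * (a ^ 2 + b ^ 2) /
                ((Real.pi : ℂ) * (b ^ 2 - a ^ 2) ^ 3) *
              (Complex.log b - Complex.log a)) ∧
      (a = b → m ≠ 0 →
        ∫ x in Ioi (0 : ℝ),
            (x : ℂ) ^ 2 * macdonaldK1 m (a * (x : ℂ)) * macdonaldK1 m (b * (x : ℂ)) =
          2 * m * (1 - m ^ 2) / (3 * a ^ 3 * Complex.sin ((Real.pi : ℂ) * m))) ∧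
      (a = b → m = 0 →
        ∫ x in Ioi (0 : ℝ),
            (x : ℂ) ^ 2 * macdonaldK1 m (a * (x : ℂ)) * macdonaldK1 m (b * (x : ℂ)) =
          2 / (3 * (Real.pi : ℂ) * a ^ 3))) := by

  constructor
  · intro ε β m hβ hm
    have hm2 : |(2 * m).re| < 2 := by
      rw [show (2 * m).re = 2 * m.re by simp, abs_mul, abs_two]; linarith
    obtain ⟨μ, hμ, h0, h2, hK⟩ := exists_index_macdonaldK1_eq_besselF_of_abs_re_lt_two hm2
    obtain ⟨hint, hval⟩ := integral_zeroEnergySolution_sq hβ hK h0 h2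
    have hpi : (Real.pi : ℂ) ≠ 0 := ofReal_ne_zero.2 Real.pi_ne_zero
    refine ⟨hint, fun m0 m1 m2 => ?_, fun m0 => ?_, fun m1 => ?_⟩
    · have hz : ∀ n : ℤ, 2 * m ≠ n := by
        intro n hn
        rw [hn, intCast_re, ← Int.cast_abs] at hm2
        have h1 : |n| < 2 := by exact_mod_cast hm2
        have h3 := abs_lt.1 h1
        -- The only integers in reach are `2m = -1, 0, 1`: exactly the three excluded values of `m`.
        obtain rfl | rfl | rfl : n = -1 ∨ n = 0 ∨ n = 1 := by lia
        · exact m2 (by push_cast at hn; linear_combination hn / 2)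
        · exact m0 (by push_cast at hn; linear_combination hn / 2)
        · exact m1 (by push_cast at hn; linear_combination hn / 2)
      have hsin := sin_pi_mul_ne_zero_of_ne_intCast hz
      rw [hval, rationalIntegral_one_eq_of_eq_or_eq_neg hμ ⟨by linarith, h2⟩ hz,
        show 2 * (Real.pi : ℂ) * m = Real.pi * (2 * m) by ring]
      generalize Complex.sin (Real.pi * (2 * m)) = S at *
      field_simp
      ring
    · subst m0
      have hμ0 : μ = 0 := by simpa using hμ
      rw [hval, hμ0, rationalIntegral_one_zero, mul_zero, neg_zero, Complex.exp_zero]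
      field_simp
    · have hμ1 : μ = 1 := by
        rcases m1 with rfl | rfl <;> rcases hμ with rfl | rfl
        · norm_num
        · norm_num at h0
        · norm_num at h0
        · norm_num
      rw [hval, hμ1, rationalIntegral_one_one, exp_neg_pi_mul_eq_neg_one ε m1]
      field_simp
  · intro a b m ha hb hab hm
    obtain ⟨μ, hμ, h0, h2, hK⟩ := exists_index_macdonaldK1_eq_besselF_of_abs_re_lt_two (m := m) (by linarith)
    have ha0 := slitPlane_ne_zero ha
    have hb0 := slitPlane_ne_zero hb
    have hpi : (Real.pi : ℂ) ≠ 0 := ofReal_ne_zero.2 Real.pi_ne_zero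
    have hcongr : ∀ x ∈ Ioi (0 : ℝ), (x : ℂ) ^ 2 * macdonaldK1 m (a * (x : ℂ)) *
        macdonaldK1 m (b * (x : ℂ)) = besselProd μ a b x := fun x hx => by
      rw [besselProd, hK _ (mul_ofReal_mem_slitPlane ha hx),
        hK _ (mul_ofReal_mem_slitPlane hb hx)]
    have hd : a ≠ b → b ^ 2 - a ^ 2 ≠ 0 := by
      intro hne h
      have h3 : (b - a) * (a + b) = 0 := by linear_combination h
      rcases mul_eq_zero.1 h3 with h4 | h4
      · exact hne (sub_eq_zero.1 h4).symm
      · rw [h4] at hab; simp at hab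
    rw [integrableOn_congr_fun hcongr measurableSet_Ioi,
      setIntegral_congr_fun measurableSet_Ioi hcongr]
    refine ⟨integrableOn_besselProd (by linarith) h2 ha hb hab, fun hne m0 => ?_, fun hne m0 => ?_,
      fun he m0 => ?_, fun he m0 => ?_⟩
    · have hsin := sin_pi_mul_ne_zero_of_ne_intCast (ne_intCast_of_abs_re_lt_one hm m0)
      have h := sin_mul_integral_besselProd (by linarith) h2 ha hb hab
      rw [eq_div_iff (mul_ne_zero hsin (pow_ne_zero 3 (hd hne)))]
      change _ = besselProdNumerator m a b
      rcases hμ with rfl | rfl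
      · rw [← h]; ring
      · rw [besselProdNumerator_neg m ha0 hb0, mul_neg, Complex.sin_neg] at h
        linear_combination -h
    · subst m0
      have hμ0 : μ = 0 := by simpa using hμ
      subst hμ0
      have h := pi_mul_integral_besselProd_zero ha hb hab
      have hd' := hd hne
      generalize a ^ (1 / 2 : ℂ) = A at *
      generalize b ^ (1 / 2 : ℂ) = B at *
      generalize Complex.log a = La at *
      generalize Complex.log b = Lb at *
      have h5 : ∫ x in Ioi (0 : ℝ), besselProd 0 a b x =
          8 * A * B * ((a ^ 2 + b ^ 2) * (Lb - La) - (b ^ 2 - a ^ 2)) /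
            ((Real.pi : ℂ) * (b ^ 2 - a ^ 2) ^ 3) := by
        rw [eq_div_iff (mul_ne_zero hpi (pow_ne_zero 3 hd')), ← h]; ring
      rw [h5]
      generalize b ^ 2 - a ^ 2 = D at *
      field_simp
      ring
    · subst he
      have hz := ne_intCast_of_abs_re_lt_one hm m0
      have hsin := sin_pi_mul_ne_zero_of_ne_intCast hz
      have hre : 0 < a.re := by rw [add_re] at hab; linarith
      have h := integral_besselProd_self (by linarith) h2 hre
      rw [rationalIntegral_one_eq_of_eq_or_eq_neg hμ ⟨by linarith, h2⟩ hz] at h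
      generalize Complex.sin (Real.pi * m) = S at *
      rw [eq_div_iff (mul_ne_zero (mul_ne_zero three_ne_zero (pow_ne_zero 3 ha0)) hsin)]
      field_simp at h
      linear_combination h / 2
    · subst he
      subst m0
      have hμ0 : μ = 0 := by simpa using hμ
      have hre : 0 < a.re := by rw [add_re] at hab; linarith
      have h := integral_besselProd_self (by linarith) h2 hre
      rw [hμ0, rationalIntegral_one_zero] at h
      rw [hμ0, eq_div_iff (mul_ne_zero (mul_ne_zero three_ne_zero hpi) (pow_ne_zero 3 ha0))]
      linear_combination 3 * h
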